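/- **Setting.** Let $\Omega=(l_1,l_2)\times(l_3,l_4)$, let $\psi$ be smooth in $\Omega$, and put $\Gamma=\{\psi=0\}$, $\Omega^{+}=\{\psi>0\}$, $\Omega^{-}=\{\psi<0\}$ (subsets of $\Omega$), with $\nabla\psi\neq 0$ on $\Gamma$. Let $\vec n=\nabla\psi/|\nabla\psi|$ be the unit normal of $\Gamma$ pointing towards $\Omega^+$, and let $[\,\cdot\,]$ be the limit from $\Omega^+$ minus the limit from $\Omega^-$. Consider $$-\nabla\cdot(a\nabla u)=f \text{ in }\Omega\setminus\Gamma,\qquad [u]=g_1,\quad [a\nabla u\cdot\vec n]=g_2\ \text{ on }\Gamma,\qquad u=g\text{ on }\partial\Omega ,$$ (the boundary condition being imposed off $\overline\Gamma$), where $a>0$ and $f$ are smooth in each of $\Omega^\pm$ with all partial derivatives having one-sided limits on $\Gamma$, and $g_1,g_2,g$ are smooth. Fix an integer $M\ge 1$. The solution $u$ is assumed to have uniformly continuous partial derivatives of total order up to $M+1$ in each of $\Omega^+$ and $\Omega^-$. Fix a base point $(x^*,y^*)\in\Gamma$. Near it, $\Gamma$ is parametrized by $x=r(t)+x^*$, $y=s(t)+y^*$,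 $t\in(-\epsilon,\epsilon)$, with $r,s$ smooth, $r(0)=s(0)=0$ and $r'(t)^2+s'(t)^2>0$. Write $v_\pm^{(m,n)}$ for the limit at $(x^*,y^*)$ from $\Omega^\pm$ of $\partial^{m+n}v/\partial x^m\partial y^n$ ($v=u,a,f$), write $g_i^{(m,n)}$ for the corresponding derivatives of $g_1,g_2$ at $(x^*,y^*)$, and assume $a_\pm^{(0,0)}>0$. Put $\Lambda_K=\{(m,n)\in\mathbb{Z}_{\ge0}^2: m+n\le K\}$ and $\Lambda_K^1=\{(m,n)\in\Lambda_K: m\in\{0,1\}\}$. Let $\sigma=1$ if $(s'(0),-r'(0))$ points towards $\Omega^+$, and $\sigma=-1$ if it points towards $\Omega^-$. **Theorem.** Let arbitrary values of $r^{(k)}(0),s^{(k)}(0)$ ($0\le k\le M+1$) and $a_\pm^{(m,n)}$ ($(m,n)\in\Lambda_M$) be given, subject to $r(0)=s(0)=0$, $r'(0)^2+s'(0)^2>0$ and $a_\pm^{(0,0)}>0$. Then there is exactly one family of real numbers $T^{u_+}_{m',n',m,n}$, $T^{\pm}_{m',n',m,n}$, $T^{g_1}_{m',n',m,n}$, $T^{g_2}_{m',n',m,n}$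 such that, for every interface problem, solution, base point and parametrization as above having these values, $$\begin{aligned}u_-^{(m',n')}={}&\sum_{(m,n)\in\Lambda^1_{M+1}}T^{u_+}_{m',n',m,n}\,u_+^{(m,n)}+\sum_{(m,n)\in\Lambda_{M-1}}\Big(T^{+}_{m',n',m,n}f_+^{(m,n)}+T^{-}_{m',n',m,n}f_-^{(m,n)}\Big)\\&+\sum_{(m,n)\in\Lambda_{M+1}}T^{g_1}_{m',n',m,n}\,g_1^{(m,n)}+\sigma\sum_{(m,n)\in\Lambda_{M}}T^{g_2}_{m',n',m,n}\,g_2^{(m,n)}\qquad\text{for all }(m',n')\in\Lambda^1_{M+1}.\end{aligned}$$ In particular the transmission coefficients are uniquely determined by the derivatives $r^{(k)}(0),s^{(k)}(0)$, $k\le M+1$, and $a_\pm^{(m,n)}$, $(m,n)\in\Lambda_M$. -/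

import Mathlib

open Set Filter Topology
open scoped ContDiff

namespace EllipticInterface

noncomputable section

/-- The partial derivative `∂v/∂x`. -/
def dX (v : ℝ × ℝ → ℝ) (p : ℝ × ℝ) : ℝ := fderiv ℝ v p (1, 0)

/-- The partial derivative `∂v/∂y`. -/
def dY (v : ℝ × ℝ → ℝ) (p : ℝ × ℝ) : ℝ := fderiv ℝ v p (0, 1)

/-- The partial derivative `∂^(m+n) v / ∂x^m ∂y^n`. -/
def pd (m n : ℕ) (v : ℝ × ℝ → ℝ) : ℝ × ℝ → ℝ := dX^[m] (dY^[n] v)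

/-- The value at a point `p` of the closure of the open region `R` of the partial derivative
`∂^(m+n) v / ∂x^m ∂y^n`, as a limit from inside `R`. -/
def sideDeriv (R : Set (ℝ × ℝ)) (v : ℝ × ℝ → ℝ) (p : ℝ × ℝ) (m n : ℕ) : ℝ :=
  limUnder (𝓝[R] p) (pd m n v)

/-- `Λ_K`: the pairs `(m, n)` of nonnegative integers with `m + n ≤ K`. -/
def Lam (K : ℕ) : Finset (ℕ × ℕ) :=
  (Finset.range (K + 1) ×ˢ Finset.range (K + 1)).filter (fun i => i.1 + i.2 ≤ K)

/-- `Λ_K^1`: the pairs `(m, n)` in `Λ_K` with `m ∈ {0, 1}`. -/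
def Lam1 (K : ℕ) : Finset (ℕ × ℕ) := (Lam K).filter (fun i => i.1 ≤ 1)

/-- `v` is smooth in the open region `R` and all its partial derivatives have limits, from inside
`R`, at the points of `S`. -/
def SmoothUpTo (R S : Set (ℝ × ℝ)) (v : ℝ × ℝ → ℝ) : Prop :=
  ContDiffOn ℝ ∞ v R ∧
    ∀ m n : ℕ, ∀ p ∈ S, ∃ l : ℝ, Tendsto (pd m n v) (𝓝[R] p) (𝓝 l)

/-- `v` has uniformly continuous partial derivatives of total order up to `k` in the open
region `R`. -/
def UniformlySmooth (k : ℕ) (R : Set (ℝ × ℝ)) (v : ℝ × ℝ → ℝ) : Prop :=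
  ContDiffOn ℝ (k : WithTop ℕ∞) v R ∧
    ∀ m n : ℕ, m + n ≤ k → UniformContinuousOn (pd m n v) R

/-- The data of an elliptic interface problem in the rectangle `(l₁, l₂) × (l₃, l₄)`:
level set function `ψ`, coefficient `a`, source `f`, jump data `g₁`, `g₂`, boundary data `g`. -/
structure InterfaceProblem where
  l₁ : ℝ
  l₂ : ℝ
  l₃ : ℝ
  l₄ : ℝ
  ψ : ℝ × ℝ → ℝ
  a : ℝ × ℝ → ℝ
  f : ℝ × ℝ → ℝ
  g₁ : ℝ × ℝ → ℝ
  g₂ : ℝ × ℝ → ℝ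
  g : ℝ × ℝ → ℝ

namespace InterfaceProblem

variable (P : InterfaceProblem)

/-- The rectangle `Ω`. -/
def Ω : Set (ℝ × ℝ) := Ioo P.l₁ P.l₂ ×ˢ Ioo P.l₃ P.l₄

/-- The interface `Γ`. -/
def Γ : Set (ℝ × ℝ) := {p | p ∈ P.Ω ∧ P.ψ p = 0}

/-- The subregion `Ω⁺`. -/
def Ωp : Set (ℝ × ℝ) := {p | p ∈ P.Ω ∧ 0 < P.ψ p}

/-- The subregion `Ω⁻`. -/
def Ωm : Set (ℝ × ℝ) := {p | p ∈ P.Ω ∧ P.ψ p < 0}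

/-- The unit normal of `Γ` pointing towards `Ω⁺`. -/
def normal (p : ℝ × ℝ) : ℝ × ℝ :=
  (dX P.ψ p / √(dX P.ψ p ^ 2 + dY P.ψ p ^ 2), dY P.ψ p / √(dX P.ψ p ^ 2 + dY P.ψ p ^ 2))

/-- The standing assumptions on the data. The level set function is regular along `Γ`, so that
`Γ` is a smooth curve. -/
structure Regular : Prop where
  smooth_ψ : ContDiffOn ℝ ∞ P.ψ P.Ω
  grad_ψ : ∀ p ∈ P.Γ, (dX P.ψ p, dY P.ψ p) ≠ (0, 0)
  smooth_a_pos : SmoothUpTo P.Ωp P.Γ P.a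
  smooth_a_neg : SmoothUpTo P.Ωm P.Γ P.a
  pos_a : ∀ p ∈ P.Ωp ∪ P.Ωm, 0 < P.a p
  smooth_f_pos : SmoothUpTo P.Ωp P.Γ P.f
  smooth_f_neg : SmoothUpTo P.Ωm P.Γ P.f
  smooth_g₁ : ContDiffOn ℝ ∞ P.g₁ P.Ω
  smooth_g₂ : ContDiffOn ℝ ∞ P.g₂ P.Ω
  smooth_g : ContDiff ℝ ∞ P.g

/-- The jump `[F](p)` across `Γ` (limit from `Ω⁺` minus limit from `Ω⁻`) exists and equals `c`. -/
def HasJump (F : ℝ × ℝ → ℝ) (p : ℝ × ℝ) (c : ℝ) : Prop :=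
  ∃ lp lm : ℝ, Tendsto F (𝓝[P.Ωp] p) (𝓝 lp) ∧ Tendsto F (𝓝[P.Ωm] p) (𝓝 lm) ∧ lp - lm = c

/-- `u` solves `-∇·(a∇u) = f` in `Ω \ Γ`, `[u] = g₁` and `[a∇u·n] = g₂` on `Γ`, `u = g` on `∂Ω`,
and has uniformly continuous partial derivatives up to order `k` in `Ω⁺` and in `Ω⁻`.
The boundary values of `u` are taken as limits from inside, away from end points of `Γ`. -/
structure IsSolution (k : ℕ) (u : ℝ × ℝ → ℝ) : Prop where
  smooth_pos : UniformlySmooth k P.Ωp u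
  smooth_neg : UniformlySmooth k P.Ωm u
  pde : ∀ p ∈ P.Ω \ P.Γ,
    -(dX (fun q => P.a q * dX u q) p + dY (fun q => P.a q * dY u q) p) = P.f p
  jump : ∀ p ∈ P.Γ, P.HasJump u p (P.g₁ p)
  jump_flux : ∀ p ∈ P.Γ,
    P.HasJump (fun q => P.a q * (dX u q * (P.normal p).1 + dY u q * (P.normal p).2)) p (P.g₂ p)
  boundary : ∀ p ∈ frontier P.Ω \ closure P.Γ, Tendsto u (𝓝[P.Ω] p) (𝓝 (P.g p))

/-- `t ↦ b + (r t, s t)`, `t ∈ (-ε, ε)` for some `ε > 0`, is a smooth regular parametrization of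
the interface near its point `b`, with `t = 0` at `b`. -/
structure IsParam (b : ℝ × ℝ) (r s : ℝ → ℝ) : Prop where
  r_zero : r 0 = 0
  s_zero : s 0 = 0
  exists_param : ∃ ε > 0, ContDiffOn ℝ ∞ r (Ioo (-ε) ε) ∧ ContDiffOn ℝ ∞ s (Ioo (-ε) ε) ∧
    ∀ t ∈ Ioo (-ε) ε, 0 < deriv r t ^ 2 + deriv s t ^ 2 ∧ b + (r t, s t) ∈ P.Γ

/-- The orientation of the parametrization: `1` if the normal vector `(s'(0), -r'(0))` points
towards `Ω⁺` and `-1` if it points towards `Ω⁻`. -/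
def orientation (b : ℝ × ℝ) (r s : ℝ → ℝ) : ℝ :=
  Real.sign (dX P.ψ b * deriv s 0 - dY P.ψ b * deriv r 0)

end InterfaceProblem

/-- Values for the derivatives `r^(k)(0)`, `s^(k)(0)`, `k ≤ M + 1`, and for the derivatives
`a_±^(m,n)`, `(m, n) ∈ Λ_M`, at the base point. -/
@[ext] structure Jet (M : ℕ) where
  r : Fin (M + 2) → ℝ
  s : Fin (M + 2) → ℝ
  ap : Lam M → ℝ
  am : Lam M → ℝ

/-- The values of a jet are possible: base point at `t = 0`, regular curve, positive `a_±`. -/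
structure Jet.Admissible {M : ℕ} (J : Jet M) : Prop where
  r_zero : J.r 0 = 0
  s_zero : J.s 0 = 0
  regular : 0 < J.r 1 ^ 2 + J.s 1 ^ 2
  ap_pos : ∀ i : Lam M, i.1 = (0, 0) → 0 < J.ap i
  am_pos : ∀ i : Lam M, i.1 = (0, 0) → 0 < J.am i

/-- The derivatives at the base point `b` of a parametrization and of the coefficient. -/
def InterfaceProblem.jet (P : InterfaceProblem) (M : ℕ) (b : ℝ × ℝ) (r s : ℝ → ℝ) : Jet M where
  r := fun k => iteratedDeriv k r 0
  s := fun k => iteratedDeriv k s 0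
  ap := fun i => sideDeriv P.Ωp P.a b i.1.1 i.1.2
  am := fun i => sideDeriv P.Ωm P.a b i.1.1 i.1.2

/-- A family of transmission coefficients `T^{u_+}`, `T^+`, `T^-`, `T^{g_1}`, `T^{g_2}`. -/
@[ext] structure Transmission (M : ℕ) where
  Tu : Lam1 (M + 1) → Lam1 (M + 1) → ℝ
  Tp : Lam1 (M + 1) → Lam (M - 1) → ℝ
  Tm : Lam1 (M + 1) → Lam (M - 1) → ℝ
  Tg₁ : Lam1 (M + 1) → Lam (M + 1) → ℝ
  Tg₂ : Lam1 (M + 1) → Lam M → ℝ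

/-- The transmission identities at the base point `b` hold with the coefficients `T`; the unit
normal pointing towards `Ω⁺` is `σ (s', -r') / |(s', -r')|` with the orientation `σ`. -/
def Transmission.Holds {M : ℕ} (T : Transmission M) (P : InterfaceProblem) (u : ℝ × ℝ → ℝ)
    (b : ℝ × ℝ) (r s : ℝ → ℝ) : Prop :=
  ∀ j : Lam1 (M + 1),
    sideDeriv P.Ωm u b j.1.1 j.1.2 =
      ∑ i : Lam1 (M + 1), T.Tu j i * sideDeriv P.Ωp u b i.1.1 i.1.2
      + ∑ i : Lam (M - 1), (T.Tp j i * sideDeriv P.Ωp P.f b i.1.1 i.1.2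
          + T.Tm j i * sideDeriv P.Ωm P.f b i.1.1 i.1.2)
      + ∑ i : Lam (M + 1), T.Tg₁ j i * pd i.1.1 i.1.2 P.g₁ b
      + P.orientation b r s * ∑ i : Lam M, T.Tg₂ j i * pd i.1.1 i.1.2 P.g₂ b

end

end EllipticInterface

open EllipticInterface

namespace EllipticInterface

noncomputable section

/-! Only derivatives at the base point enter, so existence is linear algebra on arrays of
derivatives of order at most `M + 1`. In `Ω⁺` the equation, differentiated up to order `M - 1`,
expresses every entry of `u_+` through those with `m ≤ 1` and `f_+`, because `a_+ ≠ 0`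
(`leftEquiv`). The jump conditions, differentiated along the curve, then give the derivatives of the
trace of `u_-` up to order `M + 1` and of its flux up to order `M`. Together with `f_-` these Cauchy
data determine the array of `u_-` (`cauchyEquiv`).

Both systems are square (`card_Lam`, `card_Lam1`), so injectivity suffices. For a homogeneous
solution, argue by induction on the order `N`: once all lower entries vanish, the equation at order
`N` reads `a (c (m+2) n + c m (n+2)) = 0`. The leading form is thus harmonic, `A Re z^N + B Im z^N`.
At `z = r'(0) + i s'(0)`, the `N`-th derivative of the trace is `A Re z^N + B Im z^N`
(`tr_harmonic`), and the derivative of order `N - 1` of the flux is `a (A Im z^N - B Re z^N)`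
(`fl_harmonic`). The determinant is `-a |z|^(2N)`, which is not zero, so `A = B = 0`.

That actual solutions satisfy these systems rests on a chain rule for one-sided limits along a
boundary curve (`hasDerivAt_trace`), on the Leibniz rule (`pd_mul`), and on the fact that near the
base point the normal is `σ (s', -r') / |(s', -r')|` with constant `σ` (`eventually_normal_eq`).

Uniqueness holds because the data are free (`exists_data_eq`): for any data the two systems are
solved for arrays, polynomials with these arrays are cut off to give `u_±`, and the source is read
off from them. The jumps along the curve then agree with polynomials `q₁`, `q₂` carrying the
prescribed derivatives, up to defects that vanish at the base point to order `M + 1` and `M`.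
Extending the defects off the curve by a smooth parameter function `τ` and adding them to `q₁`, `q₂`
makes the jump conditions exact without changing any relevant derivative. -/

/-- Arrays `c m n` of formal values of the derivatives `∂^(m+n) / ∂x^m ∂y^n` at a point. -/
abbrev DerivArray : Type := ℕ → ℕ → ℝ

/-! ### Formal calculus on arrays of derivatives -/

namespace DerivArray

/-- The array of the derivative in `x`. -/
def shX : DerivArray →ₗ[ℝ] DerivArray where
  toFun c := fun m n => c (m + 1) n
  map_add' _ _ := rfl
  map_smul' _ _ := rfl

/-- The array of the derivative in `y`. -/
def shY : DerivArray →ₗ[ℝ] DerivArray where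
  toFun c := fun m n => c m (n + 1)
  map_add' _ _ := rfl
  map_smul' _ _ := rfl

/-- The array of a product, by the Leibniz rule. -/
def mulA (a : DerivArray) : DerivArray →ₗ[ℝ] DerivArray where
  toFun c := fun m n => ∑ i ∈ Finset.range (m + 1), (m.choose i : ℝ) *
    ∑ j ∈ Finset.range (n + 1), (n.choose j : ℝ) * (a i j * c (m - i) (n - j))
  map_add' c d := by
    funext m n
    simp only [Pi.add_apply, mul_add, Finset.sum_add_distrib]
  map_smul' k c := by
    funext m n
    simp only [Pi.smul_apply, smul_eq_mul, RingHom.id_apply, Finset.mul_sum]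
    refine Finset.sum_congr rfl fun i _ => Finset.sum_congr rfl fun j _ => by ring

@[simp] lemma shX_apply (c : DerivArray) (m n : ℕ) : shX c m n = c (m + 1) n := rfl

@[simp] lemma shY_apply (c : DerivArray) (m n : ℕ) : shY c m n = c m (n + 1) := rfl

lemma mulA_apply (a c : DerivArray) (m n : ℕ) :
    mulA a c m n = ∑ i ∈ Finset.range (m + 1), (m.choose i : ℝ) *
      ∑ j ∈ Finset.range (n + 1), (n.choose j : ℝ) * (a i j * c (m - i) (n - j)) := rfl

/-- The `k`-th derivative at `0` of a function along a curve, in terms of the arrays of derivatives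
of the function and the derivatives `ρ`, `ς` of the coordinates of the curve. -/
def tr (ρ ς : ℕ → ℝ) : ℕ → DerivArray →ₗ[ℝ] ℝ
  | 0 => (LinearMap.proj 0).comp (LinearMap.proj (R := ℝ) (φ := fun _ : ℕ => ℕ → ℝ) 0)
  -- Leibniz rule for the `k`-th derivative of `v_x r' + v_y s'`. The shift in `k - j + 1` appears
  -- because `ρ`, `ς` list the derivatives of `r`, `s` and not of `r'`, `s'`.
  | k + 1 => ∑ j : Fin (k + 1), (k.choose j : ℝ) •
      (ρ (k - j + 1) • (tr ρ ς j).comp shX + ς (k - j + 1) • (tr ρ ς j).comp shY)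

@[simp] lemma tr_zero (ρ ς : ℕ → ℝ) (c : DerivArray) : tr ρ ς 0 c = c 0 0 := by
  simp [tr]

lemma tr_succ (ρ ς : ℕ → ℝ) (k : ℕ) (c : DerivArray) :
    tr ρ ς (k + 1) c = ∑ j ∈ Finset.range (k + 1), (k.choose j : ℝ) *
      (ρ (k - j + 1) * tr ρ ς j (shX c) + ς (k - j + 1) * tr ρ ς j (shY c)) := by
  rw [tr, Finset.sum_range]
  simp [mul_add]

/-- The derivatives along a curve of `a ∂u/∂x s' - a ∂u/∂y r'`. -/
def fl (ρ ς : ℕ → ℝ) (a : DerivArray) (k : ℕ) : DerivArray →ₗ[ℝ] ℝ :=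
  ∑ j ∈ Finset.range (k + 1), (k.choose j : ℝ) •
    (ς (k - j + 1) • (tr ρ ς j).comp ((mulA a).comp shX)
      - ρ (k - j + 1) • (tr ρ ς j).comp ((mulA a).comp shY))

lemma fl_apply (ρ ς : ℕ → ℝ) (a : DerivArray) (k : ℕ) (c : DerivArray) :
    fl ρ ς a k c = ∑ j ∈ Finset.range (k + 1), (k.choose j : ℝ) *
      (ς (k - j + 1) * tr ρ ς j (mulA a (shX c)) - ρ (k - j + 1) * tr ρ ς j (mulA a (shY c))) := by
  simp [fl]

/-- The derivatives along a curve of the product of a function with a function on the curve that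
has the derivatives `N`. -/
def gr (ρ ς N : ℕ → ℝ) (k : ℕ) : DerivArray →ₗ[ℝ] ℝ :=
  ∑ j ∈ Finset.range (k + 1), (k.choose j : ℝ) • (N (k - j) • tr ρ ς j)

lemma gr_apply (ρ ς N : ℕ → ℝ) (k : ℕ) (c : DerivArray) :
    gr ρ ς N k c = ∑ j ∈ Finset.range (k + 1), (k.choose j : ℝ) * (N (k - j) * tr ρ ς j c) := by
  simp [gr]

/-- The array of `∇ · (a ∇ u)`. -/
def ell (a : DerivArray) : DerivArray →ₗ[ℝ] DerivArray :=
  shX.comp ((mulA a).comp shX) + shY.comp ((mulA a).comp shY)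

lemma ell_apply (a c : DerivArray) (m n : ℕ) :
    ell a c m n = mulA a (shX c) (m + 1) n + mulA a (shY c) m (n + 1) := rfl

/-! ### Dependence on finitely many entries -/

lemma mulA_congr {a a' c c' : DerivArray} {m n : ℕ}
    (ha : ∀ i j, i + j ≤ m + n → a i j = a' i j) (hc : ∀ i j, i + j ≤ m + n → c i j = c' i j) :
    mulA a c m n = mulA a' c' m n := by
  rw [mulA_apply, mulA_apply]
  refine Finset.sum_congr rfl fun i hi => ?_
  congr 1
  refine Finset.sum_congr rfl fun j hj => ?_
  simp only [Finset.mem_range] at hi hj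
  rw [ha i j (by omega), hc _ _ (by omega)]

lemma tr_congr {ρ ς ρ' ς' : ℕ → ℝ} {k : ℕ} (hρ : ∀ i ≤ k, ρ i = ρ' i) (hς : ∀ i ≤ k, ς i = ς' i)
    {c c' : DerivArray} (hc : ∀ i j, i + j ≤ k → c i j = c' i j) :
    tr ρ ς k c = tr ρ' ς' k c' := by
  induction k using Nat.strong_induction_on generalizing c c' with
  | _ k ih =>
    cases k with
    | zero => simpa using hc 0 0 le_rfl
    | succ k =>
      rw [tr_succ, tr_succ]
      refine Finset.sum_congr rfl fun j hj => ?_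
      simp only [Finset.mem_range] at hj
      rw [hρ _ (by omega), hς _ (by omega),
        ih j hj (fun i hi => hρ i (by omega)) (fun i hi => hς i (by omega))
          (c := shX c) (c' := shX c') (fun i l h => hc _ _ (by omega)),
        ih j hj (fun i hi => hρ i (by omega)) (fun i hi => hς i (by omega))
          (c := shY c) (c' := shY c') (fun i l h => hc _ _ (by omega))]

/-- These bounds explain the sizes in a jet: the flux to order `M` needs the coefficient to order
`M` but the curve and the solution to order `M + 1`. -/
lemma fl_congr {ρ ς ρ' ς' : ℕ → ℝ} {k : ℕ} (hρ : ∀ i ≤ k + 1, ρ i = ρ' i)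
    (hς : ∀ i ≤ k + 1, ς i = ς' i) {a a' c c' : DerivArray}
    (ha : ∀ i j, i + j ≤ k → a i j = a' i j) (hc : ∀ i j, i + j ≤ k + 1 → c i j = c' i j) :
    fl ρ ς a k c = fl ρ' ς' a' k c' := by
  rw [fl_apply, fl_apply]
  refine Finset.sum_congr rfl fun j hj => ?_
  simp only [Finset.mem_range] at hj
  have h := fun (d d' : DerivArray) (hd : ∀ i l, i + l ≤ k → d i l = d' i l) =>
    tr_congr (ρ := ρ) (ρ' := ρ') (ς := ς) (ς' := ς') (k := j) (fun i hi => hρ i (by omega))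
      (fun i hi => hς i (by omega)) (c := mulA a d) (c' := mulA a' d')
      (fun i l h => mulA_congr (fun i' l' h' => ha _ _ (by omega))
        (fun i' l' h' => hd _ _ (by omega)))
  rw [hρ _ (by omega), hς _ (by omega), h (shX c) (shX c') (fun i l h => hc _ _ (by omega)),
    h (shY c) (shY c') (fun i l h => hc _ _ (by omega))]

lemma gr_congr {ρ ς ρ' ς' N N' : ℕ → ℝ} {k : ℕ} (hρ : ∀ i ≤ k, ρ i = ρ' i)
    (hς : ∀ i ≤ k, ς i = ς' i) (hN : ∀ i ≤ k, N i = N' i) {c c' : DerivArray}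
    (hc : ∀ i j, i + j ≤ k → c i j = c' i j) :
    gr ρ ς N k c = gr ρ' ς' N' k c' := by
  rw [gr_apply, gr_apply]
  refine Finset.sum_congr rfl fun j hj => ?_
  simp only [Finset.mem_range] at hj
  rw [hN _ (by omega), tr_congr (fun i hi => hρ i (by omega)) (fun i hi => hς i (by omega))
    (fun i l h => hc i l (by omega))]

lemma ell_congr {a a' c c' : DerivArray} {m n : ℕ}
    (ha : ∀ i j, i + j ≤ m + n + 1 → a i j = a' i j)
    (hc : ∀ i j, i + j ≤ m + n + 2 → c i j = c' i j) :
    ell a c m n = ell a' c' m n := by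
  rw [ell_apply, ell_apply]
  congr 1
  · exact mulA_congr (fun i j h => ha _ _ (by omega)) fun i j h => hc _ _ (by omega)
  · exact mulA_congr (fun i j h => ha _ _ (by omega)) fun i j h => hc _ _ (by omega)

/-! ### Leading terms -/

/-- All entries of order less than `K` are zero. -/
def VanishBelow (K : ℕ) (c : DerivArray) : Prop := ∀ i j, i + j < K → c i j = 0

lemma VanishBelow.shX {K : ℕ} {c : DerivArray} (h : VanishBelow (K + 1) c) :
    VanishBelow K (shX c) := fun _ _ hij => h _ _ (by omega)

lemma VanishBelow.shY {K : ℕ} {c : DerivArray} (h : VanishBelow (K + 1) c) :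
    VanishBelow K (shY c) := fun _ _ hij => h _ _ (by omega)

/-- Every Leibniz term that differentiates `a` meets an entry of `c` of order below `K`. -/
lemma mulA_of_vanishBelow (a : DerivArray) {c : DerivArray} {m n K : ℕ} (h : VanishBelow K c)
    (hmn : m + n ≤ K) : mulA a c m n = a 0 0 * c m n := by
  rw [mulA_apply, Finset.sum_eq_single_of_mem 0 (by simp), Finset.sum_eq_single_of_mem 0 (by simp)]
  · simp
  · intro j hj hj0
    simp only [Finset.mem_range] at hj
    rw [h _ _ (by omega)]; simp
  · intro i hi hi0
    simp only [Finset.mem_range] at hi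
    rw [Finset.sum_eq_zero, mul_zero]
    intro j hj
    rw [h _ _ (by omega)]; simp

lemma tr_eq_zero_of_vanishBelow (ρ ς : ℕ → ℝ) {c : DerivArray} {k K : ℕ} (h : VanishBelow K c)
    (hk : k < K) : tr ρ ς k c = 0 := by
  rw [tr_congr (ρ' := ρ) (ς' := ς) (fun _ _ => rfl) (fun _ _ => rfl) (c' := 0)
    (fun i j hij => by rw [h i j (by omega)]; rfl), map_zero]

/-- Higher derivatives of the curve multiply traces of lower order, which vanish; only the velocity
survives. -/
lemma tr_succ_of_vanishBelow (ρ ς : ℕ → ℝ) {c : DerivArray} {K : ℕ} (h : VanishBelow (K + 1) c) :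
    tr ρ ς (K + 1) c = ρ 1 * tr ρ ς K (shX c) + ς 1 * tr ρ ς K (shY c) := by
  rw [tr_succ, Finset.sum_eq_single_of_mem K (by simp)]
  · simp
  · intro j hj hjK
    simp only [Finset.mem_range] at hj
    rw [tr_eq_zero_of_vanishBelow ρ ς h.shX (by omega),
      tr_eq_zero_of_vanishBelow ρ ς h.shY (by omega)]
    simp

/-- The entries of order `K` satisfy the relations of a harmonic function. -/
def HarmonicAt (K : ℕ) (c : DerivArray) : Prop :=
  ∀ m n, m + n + 2 = K → c (m + 2) n + c m (n + 2) = 0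

lemma HarmonicAt.shX {K : ℕ} {c : DerivArray} (h : HarmonicAt (K + 1) c) :
    HarmonicAt K (shX c) := fun m n hmn => h (m + 1) n (by omega)

lemma HarmonicAt.shY {K : ℕ} {c : DerivArray} (h : HarmonicAt (K + 1) c) :
    HarmonicAt K (shY c) := fun m n hmn => h m (n + 1) (by omega)

/-- With vanishing lower entries the trace derivative is the leading form evaluated at the velocity.
A harmonic form of degree `N` is spanned by `Re z^N` and `Im z^N`, with coefficients the entries
`(N, 0)` and `(N - 1, 1)`. -/
lemma tr_harmonic (ρ ς : ℕ → ℝ) {K : ℕ} {c : DerivArray} (h : VanishBelow (K + 1) c)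
    (hh : HarmonicAt (K + 1) c) :
    tr ρ ς (K + 1) c = c (K + 1) 0 * ((⟨ρ 1, ς 1⟩ : ℂ) ^ (K + 1)).re
      + c K 1 * ((⟨ρ 1, ς 1⟩ : ℂ) ^ (K + 1)).im := by
  induction K generalizing c with
  | zero =>
    rw [tr_succ_of_vanishBelow ρ ς h]
    simp; ring
  | succ K ih =>
    rw [tr_succ_of_vanishBelow ρ ς h, ih h.shX hh.shX, ih h.shY hh.shY, pow_succ _ (K + 1)]
    have := hh K 0 (by omega)
    simp only [shX_apply, shY_apply, Complex.mul_re, Complex.mul_im, zero_add, one_add_one_eq_two]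
    simp only [zero_add] at this
    -- Harmonicity identifies the leading pair of `shY c` as a quarter turn of that of `shX c`, so
    -- the sum is the real part of a multiplication by `z`.
    rw [show c K 2 = - c (K + 2) 0 by linarith]
    ring

/-- The conormal replaces one factor `z` by the rotated velocity `-i z`, hence `z^N` by `-i z^N`,
which turns `Re` into `Im` and `Im` into `-Re`. The coefficient contributes only its value. -/
lemma fl_harmonic (ρ ς : ℕ → ℝ) (a : DerivArray) {K : ℕ} {c : DerivArray}
    (h : VanishBelow (K + 1) c) (hh : HarmonicAt (K + 1) c) :
    fl ρ ς a K c = a 0 0 * (c (K + 1) 0 * ((⟨ρ 1, ς 1⟩ : ℂ) ^ (K + 1)).im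
      - c K 1 * ((⟨ρ 1, ς 1⟩ : ℂ) ^ (K + 1)).re) := by
  have key : ∀ d : DerivArray, VanishBelow K d →
      tr ρ ς K (mulA a d) = a 0 0 * tr ρ ς K d := by
    intro d hd
    rw [tr_congr (ρ' := ρ) (ς' := ς) (fun _ _ => rfl) (fun _ _ => rfl) (c' := a 0 0 • d)
      (fun i j hij => by rw [mulA_of_vanishBelow a hd hij]; rfl), map_smul, smul_eq_mul]
  have key0 : ∀ d : DerivArray, VanishBelow K d → ∀ j < K, tr ρ ς j (mulA a d) = 0 := by
    intro d hd j hj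
    rw [tr_congr (ρ' := ρ) (ς' := ς) (fun _ _ => rfl) (fun _ _ => rfl) (c' := 0)
      (fun i l hij => by
        rw [mulA_of_vanishBelow a hd (by omega), hd _ _ (by omega), mul_zero]; rfl), map_zero]
  rw [fl_apply, Finset.sum_eq_single_of_mem K (by simp), key _ h.shX, key _ h.shY]
  · cases K with
    | zero => simp; ring
    | succ K =>
      rw [tr_harmonic ρ ς h.shX hh.shX, tr_harmonic ρ ς h.shY hh.shY, pow_succ _ (K + 1)]
      have := hh K 0 (by omega)
      simp only [shX_apply, shY_apply, Complex.mul_re, Complex.mul_im, zero_add,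
        one_add_one_eq_two, Nat.choose_self, Nat.sub_self, Nat.cast_one]
      simp only [zero_add] at this
      rw [show c K 2 = - c (K + 2) 0 by linarith]
      ring
  · intro j hj hjK
    simp only [Finset.mem_range] at hj
    rw [key0 _ h.shX j (by omega), key0 _ h.shY j (by omega)]
    simp

lemma harmonicAt_of_ell {a c : DerivArray} (ha : a 0 0 ≠ 0) {K : ℕ} (h : VanishBelow K c)
    (he : ∀ m n, m + n + 2 = K → ell a c m n = 0) : HarmonicAt K c := by
  intro m n hmn
  have := he m n hmn
  obtain ⟨K, rfl⟩ : ∃ L, K = L + 1 := ⟨m + n + 1, by omega⟩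
  rw [ell_apply, mulA_of_vanishBelow a h.shX (by omega), mulA_of_vanishBelow a h.shY (by omega),
    ← mul_add, mul_eq_zero] at this
  exact this.resolve_left ha

/-- The harmonic relations move two indices from one variable to the other, so two adjacent entries
of a layer fix it. -/
lemma HarmonicAt.vanish_of_left {K : ℕ} {c : DerivArray} (h : HarmonicAt K c)
    (h0 : ∀ i j, i + j = K → i ≤ 1 → c i j = 0) (i j : ℕ) (hij : i + j = K) : c i j = 0 := by
  induction i using Nat.strong_induction_on generalizing j with
  | _ i ih =>
    match i, ih, hij with
    | 0, _, hij => exact h0 _ _ hij (by omega)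
    | 1, _, hij => exact h0 _ _ hij (by omega)
    | i + 2, ih, hij =>
      have h1 := h i j (by omega)
      rw [ih i (by omega) (j + 2) (by omega)] at h1
      linarith

lemma HarmonicAt.vanish_of_right {K : ℕ} {c : DerivArray} (h : HarmonicAt K c)
    (h0 : ∀ i j, i + j = K → j ≤ 1 → c i j = 0) (i j : ℕ) (hij : i + j = K) : c i j = 0 := by
  induction j using Nat.strong_induction_on generalizing i with
  | _ j ih =>
    match j, ih, hij with
    | 0, _, hij => exact h0 _ _ hij (by omega)
    | 1, _, hij => exact h0 _ _ hij (by omega)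
    | j + 2, ih, hij =>
      have h1 := h i j (by omega)
      rw [ih j (by omega) (i + 2) (by omega)] at h1
      linarith

lemma VanishBelow.succ {K : ℕ} {c : DerivArray} (h : VanishBelow K c)
    (hK : ∀ i j, i + j = K → c i j = 0) : VanishBelow (K + 1) c := by
  intro i j hij
  rcases Nat.lt_succ_iff_lt_or_eq.mp hij with h1 | h1
  · exact h i j h1
  · exact hK i j h1

/-- A solution of the homogeneous equation with zero entries for `m ≤ 1` is zero. -/
lemma vanishBelow_of_ell_of_left {a c : DerivArray} (ha : a 0 0 ≠ 0) {K : ℕ}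
    (he : ∀ m n, m + n + 2 ≤ K → ell a c m n = 0)
    (h0 : ∀ i j, i + j ≤ K → i ≤ 1 → c i j = 0) : VanishBelow (K + 1) c := by
  suffices ∀ L ≤ K + 1, VanishBelow L c from this _ le_rfl
  intro L
  induction L with
  | zero => intro _ i j hij; omega
  | succ L ih =>
    intro hL
    have hv := ih (by omega)
    refine hv.succ ?_
    exact (harmonicAt_of_ell ha hv fun m n hmn => he m n (by omega)).vanish_of_left
      fun i j hij hi => h0 i j (by omega) hi

/-- A solution of the homogeneous equation with zero Cauchy data along the curve is zero. -/
lemma vanishBelow_of_ell_of_cauchy {ρ ς : ℕ → ℝ} (hreg : 0 < ρ 1 ^ 2 + ς 1 ^ 2)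
    {a c : DerivArray} (ha : a 0 0 ≠ 0) {K : ℕ}
    (he : ∀ m n, m + n + 2 ≤ K → ell a c m n = 0)
    (ht : ∀ k ≤ K, tr ρ ς k c = 0) (hf : ∀ k, k + 1 ≤ K → fl ρ ς a k c = 0) :
    VanishBelow (K + 1) c := by
  suffices ∀ L ≤ K + 1, VanishBelow L c from this _ le_rfl
  intro L
  induction L with
  | zero => intro _ i j hij; omega
  | succ L ih =>
    intro hL
    have hv := ih (by omega)
    refine hv.succ ?_
    have hh := harmonicAt_of_ell ha hv fun m n hmn => he m n (by omega)
    cases L with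
    | zero =>
      intro i j hij
      obtain ⟨rfl, rfl⟩ : i = 0 ∧ j = 0 := by omega
      simpa using ht 0 (by omega)
    | succ L =>
      -- The layer of order `L + 1` is tested by the trace derivative of order `L + 1` and the flux
      -- derivative of order `L` only.
      have h1 := ht (L + 1) (by omega)
      have h2 := hf L (by omega)
      rw [tr_harmonic ρ ς hv hh] at h1
      rw [fl_harmonic ρ ς a hv hh, mul_eq_zero, or_iff_right ha] at h2
      set z : ℂ := (⟨ρ 1, ς 1⟩ : ℂ) with hz
      have hz0 : z ≠ 0 := by
        intro h0
        have e1 : ρ 1 = 0 := by simpa [hz] using congrArg Complex.re h0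
        have e2 : ς 1 = 0 := by simpa [hz] using congrArg Complex.im h0
        rw [e1, e2] at hreg
        norm_num at hreg
      have hpos : 0 < Complex.normSq (z ^ (L + 1)) := Complex.normSq_pos.mpr (pow_ne_zero _ hz0)
      rw [Complex.normSq_apply] at hpos
      generalize (z ^ (L + 1)).re = X at *
      generalize (z ^ (L + 1)).im = Y at *
      -- The two relations form a linear system for `c (L + 1) 0` and `c L 1` with matrix `(X, Y; Y,
      -- -X)` and determinant `-(X² + Y²)`.
      have hA : c (L + 1) 0 = 0 := by
        have : c (L + 1) 0 * (X * X + Y * Y) = 0 := by linear_combination X * h1 + Y * h2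
        exact (mul_eq_zero.mp this).resolve_right hpos.ne'
      have hB : c L 1 = 0 := by
        have : c L 1 * (X * X + Y * Y) = 0 := by linear_combination Y * h1 - X * h2
        exact (mul_eq_zero.mp this).resolve_right hpos.ne'
      refine hh.vanish_of_right fun i j hij hj => ?_
      interval_cases j
      · obtain rfl : i = L + 1 := by omega
        exact hA
      · obtain rfl : i = L := by omega
        exact hB

/-! ### The linear systems for the arrays of a solution -/

/-- The array with given entries in `s` and zero entries outside. -/
def ext (s : Finset (ℕ × ℕ)) : (s → ℝ) →ₗ[ℝ] DerivArray where
  toFun v := fun m n => if h : (m, n) ∈ s then v ⟨(m, n), h⟩ else 0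
  map_add' v w := by
    funext m n
    by_cases h : (m, n) ∈ s <;> simp [h]
  map_smul' k v := by
    funext m n
    by_cases h : (m, n) ∈ s <;> simp [h]

/-- The entries in `s`. -/
def res (s : Finset (ℕ × ℕ)) : DerivArray →ₗ[ℝ] (s → ℝ) where
  toFun c := fun i => c i.1.1 i.1.2
  map_add' _ _ := rfl
  map_smul' _ _ := rfl

@[simp] lemma res_apply (s : Finset (ℕ × ℕ)) (c : DerivArray) (i : s) :
    res s c i = c i.1.1 i.1.2 := rfl

lemma ext_apply_mem {s : Finset (ℕ × ℕ)} (v : s → ℝ) {m n : ℕ} (h : (m, n) ∈ s) :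
    ext s v m n = v ⟨(m, n), h⟩ := dif_pos h

@[simp] lemma res_ext (s : Finset (ℕ × ℕ)) (v : s → ℝ) : res s (ext s v) = v := by
  funext i
  exact ext_apply_mem v i.2

lemma ext_res_apply {s : Finset (ℕ × ℕ)} (c : DerivArray) {m n : ℕ} (h : (m, n) ∈ s) :
    ext s (res s c) m n = c m n := ext_apply_mem _ h

@[simp] lemma _root_.EllipticInterface.mem_Lam {K : ℕ} {i : ℕ × ℕ} :
    i ∈ Lam K ↔ i.1 + i.2 ≤ K := by
  simp only [Lam, Finset.mem_filter, Finset.mem_product, Finset.mem_range]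
  omega

@[simp] lemma _root_.EllipticInterface.mem_Lam1 {K : ℕ} {i : ℕ × ℕ} :
    i ∈ Lam1 K ↔ i.1 + i.2 ≤ K ∧ i.1 ≤ 1 := by
  simp [Lam1]

lemma _root_.EllipticInterface.card_Lam1 (K : ℕ) : (Lam1 (K + 1)).card = 2 * K + 3 := by
  have : Lam1 (K + 1) = (Finset.range (K + 2)).image (fun n => (0, n))
      ∪ (Finset.range (K + 1)).image (fun n => (1, n)) := by
    ext ⟨m, n⟩
    simp only [mem_Lam1, Finset.mem_union, Finset.mem_image, Finset.mem_range, Prod.mk.injEq]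
    constructor
    · intro h
      obtain rfl | rfl : m = 0 ∨ m = 1 := by omega
      · exact Or.inl ⟨n, by omega, rfl, rfl⟩
      · exact Or.inr ⟨n, by omega, rfl, rfl⟩
    · rintro (⟨k, hk, rfl, rfl⟩ | ⟨k, hk, rfl, rfl⟩) <;> omega
  rw [this, Finset.card_union_of_disjoint,
    Finset.card_image_of_injective _ (Prod.mk_right_injective 0),
    Finset.card_image_of_injective _ (Prod.mk_right_injective 1), Finset.card_range,
    Finset.card_range]
  · omega
  · rw [Finset.disjoint_left]
    simp only [Finset.mem_image]
    rintro _ ⟨k, _, rfl⟩ ⟨l, _, h⟩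
    simp at h

/-- The entries with `m ≥ 2` correspond to the instances of the differentiated equation by `m ↦ m -
2`. This makes both linear systems square. -/
lemma _root_.EllipticInterface.card_Lam (K : ℕ) :
    (Lam (K + 2)).card = (Lam1 (K + 2)).card + (Lam K).card := by
  have : Lam (K + 2) = Lam1 (K + 2) ∪ (Lam K).image (fun i => (i.1 + 2, i.2)) := by
    ext ⟨m, n⟩
    simp only [mem_Lam1, mem_Lam, Finset.mem_union, Finset.mem_image, Prod.mk.injEq, Prod.exists]
    constructor
    · intro h
      by_cases hm : m ≤ 1
      · exact Or.inl ⟨h, hm⟩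
      · exact Or.inr ⟨m - 2, n, by omega, by omega, rfl⟩
    · rintro (h | ⟨k, l, hk, rfl, rfl⟩) <;> omega
  rw [this, Finset.card_union_of_disjoint, Finset.card_image_of_injective]
  · rintro ⟨i, j⟩ ⟨k, l⟩ h
    simpa using h
  · rw [Finset.disjoint_left]
    simp only [Finset.mem_image, mem_Lam1]
    rintro _ h ⟨l, _, rfl⟩
    simp at h

/-- The entries with `m ≤ 1` and the right-hand side of the equation. -/
def leftMap (a : DerivArray) (M : ℕ) :
    (Lam (M + 1) → ℝ) →ₗ[ℝ] (Lam1 (M + 1) → ℝ) × (Lam (M - 1) → ℝ) :=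
  ((res (Lam1 (M + 1))).prod ((res (Lam (M - 1))).comp (ell a))).comp (ext (Lam (M + 1)))

/-- The Cauchy data along the curve and the right-hand side of the equation. -/
def cauchyMap (ρ ς : ℕ → ℝ) (a : DerivArray) (M : ℕ) :
    (Lam (M + 1) → ℝ) →ₗ[ℝ] (Lam (M - 1) → ℝ) × (Fin (M + 2) → ℝ) × (Fin (M + 1) → ℝ) :=
  (((res (Lam (M - 1))).comp (ell a)).prod
    ((LinearMap.pi fun k : Fin (M + 2) => tr ρ ς k).prod
      (LinearMap.pi fun k : Fin (M + 1) => fl ρ ς a k))).comp (ext (Lam (M + 1)))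

lemma leftMap_apply (a : DerivArray) (M : ℕ) (v : Lam (M + 1) → ℝ) :
    leftMap a M v = (res (Lam1 (M + 1)) (ext (Lam (M + 1)) v),
      res (Lam (M - 1)) (ell a (ext (Lam (M + 1)) v))) := rfl

lemma cauchyMap_apply (ρ ς : ℕ → ℝ) (a : DerivArray) (M : ℕ) (v : Lam (M + 1) → ℝ) :
    cauchyMap ρ ς a M v = (res (Lam (M - 1)) (ell a (ext (Lam (M + 1)) v)),
      fun k : Fin (M + 2) => tr ρ ς k (ext (Lam (M + 1)) v),
      fun k : Fin (M + 1) => fl ρ ς a k (ext (Lam (M + 1)) v)) := rfl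

lemma eq_zero_of_vanishBelow {K : ℕ} {v : Lam K → ℝ} (h : VanishBelow (K + 1) (ext (Lam K) v)) :
    v = 0 := by
  funext i
  rw [← res_ext _ v]
  exact h _ _ (by have := mem_Lam.mp i.2; omega)

lemma leftMap_injective {a : DerivArray} (ha : a 0 0 ≠ 0) {M : ℕ} (hM : 1 ≤ M) :
    Function.Injective (leftMap a M) := by
  rw [← LinearMap.ker_eq_bot, LinearMap.ker_eq_bot']
  intro v hv
  rw [leftMap_apply, Prod.mk_eq_zero] at hv
  refine eq_zero_of_vanishBelow (vanishBelow_of_ell_of_left ha (fun m n hmn => ?_)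
    fun i j hij hi => ?_)
  · exact congrFun hv.2 ⟨(m, n), mem_Lam.mpr (by dsimp only; omega)⟩
  · exact congrFun hv.1 ⟨(i, j), mem_Lam1.mpr ⟨hij, hi⟩⟩

lemma cauchyMap_injective {ρ ς : ℕ → ℝ} (hreg : 0 < ρ 1 ^ 2 + ς 1 ^ 2) {a : DerivArray}
    (ha : a 0 0 ≠ 0) {M : ℕ} (hM : 1 ≤ M) : Function.Injective (cauchyMap ρ ς a M) := by
  rw [← LinearMap.ker_eq_bot, LinearMap.ker_eq_bot']
  intro v hv
  rw [cauchyMap_apply, Prod.mk_eq_zero, Prod.mk_eq_zero] at hv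
  refine eq_zero_of_vanishBelow (vanishBelow_of_ell_of_cauchy hreg ha (fun m n hmn => ?_)
    (fun k hk => ?_) fun k hk => ?_)
  · exact congrFun hv.1 ⟨(m, n), mem_Lam.mpr (by dsimp only; omega)⟩
  · exact congrFun hv.2.1 ⟨k, by omega⟩
  · exact congrFun hv.2.2 ⟨k, by omega⟩

/-- The entries with `m ≤ 1` and the right-hand side of the equation determine the array. -/
def leftEquiv {a : DerivArray} (ha : a 0 0 ≠ 0) {M : ℕ} (hM : 1 ≤ M) :
    (Lam (M + 1) → ℝ) ≃ₗ[ℝ] (Lam1 (M + 1) → ℝ) × (Lam (M - 1) → ℝ) :=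
  (leftMap a M).linearEquivOfInjective (leftMap_injective ha hM) (by
    obtain ⟨K, rfl⟩ : ∃ K, M = K + 1 := ⟨M - 1, by omega⟩
    simp [card_Lam])

/-- The Cauchy data along the curve and the right-hand side of the equation determine the
array. -/
def cauchyEquiv {ρ ς : ℕ → ℝ} (hreg : 0 < ρ 1 ^ 2 + ς 1 ^ 2) {a : DerivArray} (ha : a 0 0 ≠ 0)
    {M : ℕ} (hM : 1 ≤ M) :
    (Lam (M + 1) → ℝ) ≃ₗ[ℝ] (Lam (M - 1) → ℝ) × (Fin (M + 2) → ℝ) × (Fin (M + 1) → ℝ) :=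
  (cauchyMap ρ ς a M).linearEquivOfInjective (cauchyMap_injective hreg ha hM) (by
    -- The Cauchy data are `(M + 2) + (M + 1) = 2 M + 3` numbers, as many as `Lam1 (M + 1)` has
    -- elements.
    obtain ⟨K, rfl⟩ : ∃ K, M = K + 1 := ⟨M - 1, by omega⟩
    simp [card_Lam, card_Lam1]
    omega)

lemma leftEquiv_apply {a : DerivArray} (ha : a 0 0 ≠ 0) {M : ℕ} (hM : 1 ≤ M)
    (v : Lam (M + 1) → ℝ) : leftEquiv ha hM v = leftMap a M v := rfl

lemma cauchyEquiv_apply {ρ ς : ℕ → ℝ} (hreg : 0 < ρ 1 ^ 2 + ς 1 ^ 2) {a : DerivArray}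
    (ha : a 0 0 ≠ 0) {M : ℕ} (hM : 1 ≤ M) (v : Lam (M + 1) → ℝ) :
    cauchyEquiv hreg ha hM v = cauchyMap ρ ς a M v := rfl

end DerivArray

/-! ### Partial derivatives in an open set -/

section PartialDerivatives

variable {R : Set (ℝ × ℝ)} {v w : ℝ × ℝ → ℝ}

lemma eqOn_dX (hR : IsOpen R) (h : EqOn v w R) : EqOn (dX v) (dX w) R := fun p hp => by
  rw [dX, dX, (h.eventuallyEq_of_mem (hR.mem_nhds hp)).fderiv_eq]

lemma eqOn_dY (hR : IsOpen R) (h : EqOn v w R) : EqOn (dY v) (dY w) R := fun p hp => by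
  rw [dY, dY, (h.eventuallyEq_of_mem (hR.mem_nhds hp)).fderiv_eq]

@[simp] lemma pd_zero_zero (v : ℝ × ℝ → ℝ) : pd 0 0 v = v := rfl

lemma pd_succ_left (m n : ℕ) (v : ℝ × ℝ → ℝ) : pd (m + 1) n v = dX (pd m n v) :=
  Function.iterate_succ_apply' _ _ _

lemma pd_zero_succ (n : ℕ) (v : ℝ × ℝ → ℝ) : pd 0 (n + 1) v = dY (pd 0 n v) :=
  Function.iterate_succ_apply' _ _ _

lemma pd_dY (m n : ℕ) (v : ℝ × ℝ → ℝ) : pd m n (dY v) = pd m (n + 1) v := rfl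

lemma eqOn_pd (hR : IsOpen R) (h : EqOn v w R) (m n : ℕ) : EqOn (pd m n v) (pd m n w) R := by
  induction m with
  | zero =>
    induction n with
    | zero => exact h
    | succ n ih => rw [pd_zero_succ, pd_zero_succ]; exact eqOn_dY hR ih
  | succ m ih => rw [pd_succ_left, pd_succ_left]; exact eqOn_dX hR ih

lemma pd_congr_of_eventuallyEq {p : ℝ × ℝ} (h : v =ᶠ[𝓝 p] w) (m n : ℕ) :
    pd m n v p = pd m n w p := by
  obtain ⟨U, hU, hUo, hp⟩ := eventually_nhds_iff.mp h
  exact eqOn_pd hUo (fun q hq => hU q hq) m n hp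

lemma contDiffOn_dX (hR : IsOpen R) {k n : WithTop ℕ∞} (hkn : k + 1 ≤ n)
    (h : ContDiffOn ℝ n v R) : ContDiffOn ℝ k (dX v) R :=
  (h.fderiv_of_isOpen hR hkn).clm_apply contDiffOn_const

lemma contDiffOn_dY (hR : IsOpen R) {k n : WithTop ℕ∞} (hkn : k + 1 ≤ n)
    (h : ContDiffOn ℝ n v R) : ContDiffOn ℝ k (dY v) R :=
  (h.fderiv_of_isOpen hR hkn).clm_apply contDiffOn_const

lemma contDiffOn_pd (hR : IsOpen R) {K : ℕ} (h : ContDiffOn ℝ K v R) {m n l : ℕ}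
    (hl : m + n + l ≤ K) : ContDiffOn ℝ l (pd m n v) R := by
  induction m generalizing l with
  | zero =>
    induction n generalizing l with
    | zero => exact h.of_le (by exact_mod_cast (by omega))
    | succ n ih =>
      rw [pd_zero_succ]
      exact contDiffOn_dY hR (n := (l + 1 : ℕ)) (by push_cast; exact le_rfl) (ih (by omega))
  | succ m ih =>
    rw [pd_succ_left]
    exact contDiffOn_dX hR (n := (l + 1 : ℕ)) (by push_cast; exact le_rfl) (ih (by omega))

lemma differentiableAt_pd (hR : IsOpen R) {K : ℕ} (h : ContDiffOn ℝ K v R) {m n : ℕ}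
    (hmn : m + n + 1 ≤ K) {p : ℝ × ℝ} (hp : p ∈ R) : DifferentiableAt ℝ (pd m n v) p :=
  ((contDiffOn_pd hR h hmn).contDiffAt (hR.mem_nhds hp)).differentiableAt (by simp)

lemma dX_dY_comm (hR : IsOpen R) {K : ℕ} (hK : 2 ≤ K) (h : ContDiffOn ℝ K v R) :
    EqOn (dX (dY v)) (dY (dX v)) R := by
  intro p hp
  have hv : ContDiffAt ℝ K v p := h.contDiffAt (hR.mem_nhds hp)
  have hsymm : IsSymmSndFDerivAt ℝ v p :=
    hv.isSymmSndFDerivAt (by simpa using by exact_mod_cast hK)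
  have hd : DifferentiableAt ℝ (fderiv ℝ v) p :=
    (hv.fderiv_right (m := 1) (by exact_mod_cast hK)).differentiableAt (by simp)
  have key : ∀ e e' : ℝ × ℝ, fderiv ℝ (fun q => fderiv ℝ v q e) p e' =
      fderiv ℝ (fderiv ℝ v) p e' e := by
    intro e e'
    rw [fderiv_clm_apply hd (differentiableAt_const e)]
    simp
  change fderiv ℝ (fun q => fderiv ℝ v q (0, 1)) p (1, 0) =
    fderiv ℝ (fun q => fderiv ℝ v q (1, 0)) p (0, 1)
  rw [key, key]
  exact hsymm _ _

/-- In `pd` the `x`-derivatives are applied last, so an inner `dX` has to be commuted past all the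
`y`-derivatives; this uses symmetry of second derivatives. -/
lemma pd_dX (hR : IsOpen R) {K : ℕ} (h : ContDiffOn ℝ K v R) {m n : ℕ} (hmn : m + n + 1 ≤ K) :
    EqOn (pd m n (dX v)) (pd (m + 1) n v) R := by
  induction m with
  | zero =>
    induction n with
    | zero => exact fun _ _ => rfl
    | succ n ih =>
      rw [pd_zero_succ, pd_succ_left, pd_zero_succ]
      have h1 := eqOn_dY hR (ih (by omega))
      rw [pd_succ_left] at h1
      exact h1.trans (dX_dY_comm hR le_rfl (contDiffOn_pd hR h (by omega))).symm
  | succ m ih =>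
    rw [pd_succ_left, pd_succ_left]
    exact eqOn_dX hR (ih (by omega))

lemma dX_add {p : ℝ × ℝ} (hv : DifferentiableAt ℝ v p) (hw : DifferentiableAt ℝ w p) :
    dX (fun q => v q + w q) p = dX v p + dX w p := by
  simp [dX, fderiv_fun_add hv hw]

lemma dY_add {p : ℝ × ℝ} (hv : DifferentiableAt ℝ v p) (hw : DifferentiableAt ℝ w p) :
    dY (fun q => v q + w q) p = dY v p + dY w p := by
  simp [dY, fderiv_fun_add hv hw]

lemma dX_mul {p : ℝ × ℝ} (hv : DifferentiableAt ℝ v p) (hw : DifferentiableAt ℝ w p) :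
    dX (fun q => v q * w q) p = dX v p * w p + v p * dX w p := by
  simp [dX, fderiv_fun_mul hv hw]; ring

lemma dY_mul {p : ℝ × ℝ} (hv : DifferentiableAt ℝ v p) (hw : DifferentiableAt ℝ w p) :
    dY (fun q => v q * w q) p = dY v p * w p + v p * dY w p := by
  simp [dY, fderiv_fun_mul hv hw]; ring

lemma pd_add (hR : IsOpen R) {K : ℕ} (hv : ContDiffOn ℝ K v R) (hw : ContDiffOn ℝ K w R)
    {m n : ℕ} (hmn : m + n ≤ K) :
    EqOn (pd m n fun q => v q + w q) (fun q => pd m n v q + pd m n w q) R := by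
  induction m with
  | zero =>
    induction n with
    | zero => exact fun _ _ => rfl
    | succ n ih =>
      intro p hp
      simp only [pd_zero_succ]
      rw [eqOn_dY hR (ih (by omega)) hp, dY_add (differentiableAt_pd hR hv (by omega) hp)
        (differentiableAt_pd hR hw (by omega) hp)]
  | succ m ih =>
    intro p hp
    simp only [pd_succ_left]
    rw [eqOn_dX hR (ih (by omega)) hp, dX_add (differentiableAt_pd hR hv (by omega) hp)
      (differentiableAt_pd hR hw (by omega) hp)]

lemma pd_neg (m n : ℕ) (v : ℝ × ℝ → ℝ) : (pd m n fun q => - v q) = fun q => - pd m n v q := by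
  induction m with
  | zero =>
    induction n with
    | zero => rfl
    | succ n ih =>
      rw [pd_zero_succ, pd_zero_succ, ih]
      funext p
      simp [dY, fderiv_fun_neg]
  | succ m ih =>
    rw [pd_succ_left, pd_succ_left, ih]
    funext p
    simp [dX, fderiv_fun_neg]

end PartialDerivatives

/-! ### The Leibniz rule for arrays and for partial derivatives -/

namespace DerivArray

/-- With the sum over `j` outermost, Pascal's rule applies in `n` as it does in `m`. -/
lemma mulA_comm_sums (a c : DerivArray) (m n : ℕ) :
    mulA a c m n = ∑ j ∈ Finset.range (n + 1), (n.choose j : ℝ) *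
      ∑ i ∈ Finset.range (m + 1), (m.choose i : ℝ) * (a i j * c (m - i) (n - j)) := by
  simp only [mulA_apply, Finset.mul_sum]
  rw [Finset.sum_comm]
  refine Finset.sum_congr rfl fun i _ => Finset.sum_congr rfl fun j _ => by ring

lemma mulA_succ_left (a c : DerivArray) (m n : ℕ) :
    mulA a c (m + 1) n = mulA (shX a) c m n + mulA a (shX c) m n := by
  rw [mulA_apply, Finset.sum_choose_succ_mul (fun i i' =>
    ∑ j ∈ Finset.range (n + 1), (n.choose j : ℝ) * (a i j * c i' (n - j))), add_comm, mulA_apply,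
    mulA_apply]
  congr 1
  refine Finset.sum_congr rfl fun i hi => ?_
  rw [Finset.mem_range] at hi
  rw [show m + 1 - i = m - i + 1 by omega]
  rfl

lemma mulA_succ_right (a c : DerivArray) (m n : ℕ) :
    mulA a c m (n + 1) = mulA (shY a) c m n + mulA a (shY c) m n := by
  rw [mulA_comm_sums, Finset.sum_choose_succ_mul (fun j j' =>
    ∑ i ∈ Finset.range (m + 1), (m.choose i : ℝ) * (a i j * c (m - i) j')), add_comm,
    mulA_comm_sums, mulA_comm_sums]
  congr 1
  refine Finset.sum_congr rfl fun i hi => ?_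
  rw [Finset.mem_range] at hi
  rw [show n + 1 - i = n - i + 1 by omega]
  rfl

end DerivArray

open DerivArray

/-- The array of partial derivatives of `v` at `p`. -/
def pdArray (v : ℝ × ℝ → ℝ) (p : ℝ × ℝ) : DerivArray := fun m n => pd m n v p

section Sums

variable {R : Set (ℝ × ℝ)}

lemma dX_mulA {A C : ℝ × ℝ → DerivArray} {p : ℝ × ℝ} {m n : ℕ}
    (hA : ∀ i j, i + j ≤ m + n → DifferentiableAt ℝ (fun q => A q i j) p)
    (hC : ∀ i j, i + j ≤ m + n → DifferentiableAt ℝ (fun q => C q i j) p) :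
    dX (fun q => mulA (A q) (C q) m n) p =
      mulA (fun i j => dX (fun q => A q i j) p) (C p) m n
        + mulA (A p) (fun i j => dX (fun q => C q i j) p) m n := by
  have h : ∀ i ∈ Finset.range (m + 1), ∀ j ∈ Finset.range (n + 1),
      HasFDerivAt (fun q => A q i j * C q (m - i) (n - j)) _ p := fun i hi j hj => by
    simp only [Finset.mem_range] at hi hj
    exact (hA i j (by omega)).hasFDerivAt.mul (hC (m - i) (n - j) (by omega)).hasFDerivAt
  have h2 := HasFDerivAt.fun_sum fun i hi =>
    (HasFDerivAt.fun_sum fun j hj => (h i hi j hj).const_mul (n.choose j : ℝ)).const_mul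
      (m.choose i : ℝ)
  rw [dX]
  simp only [mulA_apply]
  rw [h2.fderiv]
  simp only [sum_apply, smul_apply,
    add_apply, smul_eq_mul, dX, ← Finset.sum_add_distrib, ← mul_add]
  refine Finset.sum_congr rfl fun i _ => ?_
  congr 1
  refine Finset.sum_congr rfl fun j _ => by ring

lemma dY_mulA {A C : ℝ × ℝ → DerivArray} {p : ℝ × ℝ} {m n : ℕ}
    (hA : ∀ i j, i + j ≤ m + n → DifferentiableAt ℝ (fun q => A q i j) p)
    (hC : ∀ i j, i + j ≤ m + n → DifferentiableAt ℝ (fun q => C q i j) p) :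
    dY (fun q => mulA (A q) (C q) m n) p =
      mulA (fun i j => dY (fun q => A q i j) p) (C p) m n
        + mulA (A p) (fun i j => dY (fun q => C q i j) p) m n := by
  have h : ∀ i ∈ Finset.range (m + 1), ∀ j ∈ Finset.range (n + 1),
      HasFDerivAt (fun q => A q i j * C q (m - i) (n - j)) _ p := fun i hi j hj => by
    simp only [Finset.mem_range] at hi hj
    exact (hA i j (by omega)).hasFDerivAt.mul (hC (m - i) (n - j) (by omega)).hasFDerivAt
  have h2 := HasFDerivAt.fun_sum fun i hi =>
    (HasFDerivAt.fun_sum fun j hj => (h i hi j hj).const_mul (n.choose j : ℝ)).const_mul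
      (m.choose i : ℝ)
  rw [dY]
  simp only [mulA_apply]
  rw [h2.fderiv]
  simp only [sum_apply, smul_apply,
    add_apply, smul_eq_mul, dY, ← Finset.sum_add_distrib, ← mul_add]
  refine Finset.sum_congr rfl fun i _ => ?_
  congr 1
  refine Finset.sum_congr rfl fun j _ => by ring

/-- The Leibniz rule. -/
lemma pd_mul (hR : IsOpen R) {v w : ℝ × ℝ → ℝ} {K : ℕ} (hv : ContDiffOn ℝ K v R)
    (hw : ContDiffOn ℝ K w R) {m n : ℕ} (hmn : m + n ≤ K) :
    EqOn (pd m n fun q => v q * w q) (fun q => mulA (pdArray v q) (pdArray w q) m n) R := by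
  induction m with
  | zero =>
    induction n with
    | zero => intro p _; simp [mulA_apply, pdArray]
    | succ n ih =>
      intro p hp
      rw [pd_zero_succ, eqOn_dY hR (ih (by omega)) hp, dY_mulA (A := pdArray v) (C := pdArray w)
        (fun i j _ => differentiableAt_pd hR hv (by omega) hp)
        (fun i j _ => differentiableAt_pd hR hw (by omega) hp)]
      dsimp only
      rw [mulA_succ_right]
      have e : ∀ z : ℝ × ℝ → ℝ, ∀ j, dY (pd 0 j z) p = pd 0 (j + 1) z p := fun z j => by
        rw [pd_zero_succ]
      congr 1
      · simp [mulA_apply, pdArray, e]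
      · simp [mulA_apply, pdArray, e]
  | succ m ih =>
    intro p hp
    rw [pd_succ_left, eqOn_dX hR (ih (by omega)) hp, dX_mulA (A := pdArray v) (C := pdArray w)
      (fun i j _ => differentiableAt_pd hR hv (by omega) hp)
      (fun i j _ => differentiableAt_pd hR hw (by omega) hp)]
    dsimp only
    rw [mulA_succ_left]
    have e : ∀ z : ℝ × ℝ → ℝ, (fun i j => dX (fun q => pdArray z q i j) p) = shX (pdArray z p) := by
      intro z
      funext i j
      simp only [shX_apply, pdArray, pd_succ_left]
    rw [e, e]

end Sums

/-! ### One-sided derivatives -/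

/-- `v` is `C^K` in the region `R` and its partial derivatives of order up to `K` have limits, from
inside `R`, at the points of `S`. -/
def SmoothUpToOrder (K : ℕ) (R S : Set (ℝ × ℝ)) (v : ℝ × ℝ → ℝ) : Prop :=
  ContDiffOn ℝ K v R ∧
    ∀ m n : ℕ, m + n ≤ K → ∀ p ∈ S, ∃ l : ℝ, Tendsto (pd m n v) (𝓝[R] p) (𝓝 l)

lemma sideDeriv_congr {R : Set (ℝ × ℝ)} {v w : ℝ × ℝ → ℝ} (p : ℝ × ℝ) {m n k l : ℕ}
    (h : EqOn (pd m n v) (pd k l w) R) : sideDeriv R v p m n = sideDeriv R w p k l := by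
  rw [sideDeriv, sideDeriv, limUnder, limUnder,
    Filter.map_congr (h.eventuallyEq_of_mem self_mem_nhdsWithin)]

namespace SmoothUpToOrder

variable {K : ℕ} {R S : Set (ℝ × ℝ)} {v w : ℝ × ℝ → ℝ}

lemma tendsto (h : SmoothUpToOrder K R S v) {m n : ℕ} (hmn : m + n ≤ K) {p : ℝ × ℝ}
    (hp : p ∈ S) : Tendsto (pd m n v) (𝓝[R] p) (𝓝 (sideDeriv R v p m n)) :=
  tendsto_nhds_limUnder (h.2 m n hmn p hp)

lemma mono (h : SmoothUpToOrder K R S v) {L : ℕ} (hL : L ≤ K) : SmoothUpToOrder L R S v :=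
  ⟨h.1.of_le (by exact_mod_cast hL), fun m n hmn => h.2 m n (hmn.trans hL)⟩

lemma congr (hR : IsOpen R) (h : SmoothUpToOrder K R S v) (hvw : EqOn v w R) :
    SmoothUpToOrder K R S w :=
  ⟨h.1.congr fun _ hp => (hvw hp).symm, fun m n hmn p hp => (h.2 m n hmn p hp).imp fun _ hl =>
    hl.congr' ((eqOn_pd hR hvw m n).eventuallyEq_of_mem self_mem_nhdsWithin)⟩

lemma dX (hR : IsOpen R) (h : SmoothUpToOrder (K + 1) R S v) : SmoothUpToOrder K R S (dX v) :=
  ⟨contDiffOn_dX hR (by push_cast; exact le_rfl) h.1, fun m n hmn p hp =>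
    (h.2 (m + 1) n (by omega) p hp).imp fun _ hl => hl.congr'
      ((pd_dX hR h.1 (by omega)).symm.eventuallyEq_of_mem self_mem_nhdsWithin)⟩

lemma dY (hR : IsOpen R) (h : SmoothUpToOrder (K + 1) R S v) : SmoothUpToOrder K R S (dY v) :=
  ⟨contDiffOn_dY hR (by push_cast; exact le_rfl) h.1, fun m n hmn p hp =>
    h.2 m (n + 1) (by omega) p hp⟩

lemma sideDeriv_dX (hR : IsOpen R) (h : SmoothUpToOrder K R S v) (p : ℝ × ℝ) {m n : ℕ}
    (hmn : m + n + 1 ≤ K) :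
    sideDeriv R (EllipticInterface.dX v) p m n = shX (sideDeriv R v p) m n :=
  sideDeriv_congr p (pd_dX hR h.1 hmn)

lemma sideDeriv_dY (p : ℝ × ℝ) (m n : ℕ) :
    sideDeriv R (EllipticInterface.dY v) p m n = shY (sideDeriv R v p) m n := rfl

lemma tendsto_add (hR : IsOpen R) (hv : SmoothUpToOrder K R S v) (hw : SmoothUpToOrder K R S w)
    {p : ℝ × ℝ} (hp : p ∈ S) {m n : ℕ} (hmn : m + n ≤ K) :
    Tendsto (pd m n fun q => v q + w q) (𝓝[R] p)
      (𝓝 (sideDeriv R v p m n + sideDeriv R w p m n)) :=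
  ((hv.tendsto hmn hp).add (hw.tendsto hmn hp)).congr'
    ((pd_add hR hv.1 hw.1 hmn).symm.eventuallyEq_of_mem self_mem_nhdsWithin)

lemma add (hR : IsOpen R) (hv : SmoothUpToOrder K R S v) (hw : SmoothUpToOrder K R S w) :
    SmoothUpToOrder K R S (fun q => v q + w q) :=
  ⟨hv.1.add hw.1, fun _ _ hmn _ hp => ⟨_, tendsto_add hR hv hw hp hmn⟩⟩

lemma sideDeriv_add (hR : IsOpen R) (hv : SmoothUpToOrder K R S v)
    (hw : SmoothUpToOrder K R S w) {p : ℝ × ℝ} (hp : p ∈ S) [(𝓝[R] p).NeBot] {m n : ℕ}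
    (hmn : m + n ≤ K) :
    sideDeriv R (fun q => v q + w q) p m n = sideDeriv R v p m n + sideDeriv R w p m n :=
  (tendsto_add hR hv hw hp hmn).limUnder_eq

lemma sideDeriv_neg (h : SmoothUpToOrder K R S v) {p : ℝ × ℝ} (hp : p ∈ S) [(𝓝[R] p).NeBot]
    {m n : ℕ} (hmn : m + n ≤ K) :
    sideDeriv R (fun q => - v q) p m n = - sideDeriv R v p m n := by
  rw [sideDeriv, pd_neg]
  exact (h.tendsto hmn hp).neg.limUnder_eq

lemma tendsto_mul (hR : IsOpen R) (hv : SmoothUpToOrder K R S v) (hw : SmoothUpToOrder K R S w)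
    {p : ℝ × ℝ} (hp : p ∈ S) {m n : ℕ} (hmn : m + n ≤ K) :
    Tendsto (pd m n fun q => v q * w q) (𝓝[R] p)
      (𝓝 (mulA (sideDeriv R v p) (sideDeriv R w p) m n)) := by
  refine Tendsto.congr' ((pd_mul hR hv.1 hw.1 hmn).symm.eventuallyEq_of_mem self_mem_nhdsWithin) ?_
  simp only [mulA_apply]
  refine tendsto_finsetSum _ fun i hi => Tendsto.const_mul _ <| tendsto_finsetSum _ fun j hj =>
    Tendsto.const_mul _ ?_
  simp only [Finset.mem_range] at hi hj
  exact (hv.tendsto (by omega) hp).mul (hw.tendsto (by omega) hp)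

lemma mul (hR : IsOpen R) (hv : SmoothUpToOrder K R S v) (hw : SmoothUpToOrder K R S w) :
    SmoothUpToOrder K R S (fun q => v q * w q) :=
  ⟨hv.1.mul hw.1, fun _ _ hmn _ hp => ⟨_, tendsto_mul hR hv hw hp hmn⟩⟩

lemma sideDeriv_mul (hR : IsOpen R) (hv : SmoothUpToOrder K R S v)
    (hw : SmoothUpToOrder K R S w) {p : ℝ × ℝ} (hp : p ∈ S) [(𝓝[R] p).NeBot] {m n : ℕ}
    (hmn : m + n ≤ K) :
    sideDeriv R (fun q => v q * w q) p m n = mulA (sideDeriv R v p) (sideDeriv R w p) m n :=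
  (tendsto_mul hR hv hw hp hmn).limUnder_eq

lemma tendsto_of_contDiffOn {U : Set (ℝ × ℝ)} (hU : IsOpen U) (h : ContDiffOn ℝ ∞ v U)
    (hRU : R ⊆ U) {p : ℝ × ℝ} (hp : p ∈ U) (m n : ℕ) :
    Tendsto (pd m n v) (𝓝[R] p) (𝓝 (pd m n v p)) := by
  have h1 : ContDiffOn ℝ ((m + n : ℕ) : WithTop ℕ∞) v U := h.of_le (by exact_mod_cast le_top)
  exact ((contDiffOn_pd hU h1 (l := 0) le_rfl).continuousOn p hp).mono_left
    (nhdsWithin_mono p hRU)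

lemma of_contDiffOn {U : Set (ℝ × ℝ)} (hU : IsOpen U) (h : ContDiffOn ℝ ∞ v U) (hRU : R ⊆ U)
    (hSU : S ⊆ U) (K : ℕ) : SmoothUpToOrder K R S v :=
  ⟨(h.of_le (by exact_mod_cast le_top)).mono hRU,
    fun m n _ _ hp => ⟨_, tendsto_of_contDiffOn hU h hRU (hSU hp) m n⟩⟩

lemma sideDeriv_of_contDiffOn {U : Set (ℝ × ℝ)} (hU : IsOpen U) (h : ContDiffOn ℝ ∞ v U)
    (hRU : R ⊆ U) {p : ℝ × ℝ} (hp : p ∈ U) [(𝓝[R] p).NeBot] (m n : ℕ) :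
    sideDeriv R v p m n = pd m n v p :=
  (tendsto_of_contDiffOn hU h hRU hp m n).limUnder_eq

end SmoothUpToOrder

lemma SmoothUpTo.smoothUpToOrder {R S : Set (ℝ × ℝ)} {v : ℝ × ℝ → ℝ} (h : SmoothUpTo R S v)
    (K : ℕ) : SmoothUpToOrder K R S v :=
  ⟨h.1.of_le (by exact_mod_cast le_top), fun m n _ => h.2 m n⟩

/-- A uniformly continuous function maps the Cauchy filter `𝓝[R] p` to a Cauchy filter, which
converges since `ℝ` is complete. -/
lemma UniformlySmooth.smoothUpToOrder {K : ℕ} {R S : Set (ℝ × ℝ)} {v : ℝ × ℝ → ℝ}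
    (h : UniformlySmooth K R v) (hS : S ⊆ closure R) : SmoothUpToOrder K R S v := by
  refine ⟨h.1, fun m n hmn p hp => ?_⟩
  have : (𝓝[R] p).NeBot := mem_closure_iff_nhdsWithin_neBot.mp (hS hp)
  have h2 := h.2 m n hmn
  have hc : Cauchy (map (pd m n v) (𝓝[R] p)) := by
    refine Cauchy.map_of_le (cauchy_nhds.mono nhdsWithin_le_nhds) h2 ?_
    exact le_principal_iff.mpr self_mem_nhdsWithin
  exact cauchy_map_iff_exists_tendsto.mp hc

/-! ### Traces along a boundary curve -/

/-- The curve `t ↦ b + (r t, s t)`, `t ∈ I`, is smooth, runs in `S`, and locally can be pushed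
into the open region `R` by small multiples of a vector. -/
structure IsBoundaryCurve (R S : Set (ℝ × ℝ)) (b : ℝ × ℝ) (r s : ℝ → ℝ) (I : Set ℝ) : Prop where
  isOpen_region : IsOpen R
  isOpen_interval : IsOpen I
  smooth_r : ContDiffOn ℝ ∞ r I
  smooth_s : ContDiffOn ℝ ∞ s I
  mem : ∀ t ∈ I, b + (r t, s t) ∈ S
  push : ∀ t₀ ∈ I, ∃ e : ℝ × ℝ, ∀ᶠ z : ℝ × ℝ in 𝓝[>] (0 : ℝ) ×ˢ 𝓝 t₀,
    b + (r z.2, s z.2) + z.1 • e ∈ R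

/-- The values on a curve of the limits of `v` from inside `R`. -/
def trace (R : Set (ℝ × ℝ)) (v : ℝ × ℝ → ℝ) (b : ℝ × ℝ) (r s : ℝ → ℝ) (t : ℝ) : ℝ :=
  sideDeriv R v (b + (r t, s t)) 0 0

lemma hasDerivAt_of_isOpen_of_contDiffOn {r : ℝ → ℝ} {I : Set ℝ} (hI : IsOpen I)
    (hr : ContDiffOn ℝ ∞ r I) {t : ℝ} (ht : t ∈ I) : HasDerivAt r (deriv r t) t :=
  ((hr.contDiffAt (hI.mem_nhds ht)).differentiableAt (by simp)).hasDerivAt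

lemma contDiffOn_deriv {r : ℝ → ℝ} {I : Set ℝ} (hI : IsOpen I) (hr : ContDiffOn ℝ ∞ r I) :
    ContDiffOn ℝ ∞ (deriv r) I :=
  hr.deriv_of_isOpen hI (by simp)

namespace IsBoundaryCurve

variable {R S : Set (ℝ × ℝ)} {b : ℝ × ℝ} {r s : ℝ → ℝ} {I : Set ℝ} {v : ℝ × ℝ → ℝ} {K : ℕ}

lemma continuousAt_curve (h : IsBoundaryCurve R S b r s I) {t : ℝ} (ht : t ∈ I) :
    ContinuousAt (fun t => b + (r t, s t)) t :=
  continuousAt_const.add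
    ((hasDerivAt_of_isOpen_of_contDiffOn h.isOpen_interval h.smooth_r ht).continuousAt.prodMk
      (hasDerivAt_of_isOpen_of_contDiffOn h.isOpen_interval h.smooth_s ht).continuousAt)

lemma hasDerivAt_curve (h : IsBoundaryCurve R S b r s I) {t : ℝ} (ht : t ∈ I) :
    HasDerivAt (fun t => b + (r t, s t)) (deriv r t, deriv s t) t :=
  ((hasDerivAt_of_isOpen_of_contDiffOn h.isOpen_interval h.smooth_r ht).prodMk
      (hasDerivAt_of_isOpen_of_contDiffOn h.isOpen_interval h.smooth_s ht)).const_add b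

lemma tendsto_push (h : IsBoundaryCurve R S b r s I) {t₀ : ℝ} (ht₀ : t₀ ∈ I) {e : ℝ × ℝ}
    (he : ∀ᶠ z : ℝ × ℝ in 𝓝[>] (0 : ℝ) ×ˢ 𝓝 t₀, b + (r z.2, s z.2) + z.1 • e ∈ R) :
    Tendsto (fun z : ℝ × ℝ => b + (r z.2, s z.2) + z.1 • e) (𝓝[>] (0 : ℝ) ×ˢ 𝓝 t₀)
      (𝓝[R] (b + (r t₀, s t₀))) := by
  refine tendsto_nhdsWithin_iff.mpr ⟨?_, he⟩
  have h1 : Tendsto (fun z : ℝ × ℝ => b + (r z.2, s z.2)) (𝓝[>] (0 : ℝ) ×ˢ 𝓝 t₀)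
      (𝓝 (b + (r t₀, s t₀))) := (h.continuousAt_curve ht₀).tendsto.comp tendsto_snd
  have h2 : Tendsto (fun z : ℝ × ℝ => z.1 • e) (𝓝[>] (0 : ℝ) ×ˢ 𝓝 t₀) (𝓝 ((0 : ℝ) • e)) :=
    (tendsto_fst.mono_right nhdsWithin_le_nhds).smul_const e
  simpa using h1.add h2

lemma neBot (h : IsBoundaryCurve R S b r s I) {t : ℝ} (ht : t ∈ I) :
    (𝓝[R] (b + (r t, s t))).NeBot := by
  obtain ⟨e, he⟩ := h.push t ht
  exact (h.tendsto_push ht he).neBot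

lemma trace_tendsto (h : IsBoundaryCurve R S b r s I) (hv : SmoothUpToOrder K R S v) {t : ℝ}
    (ht : t ∈ I) : Tendsto v (𝓝[R] (b + (r t, s t))) (𝓝 (trace R v b r s t)) :=
  hv.tendsto (Nat.zero_le _) (h.mem t ht)

/-- Along the curve the trace is the extension of `v` by limits, and such an extension is continuous
wherever the limits exist. -/
lemma continuousOn_trace (h : IsBoundaryCurve R S b r s I) (hv : SmoothUpToOrder K R S v) :
    ContinuousOn (trace R v b r s) I := by
  have h1 : ContinuousOn (extendFrom R v) ((fun t => b + (r t, s t)) '' I) := by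
    refine continuousOn_extendFrom ?_ ?_
    · rintro _ ⟨t, ht, rfl⟩
      exact mem_closure_iff_nhdsWithin_neBot.mpr (h.neBot ht)
    · rintro _ ⟨t, ht, rfl⟩
      exact ⟨_, h.trace_tendsto hv ht⟩
  exact h1.comp (fun t ht => (h.continuousAt_curve ht).continuousWithinAt) (mapsTo_image _ _)

/-- The chain rule for limits from one side along a boundary curve. -/
lemma hasDerivAt_trace (h : IsBoundaryCurve R S b r s I) (hv : SmoothUpToOrder (K + 1) R S v)
    {t₀ : ℝ} (ht₀ : t₀ ∈ I) :
    HasDerivAt (trace R v b r s)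
      (trace R (dX v) b r s t₀ * deriv r t₀ + trace R (dY v) b r s t₀ * deriv s t₀) t₀ := by
  have hR := h.isOpen_region
  obtain ⟨e, he⟩ := h.push t₀ ht₀
  -- A product neighbourhood on which every pushed point lies in `R`, so that each pushed curve can
  -- be differentiated on a common parameter set.
  obtain ⟨E, hE, W, hW, hEW⟩ := Filter.mem_prod_iff.mp he
  obtain ⟨W', hW'W, hW'o, ht₀W⟩ := mem_nhds_iff.mp hW
  have hJo : IsOpen (W' ∩ I) := hW'o.inter h.isOpen_interval
  have hpush : ∀ ε ∈ E, ∀ t ∈ W' ∩ I, b + (r t, s t) + ε • e ∈ R := fun ε hε t ht =>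
    hEW (Set.mk_mem_prod hε (hW'W ht.1))
  have hpush' : ∀ t ∈ W' ∩ I, ∀ᶠ z : ℝ × ℝ in 𝓝[>] (0 : ℝ) ×ˢ 𝓝 t,
      b + (r z.2, s z.2) + z.1 • e ∈ R := by
    intro t ht
    filter_upwards [prod_mem_prod hE (hJo.mem_nhds ht)] with z hz
    exact hpush _ hz.1 _ hz.2
  have hlim : ∀ w : ℝ × ℝ → ℝ, SmoothUpToOrder K R S w → ∀ t ∈ W' ∩ I,
      Tendsto (fun z : ℝ × ℝ => w (b + (r z.2, s z.2) + z.1 • e)) (𝓝[>] (0 : ℝ) ×ˢ 𝓝 t)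
        (𝓝 (trace R w b r s t)) := fun w hw t ht =>
    (h.trace_tendsto hw ht.2).comp (h.tendsto_push ht.2 (hpush' t ht))
  have hcr : ∀ t ∈ I, ContinuousAt (deriv r) t := fun t ht =>
    (contDiffOn_deriv h.isOpen_interval h.smooth_r).continuousOn.continuousAt
      (h.isOpen_interval.mem_nhds ht)
  have hcs : ∀ t ∈ I, ContinuousAt (deriv s) t := fun t ht =>
    (contDiffOn_deriv h.isOpen_interval h.smooth_s).continuousOn.continuousAt
      (h.isOpen_interval.mem_nhds ht)
  -- The trace is the limit of `v` along the curve pushed by `ε • e` as `ε → 0+`. There the ordinary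
  -- chain rule holds, and locally uniform convergence of the derivatives passes it to the limit.
  refine hasDerivAt_of_tendstoLocallyUniformlyOn (l := 𝓝[>] (0 : ℝ)) hJo
    (f := fun ε t => v (b + (r t, s t) + ε • e))
    (f' := fun ε t => dX v (b + (r t, s t) + ε • e) * deriv r t
      + dY v (b + (r t, s t) + ε • e) * deriv s t)
    (g' := fun t => trace R (dX v) b r s t * deriv r t + trace R (dY v) b r s t * deriv s t)
    ?_ ?_ ?_ ⟨ht₀W, ht₀⟩
  -- Locally uniform convergence follows from convergence jointly in `(ε, t)` together with
  -- continuity of the limit: both components tend to the same number.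
  · rw [hJo.tendstoLocallyUniformlyOn_iff_forall_tendsto]
    intro t ht
    refine Tendsto.mono_right ?_ (nhds_le_uniformity
      (trace R (dX v) b r s t * deriv r t + trace R (dY v) b r s t * deriv s t))
    rw [nhds_prod_eq]
    refine Tendsto.prodMk ?_ ?_
    · refine Tendsto.comp (g := fun t => trace R (dX v) b r s t * deriv r t
        + trace R (dY v) b r s t * deriv s t) (y := 𝓝 t) ?_ tendsto_snd
      have c1 := (h.continuousOn_trace (hv.dX hR)).continuousAt (h.isOpen_interval.mem_nhds ht.2)
      have c2 := (h.continuousOn_trace (hv.dY hR)).continuousAt (h.isOpen_interval.mem_nhds ht.2)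
      exact ((c1.mul (hcr t ht.2)).add (c2.mul (hcs t ht.2))).tendsto
    · exact ((hlim _ (hv.dX hR) t ht).mul ((hcr t ht.2).tendsto.comp tendsto_snd)).add
        ((hlim _ (hv.dY hR) t ht).mul ((hcs t ht.2).tendsto.comp tendsto_snd))
  · filter_upwards [hE] with ε hε t ht
    have hd : DifferentiableAt ℝ v (b + (r t, s t) + ε • e) :=
      differentiableAt_pd hR hv.1 (m := 0) (n := 0) (by omega) (hpush ε hε t ht)
    have h1 := hd.hasFDerivAt.comp_hasDerivAt t ((h.hasDerivAt_curve ht.2).add_const (ε • e))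
    refine h1.congr_deriv ?_
    rw [show ((deriv r t, deriv s t) : ℝ × ℝ) = deriv r t • (1, 0) + deriv s t • (0, 1) by simp,
      map_add, map_smul, map_smul, dX, dY, smul_eq_mul, smul_eq_mul]
    ring
  · intro t ht
    exact (hlim v (hv.mono (Nat.le_succ K)) t ht).comp
      (tendsto_id.prodMk (tendsto_const_nhds (x := t)))

lemma contDiffOn_trace (h : IsBoundaryCurve R S b r s I) (hv : SmoothUpToOrder K R S v) :
    ContDiffOn ℝ K (trace R v b r s) I := by
  induction K generalizing v with
  | zero => exact contDiffOn_zero.mpr (h.continuousOn_trace hv)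
  | succ K ih =>
    push_cast
    rw [contDiffOn_succ_iff_deriv_of_isOpen h.isOpen_interval]
    refine ⟨fun t ht => (h.hasDerivAt_trace hv ht).differentiableAt.differentiableWithinAt,
      by simp, ?_⟩
    have hR := h.isOpen_region
    have hle : (K : WithTop ℕ∞) ≤ ∞ := by exact_mod_cast le_top
    refine ContDiffOn.congr ?_ fun t ht => (h.hasDerivAt_trace hv ht).deriv
    exact ((ih (hv.dX hR)).mul
      ((contDiffOn_deriv h.isOpen_interval h.smooth_r).of_le hle)).add ((ih (hv.dY hR)).mul
      ((contDiffOn_deriv h.isOpen_interval h.smooth_s).of_le hle))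

/-- The derivatives of a trace in terms of the one-sided derivatives. -/
lemma iteratedDeriv_trace (h : IsBoundaryCurve R S b r s I) (hv : SmoothUpToOrder K R S v)
    {t : ℝ} (ht : t ∈ I) {k : ℕ} (hk : k ≤ K) :
    iteratedDeriv k (trace R v b r s) t =
      tr (fun i => iteratedDeriv i r t) (fun i => iteratedDeriv i s t) k
        (sideDeriv R v (b + (r t, s t))) := by
  induction k using Nat.strong_induction_on generalizing v K with
  | _ k ih =>
    cases k with
    | zero => simp [trace]
    | succ k =>
      -- Lowering the order to exactly `k + 1` leaves the first partial derivatives with order `k`,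
      -- as the induction hypothesis requires.
      replace hv := hv.mono hk
      have hR := h.isOpen_region
      have hI := h.isOpen_interval.mem_nhds ht
      have hle : (k : WithTop ℕ∞) ≤ ∞ := by exact_mod_cast le_top
      have hX := (h.contDiffOn_trace (hv.dX hR)).contDiffAt hI
      have hY := (h.contDiffOn_trace (hv.dY hR)).contDiffAt hI
      have hr := ((contDiffOn_deriv h.isOpen_interval h.smooth_r).of_le hle).contDiffAt hI
      have hs := ((contDiffOn_deriv h.isOpen_interval h.smooth_s).of_le hle).contDiffAt hI
      have hev : deriv (trace R v b r s) =ᶠ[𝓝 t]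
          (trace R (dX v) b r s * deriv r) + (trace R (dY v) b r s * deriv s) := by
        filter_upwards [hI] with t' ht'
        exact (h.hasDerivAt_trace hv ht').deriv
      rw [iteratedDeriv_succ', hev.iteratedDeriv_eq, iteratedDeriv_add
        (f := trace R (dX v) b r s * deriv r) (g := trace R (dY v) b r s * deriv s)
        (hX.mul hr) (hY.mul hs),
        iteratedDeriv_mul hX hr, iteratedDeriv_mul hY hs, tr_succ, ← Finset.sum_add_distrib]
      refine Finset.sum_congr rfl fun j hj => ?_
      rw [Finset.mem_range] at hj
      rw [ih j hj (hv.dX hR) (by omega), ih j hj (hv.dY hR) (by omega), ← iteratedDeriv_succ',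
        ← iteratedDeriv_succ', tr_congr (fun _ _ => rfl) (fun _ _ => rfl)
          (c := sideDeriv R (dX v) (b + (r t, s t)))
          (c' := shX (sideDeriv R v (b + (r t, s t))))
          (fun i l hil => hv.sideDeriv_dX hR _ (by omega))]
      rw [show sideDeriv R (dY v) (b + (r t, s t)) = shY (sideDeriv R v (b + (r t, s t))) from rfl]
      ring

end IsBoundaryCurve

/-! ### The equation and the flux in terms of one-sided derivatives -/

lemma fderiv_eq_dX_dY (v : ℝ × ℝ → ℝ) (p e : ℝ × ℝ) :
    fderiv ℝ v p e = dX v p * e.1 + dY v p * e.2 := by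
  conv_lhs => rw [show e = e.1 • ((1, 0) : ℝ × ℝ) + e.2 • ((0, 1) : ℝ × ℝ) by ext <;> simp]
  rw [map_add, map_smul, map_smul, dX, dY, smul_eq_mul, smul_eq_mul]
  ring

/-- The equation is differentiated inside `R`, and the limit at `p` is taken term by term. -/
lemma ell_sideDeriv {R S : Set (ℝ × ℝ)} (hR : IsOpen R) {K : ℕ} {a u f : ℝ × ℝ → ℝ}
    (ha : SmoothUpToOrder (K + 1) R S a) (hu : SmoothUpToOrder (K + 2) R S u)
    (hpde : ∀ p ∈ R, -(dX (fun q => a q * dX u q) p + dY (fun q => a q * dY u q) p) = f p)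
    {p : ℝ × ℝ} (hp : p ∈ S) [(𝓝[R] p).NeBot] {m n : ℕ} (hmn : m + n ≤ K) :
    ell (sideDeriv R a p) (sideDeriv R u p) m n = - sideDeriv R f p m n := by
  have h1 := ha.mul hR (hu.dX hR)
  have h2 := ha.mul hR (hu.dY hR)
  have h3 := (h1.dX hR).add hR (h2.dY hR)
  rw [← sideDeriv_congr p (eqOn_pd hR (fun p hp => hpde p hp) m n), h3.sideDeriv_neg hp hmn,
    neg_neg, (h1.dX hR).sideDeriv_add hR (h2.dY hR) hp hmn, ell_apply,
    h1.sideDeriv_dX hR p (by omega), SmoothUpToOrder.sideDeriv_dY, shX_apply, shY_apply,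
    ha.sideDeriv_mul hR (hu.dX hR) hp (by omega), ha.sideDeriv_mul hR (hu.dY hR) hp (by omega)]
  congr 1
  · exact mulA_congr (fun _ _ _ => rfl) fun i j hij => (hu.sideDeriv_dX hR p (by omega)).symm

/-- The trace of `a ∂u/∂x s' - a ∂u/∂y r'`. -/
def fluxTrace (R : Set (ℝ × ℝ)) (a u : ℝ × ℝ → ℝ) (b : ℝ × ℝ) (r s : ℝ → ℝ) : ℝ → ℝ :=
  trace R (fun q => a q * dX u q) b r s * deriv s - trace R (fun q => a q * dY u q) b r s * deriv r

namespace IsBoundaryCurve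

variable {R S : Set (ℝ × ℝ)} {b : ℝ × ℝ} {r s : ℝ → ℝ} {I : Set ℝ} {a u : ℝ × ℝ → ℝ} {K : ℕ}

lemma contDiffOn_fluxTrace (h : IsBoundaryCurve R S b r s I) (ha : SmoothUpToOrder K R S a)
    (hu : SmoothUpToOrder (K + 1) R S u) : ContDiffOn ℝ K (fluxTrace R a u b r s) I := by
  have hR := h.isOpen_region
  have hle : (K : WithTop ℕ∞) ≤ ∞ := by exact_mod_cast le_top
  exact ((h.contDiffOn_trace (ha.mul hR (hu.dX hR))).mul
    ((contDiffOn_deriv h.isOpen_interval h.smooth_s).of_le hle)).sub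
    ((h.contDiffOn_trace (ha.mul hR (hu.dY hR))).mul
    ((contDiffOn_deriv h.isOpen_interval h.smooth_r).of_le hle))

lemma iteratedDeriv_fluxTrace (h : IsBoundaryCurve R S b r s I) (ha : SmoothUpToOrder K R S a)
    (hu : SmoothUpToOrder (K + 1) R S u) {t : ℝ} (ht : t ∈ I) {k : ℕ} (hk : k ≤ K) :
    iteratedDeriv k (fluxTrace R a u b r s) t =
      fl (fun i => iteratedDeriv i r t) (fun i => iteratedDeriv i s t)
        (sideDeriv R a (b + (r t, s t))) k (sideDeriv R u (b + (r t, s t))) := by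
  have hR := h.isOpen_region
  have := h.neBot ht
  have hI := h.isOpen_interval.mem_nhds ht
  replace ha := ha.mono hk
  replace hu := hu.mono (Nat.succ_le_succ hk)
  have hle : (k : WithTop ℕ∞) ≤ ∞ := by exact_mod_cast le_top
  have hX := (h.contDiffOn_trace (ha.mul hR (hu.dX hR))).contDiffAt hI
  have hY := (h.contDiffOn_trace (ha.mul hR (hu.dY hR))).contDiffAt hI
  have hr := ((contDiffOn_deriv h.isOpen_interval h.smooth_r).of_le hle).contDiffAt hI
  have hs := ((contDiffOn_deriv h.isOpen_interval h.smooth_s).of_le hle).contDiffAt hI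
  rw [fluxTrace, iteratedDeriv_sub
      (f := trace R (fun q => a q * dX u q) b r s * deriv s)
      (g := trace R (fun q => a q * dY u q) b r s * deriv r) (hX.mul hs) (hY.mul hr), iteratedDeriv_mul hX hs,
    iteratedDeriv_mul hY hr, fl_apply, ← Finset.sum_sub_distrib]
  refine Finset.sum_congr rfl fun j hj => ?_
  rw [Finset.mem_range] at hj
  rw [h.iteratedDeriv_trace (ha.mul hR (hu.dX hR)) ht (by omega),
    h.iteratedDeriv_trace (ha.mul hR (hu.dY hR)) ht (by omega), ← iteratedDeriv_succ',
    ← iteratedDeriv_succ']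
  rw [tr_congr (fun _ _ => rfl) (fun _ _ => rfl)
      (c := sideDeriv R (fun q => a q * dX u q) (b + (r t, s t)))
      (c' := mulA (sideDeriv R a (b + (r t, s t))) (shX (sideDeriv R u (b + (r t, s t))))) ?_,
    tr_congr (fun _ _ => rfl) (fun _ _ => rfl)
      (c := sideDeriv R (fun q => a q * dY u q) (b + (r t, s t)))
      (c' := mulA (sideDeriv R a (b + (r t, s t))) (shY (sideDeriv R u (b + (r t, s t))))) ?_]
  · ring
  · intro i l hil
    rw [ha.sideDeriv_mul hR (hu.dY hR) (h.mem t ht) (by omega)]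
    rfl
  · intro i l hil
    rw [ha.sideDeriv_mul hR (hu.dX hR) (h.mem t ht) (by omega)]
    exact mulA_congr (fun _ _ _ => rfl) fun i' l' h' => hu.sideDeriv_dX hR _ (by omega)

/-- A smooth curve in a regular level set is a boundary curve of the superlevel set. -/
lemma of_levelSet {U S : Set (ℝ × ℝ)} {φ : ℝ × ℝ → ℝ} (hU : IsOpen U)
    (hφ : ContDiffOn ℝ ∞ φ U) (hI : IsOpen I) (hr : ContDiffOn ℝ ∞ r I)
    (hs : ContDiffOn ℝ ∞ s I) (hmem : ∀ t ∈ I, b + (r t, s t) ∈ S)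
    (hS : ∀ p ∈ S, p ∈ U ∧ φ p = 0 ∧ (dX φ p, dY φ p) ≠ (0, 0)) :
    IsBoundaryCurve {p | p ∈ U ∧ 0 < φ p} S b r s I where
  isOpen_region := hφ.continuousOn.isOpen_inter_preimage hU isOpen_Ioi
  isOpen_interval := hI
  smooth_r := hr
  smooth_s := hs
  mem := hmem
  push := by
    intro t₀ ht₀
    obtain ⟨hp0U, -, hgrad⟩ := hS _ (hmem t₀ ht₀)
    set p0 := b + (r t₀, s t₀) with hp0
    -- The push direction is the gradient at `p0`, along which `φ` increases; it is kept fixed for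
    -- nearby points of the curve.
    set e : ℝ × ℝ := (dX φ p0, dY φ p0) with he
    have hd : 0 < fderiv ℝ φ p0 e := by
      rw [fderiv_eq_dX_dY]
      rcases not_and_or.mp (fun hh : dX φ p0 = 0 ∧ dY φ p0 = 0 => hgrad (Prod.ext hh.1 hh.2))
        with h1 | h1
      · exact add_pos_of_pos_of_nonneg (mul_self_pos.mpr h1) (mul_self_nonneg _)
      · exact add_pos_of_nonneg_of_pos (mul_self_nonneg _) (mul_self_pos.mpr h1)
    have hen : 0 < ‖e‖ := norm_pos_iff.mpr hgrad
    refine ⟨e, ?_⟩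
    have hc : ContinuousAt (fun t => b + (r t, s t)) t₀ :=
      continuousAt_const.add ((hasDerivAt_of_isOpen_of_contDiffOn hI hr ht₀).continuousAt.prodMk
        (hasDerivAt_of_isOpen_of_contDiffOn hI hs ht₀).continuousAt)
    have h1 : Tendsto (fun z : ℝ × ℝ => b + (r z.2, s z.2)) (𝓝[>] (0 : ℝ) ×ˢ 𝓝 t₀) (𝓝 p0) :=
      hc.tendsto.comp tendsto_snd
    have h2 : Tendsto (fun z : ℝ × ℝ => b + (r z.2, s z.2) + z.1 • e) (𝓝[>] (0 : ℝ) ×ˢ 𝓝 t₀)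
        (𝓝 p0) := by
      have h3 : Tendsto (fun z : ℝ × ℝ => z.1 • e) (𝓝[>] (0 : ℝ) ×ˢ 𝓝 t₀) (𝓝 ((0 : ℝ) • e)) :=
        (tendsto_fst.mono_right nhdsWithin_le_nhds).smul_const e
      simpa using h1.add h3
    -- Strict differentiability is needed since the base point on the curve varies. The constant
    -- makes the error at most half of the linear increment `z.1 * fderiv ℝ φ p0 e`, so `φ` stays
    -- positive.
    have hst := ((hφ.contDiffAt (hU.mem_nhds hp0U)).hasStrictFDerivAt (by simp)).isLittleO
    have hev := (h2.prodMk_nhds h1).eventually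
      (hst.def (c := fderiv ℝ φ p0 e / (2 * ‖e‖)) (by positivity))
    filter_upwards [hev, h2.eventually (hU.mem_nhds hp0U),
      prod_mem_prod self_mem_nhdsWithin (hI.mem_nhds ht₀)] with z hz hzU hzm
    refine ⟨hzU, ?_⟩
    have hz0 : 0 < z.1 := hzm.1
    rw [(hS _ (hmem _ hzm.2)).2.1, add_sub_cancel_left, map_smul, norm_smul, Real.norm_eq_abs,
      Real.norm_eq_abs, abs_of_pos hz0, smul_eq_mul, sub_zero] at hz
    have h4 : fderiv ℝ φ p0 e / (2 * ‖e‖) * (z.1 * ‖e‖) = z.1 * fderiv ℝ φ p0 e / 2 := by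
      field_simp
    rw [h4] at hz
    have h5 := (abs_le.mp hz).1
    have h6 := mul_pos hz0 hd
    linarith

end IsBoundaryCurve

/-! ### Interface problems -/

namespace InterfaceProblem

variable {P : InterfaceProblem}

lemma isOpen_Ω (P : InterfaceProblem) : IsOpen P.Ω := isOpen_Ioo.prod isOpen_Ioo

lemma Ωm_eq (P : InterfaceProblem) : P.Ωm = {p | p ∈ P.Ω ∧ 0 < -P.ψ p} := by
  ext p
  simp [Ωm]

lemma Regular.isBoundaryCurve_pos (hP : P.Regular) {b : ℝ × ℝ} {r s : ℝ → ℝ} {I : Set ℝ}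
    (hI : IsOpen I) (hr : ContDiffOn ℝ ∞ r I) (hs : ContDiffOn ℝ ∞ s I)
    (hmem : ∀ t ∈ I, b + (r t, s t) ∈ P.Γ) : IsBoundaryCurve P.Ωp P.Γ b r s I :=
  IsBoundaryCurve.of_levelSet P.isOpen_Ω hP.smooth_ψ hI hr hs hmem
    fun p hp => ⟨hp.1, hp.2, hP.grad_ψ p hp⟩

lemma Regular.isBoundaryCurve_neg (hP : P.Regular) {b : ℝ × ℝ} {r s : ℝ → ℝ} {I : Set ℝ}
    (hI : IsOpen I) (hr : ContDiffOn ℝ ∞ r I) (hs : ContDiffOn ℝ ∞ s I)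
    (hmem : ∀ t ∈ I, b + (r t, s t) ∈ P.Γ) : IsBoundaryCurve P.Ωm P.Γ b r s I := by
  rw [Ωm_eq]
  refine IsBoundaryCurve.of_levelSet P.isOpen_Ω hP.smooth_ψ.neg hI hr hs hmem
    fun p hp => ⟨hp.1, by simp [hp.2], ?_⟩
  have h := hP.grad_ψ p hp
  have e1 : dX (fun q => -P.ψ q) p = - dX P.ψ p := by simp [dX, fderiv_fun_neg]
  have e2 : dY (fun q => -P.ψ q) p = - dY P.ψ p := by simp [dY, fderiv_fun_neg]
  simpa [e1, e2] using h

/-- The gradient is orthogonal to the tangent `(x, y)`, hence a multiple of `(y, -x)`; the sign of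
the multiple is that of the cross product. -/
lemma normal_eq {p : ℝ × ℝ} {x y : ℝ}
    (hgrad : (dX P.ψ p, dY P.ψ p) ≠ (0, 0))
    (hxy : 0 < x ^ 2 + y ^ 2)
    (ht : dX P.ψ p * x + dY P.ψ p * y = 0) {σ : ℝ}
    (hσ : Real.sign (dX P.ψ p * y - dY P.ψ p * x) = σ) :
    P.normal p = (σ * y / √(x ^ 2 + y ^ 2), -(σ * x) / √(x ^ 2 + y ^ 2)) ∧
      σ * σ = 1 := by
  rw [normal]
  set A := dX P.ψ p
  set B := dY P.ψ p
  set D := A * y - B * x with hD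
  have hAB : 0 < A ^ 2 + B ^ 2 := by
    rcases not_and_or.mp (fun hh : A = 0 ∧ B = 0 => hgrad (Prod.ext hh.1 hh.2)) with h1 | h1
    · exact add_pos_of_pos_of_nonneg (sq_pos_of_ne_zero h1) (sq_nonneg _)
    · exact add_pos_of_nonneg_of_pos (sq_nonneg _) (sq_pos_of_ne_zero h1)
  -- Lagrange's identity: the squares of the cross product and of the scalar product, here zero, add
  -- up to the product of the squared lengths.
  have hD2 : D ^ 2 = (A ^ 2 + B ^ 2) * (x ^ 2 + y ^ 2) := by
    rw [hD]; linear_combination -(A * x + B * y) * ht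
  have hD0 : D ≠ 0 := by
    intro h0
    rw [h0] at hD2
    have := mul_pos hAB hxy
    rw [← hD2] at this
    norm_num at this
  have habs : σ * |D| = D ∧ σ * σ = 1 := by
    rw [← hσ]
    rcases hD0.lt_or_gt with h | h
    · rw [Real.sign_of_neg h, abs_of_neg h]; constructor <;> ring
    · rw [Real.sign_of_pos h, abs_of_pos h]; constructor <;> ring
  have hDabs : |D| = √(A ^ 2 + B ^ 2) * √(x ^ 2 + y ^ 2) := by
    rw [← Real.sqrt_mul hAB.le, ← hD2, Real.sqrt_sq_eq_abs]
  have hQ := Real.sqrt_pos.mpr hAB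
  have hN := Real.sqrt_pos.mpr hxy
  have hN2 := Real.sq_sqrt hxy.le
  have hDσ : σ * (√(A ^ 2 + B ^ 2) * √(x ^ 2 + y ^ 2)) = D := by rw [← hDabs]; exact habs.1
  set Q := √(A ^ 2 + B ^ 2)
  set N := √(x ^ 2 + y ^ 2)
  refine ⟨Prod.ext ?_ ?_, habs.2⟩
  · change A / Q = σ * y / N
    rw [div_eq_div_iff hQ.ne' hN.ne']
    refine mul_right_cancel₀ hN.ne' ?_
    linear_combination A * hN2 - y * hDσ + x * ht + y * hD
  · change B / Q = -(σ * x) / N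
    rw [div_eq_div_iff hQ.ne' hN.ne']
    refine mul_right_cancel₀ hN.ne' ?_
    linear_combination B * hN2 + x * hDσ + y * ht - x * hD

/-- Near the base point, the normal is given by the orientation and the parametrization. -/
lemma Regular.eventually_normal_eq (hP : P.Regular) {b : ℝ × ℝ} {r s : ℝ → ℝ} {I : Set ℝ}
    (h : IsBoundaryCurve P.Ωp P.Γ b r s I) (h0 : (0 : ℝ) ∈ I) (hr0 : r 0 = 0) (hs0 : s 0 = 0)
    (hreg : ∀ t ∈ I, 0 < deriv r t ^ 2 + deriv s t ^ 2) :
    ∀ᶠ t in 𝓝 (0 : ℝ), t ∈ I ∧ P.normal (b + (r t, s t)) =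
      (P.orientation b r s * deriv s t / √(deriv r t ^ 2 + deriv s t ^ 2),
        -(P.orientation b r s * deriv r t) / √(deriv r t ^ 2 + deriv s t ^ 2)) ∧
      P.orientation b r s * P.orientation b r s = 1 := by
  have hΩ := P.isOpen_Ω
  -- Differentiation of `ψ = 0` along the curve.
  have htang : ∀ t ∈ I, dX P.ψ (b + (r t, s t)) * deriv r t
      + dY P.ψ (b + (r t, s t)) * deriv s t = 0 := by
    intro t ht
    have hd := ((hP.smooth_ψ.contDiffAt (hΩ.mem_nhds (h.mem t ht).1)).differentiableAt
      (by simp)).hasFDerivAt.comp_hasDerivAt t (h.hasDerivAt_curve ht)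
    have hz : P.ψ ∘ (fun t => b + (r t, s t)) =ᶠ[𝓝 t] fun _ => 0 := by
      filter_upwards [h.isOpen_interval.mem_nhds ht] with t' ht'
      exact (h.mem t' ht').2
    have := hd.deriv
    rw [hz.deriv_eq, deriv_const, fderiv_eq_dX_dY] at this
    exact this.symm
  have hcX : ContinuousOn (dX P.ψ) P.Ω :=
    (contDiffOn_dX (k := 0) hΩ (by simp) hP.smooth_ψ).continuousOn
  have hcY : ContinuousOn (dY P.ψ) P.Ω :=
    (contDiffOn_dY (k := 0) hΩ (by simp) hP.smooth_ψ).continuousOn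
  have hγ : ∀ v : ℝ × ℝ → ℝ, ContinuousOn v P.Ω →
      ContinuousAt (fun t => v (b + (r t, s t))) 0 := fun v hv =>
    ContinuousAt.comp (f := fun t => b + (r t, s t)) (g := v)
      (hv.continuousAt (hΩ.mem_nhds (h.mem 0 h0).1)) (h.continuousAt_curve h0)
  have hI := h.isOpen_interval.mem_nhds h0
  have hDc : ContinuousAt (fun t => dX P.ψ (b + (r t, s t)) * deriv s t
      - dY P.ψ (b + (r t, s t)) * deriv r t) 0 :=
    ((hγ _ hcX).mul ((contDiffOn_deriv h.isOpen_interval h.smooth_s).continuousOn.continuousAt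
      hI)).sub ((hγ _ hcY).mul
      ((contDiffOn_deriv h.isOpen_interval h.smooth_r).continuousOn.continuousAt hI))
  have hb : b + (r 0, s 0) = b := by rw [hr0, hs0]; simp
  -- Otherwise the gradient would be both parallel and orthogonal to the nonzero velocity, hence
  -- zero.
  have hD0 : dX P.ψ (b + (r 0, s 0)) * deriv s 0 - dY P.ψ (b + (r 0, s 0)) * deriv r 0 ≠ 0 := by
    intro hD
    have h1 := htang 0 h0
    have h2 := hreg 0 h0
    have h3 := hP.grad_ψ _ (h.mem 0 h0)
    set A := dX P.ψ (b + (r 0, s 0))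
    set B := dY P.ψ (b + (r 0, s 0))
    have hA : A * (deriv r 0 ^ 2 + deriv s 0 ^ 2) = 0 := by
      linear_combination deriv r 0 * h1 + deriv s 0 * hD
    have hB : B * (deriv r 0 ^ 2 + deriv s 0 ^ 2) = 0 := by
      linear_combination deriv s 0 * h1 - deriv r 0 * hD
    exact h3 (Prod.ext ((mul_eq_zero.mp hA).resolve_right h2.ne')
      ((mul_eq_zero.mp hB).resolve_right h2.ne'))
  -- The orientation is defined at the base point only; by continuity the nonvanishing cross product
  -- keeps its sign nearby.
  have hsign : ∀ᶠ t in 𝓝 (0 : ℝ), Real.sign (dX P.ψ (b + (r t, s t)) * deriv s t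
      - dY P.ψ (b + (r t, s t)) * deriv r t) = P.orientation b r s := by
    rw [orientation]
    conv in (dX P.ψ b * _ - _) => rw [← hb]
    rcases hD0.lt_or_gt with hlt | hgt
    · filter_upwards [hDc.eventually_lt continuousAt_const hlt] with t ht
      rw [Real.sign_of_neg ht, Real.sign_of_neg hlt]
    · filter_upwards [continuousAt_const.eventually_lt hDc hgt] with t ht
      rw [Real.sign_of_pos ht, Real.sign_of_pos hgt]
  filter_upwards [hI, hsign] with t ht hσ
  exact ⟨ht, normal_eq (hP.grad_ψ _ (h.mem t ht)) (hreg t ht) (htang t ht) hσ⟩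

end InterfaceProblem

/-! ### The speed of a curve -/

/-- The speed `√(r'² + s'²)` of a plane curve. -/
def speed (r s : ℝ → ℝ) (t : ℝ) : ℝ := √(deriv r t ^ 2 + deriv s t ^ 2)

/-- In the Leibniz expansion of `(f * f)^(k+1)` the order `k + 1` occurs only in the two extreme
terms, which sum to `2 f f^(k+1)`. Since `f t ≠ 0`, this top derivative is determined by the square
and the lower derivatives. -/
lemma iteratedDeriv_eq_of_mul_self {f g : ℝ → ℝ} {t : ℝ} {K : ℕ} (hf : ContDiffAt ℝ K f t)
    (hg : ContDiffAt ℝ K g t) (h0 : f t = g t) (hne : f t ≠ 0)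
    (h : ∀ k ≤ K, iteratedDeriv k (f * f) t = iteratedDeriv k (g * g) t) {k : ℕ} (hk : k ≤ K) :
    iteratedDeriv k f t = iteratedDeriv k g t := by
  induction k using Nat.strong_induction_on with
  | _ k ih =>
    cases k with
    | zero => simpa using h0
    | succ k =>
      have hle : ((k + 1 : ℕ) : WithTop ℕ∞) ≤ K := by exact_mod_cast hk
      have h1 := h (k + 1) hk
      rw [iteratedDeriv_mul (hf.of_le hle) (hf.of_le hle),
        iteratedDeriv_mul (hg.of_le hle) (hg.of_le hle), Finset.sum_range_succ,
        Finset.sum_range_succ', Finset.sum_range_succ _ (k + 1), Finset.sum_range_succ' _ k] at h1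
      have h2 : ∀ i ∈ Finset.range k, ((k + 1).choose (i + 1) : ℝ) * iteratedDeriv (i + 1) f t
          * iteratedDeriv (k + 1 - (i + 1)) f t = ((k + 1).choose (i + 1) : ℝ)
          * iteratedDeriv (i + 1) g t * iteratedDeriv (k + 1 - (i + 1)) g t := by
        intro i hi
        rw [Finset.mem_range] at hi
        rw [ih (i + 1) (by omega) (by omega), ih (k + 1 - (i + 1)) (by omega) (by omega)]
      rw [Finset.sum_congr rfl h2] at h1
      simp only [Nat.choose_zero_right, Nat.choose_self, Nat.cast_one, iteratedDeriv_zero,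
        Nat.sub_zero, Nat.sub_self, one_mul, ← h0] at h1
      have h3 : 2 * f t * (iteratedDeriv (k + 1) f t - iteratedDeriv (k + 1) g t) = 0 := by
        linear_combination h1
      have h4 := (mul_eq_zero.mp h3).resolve_left (by simpa using hne)
      linarith

lemma contDiffAt_deriv {r : ℝ → ℝ} {t : ℝ} (hr : ContDiffAt ℝ ∞ r t) :
    ContDiffAt ℝ ∞ (deriv r) t := hr.derivWithin (by simp)

lemma contDiffAt_speed {r s : ℝ → ℝ} {t : ℝ} (hr : ContDiffAt ℝ ∞ r t) (hs : ContDiffAt ℝ ∞ s t)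
    (hreg : 0 < deriv r t ^ 2 + deriv s t ^ 2) : ContDiffAt ℝ ∞ (speed r s) t :=
  (((contDiffAt_deriv hr).pow 2).add ((contDiffAt_deriv hs).pow 2)).sqrt hreg.ne'

lemma iteratedDeriv_deriv_mul_self_congr {r r' : ℝ → ℝ} {t : ℝ} {K : ℕ} (hr : ContDiffAt ℝ ∞ r t)
    (hr' : ContDiffAt ℝ ∞ r' t)
    (h : ∀ k ≤ K + 1, iteratedDeriv k r t = iteratedDeriv k r' t) {k : ℕ} (hk : k ≤ K) :
    iteratedDeriv k (deriv r * deriv r) t = iteratedDeriv k (deriv r' * deriv r') t := by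
  have hle : (k : WithTop ℕ∞) ≤ ∞ := by exact_mod_cast le_top
  have h1 := (contDiffAt_deriv hr).of_le hle
  have h2 := (contDiffAt_deriv hr').of_le hle
  rw [iteratedDeriv_mul h1 h1, iteratedDeriv_mul h2 h2]
  refine Finset.sum_congr rfl fun i hi => ?_
  rw [Finset.mem_range] at hi
  simp only [← iteratedDeriv_succ']
  rw [h (i + 1) (by omega), h (k - i + 1) (by omega)]

lemma eventually_speed_mul_self {r s : ℝ → ℝ} {t : ℝ} :
    speed r s * speed r s =ᶠ[𝓝 t] deriv r * deriv r + deriv s * deriv s := by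
  refine Eventually.of_forall fun t' => ?_
  simp only [Pi.mul_apply, Pi.add_apply, speed]
  rw [Real.mul_self_sqrt (by positivity)]
  ring

/-- The square of the speed is `r'² + s'²`, whose derivatives are visibly functions of those of the
curve. This makes the factor multiplying `g₂` depend on the jet alone, without an explicit formula
for it. -/
lemma iteratedDeriv_speed_congr {r s r' s' : ℝ → ℝ} {t : ℝ} {K : ℕ} (hr : ContDiffAt ℝ ∞ r t)
    (hs : ContDiffAt ℝ ∞ s t) (hr' : ContDiffAt ℝ ∞ r' t) (hs' : ContDiffAt ℝ ∞ s' t)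
    (hreg : 0 < deriv r t ^ 2 + deriv s t ^ 2)
    (h : ∀ k ≤ K + 1, iteratedDeriv k r t = iteratedDeriv k r' t)
    (h' : ∀ k ≤ K + 1, iteratedDeriv k s t = iteratedDeriv k s' t) {k : ℕ} (hk : k ≤ K) :
    iteratedDeriv k (speed r s) t = iteratedDeriv k (speed r' s') t := by
  have hle : ∀ k : ℕ, (k : WithTop ℕ∞) ≤ ∞ := fun k => by exact_mod_cast le_top
  have e1 : deriv r t = deriv r' t := by simpa [iteratedDeriv_one] using h 1 (by omega)
  have e2 : deriv s t = deriv s' t := by simpa [iteratedDeriv_one] using h' 1 (by omega)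
  have hreg' : 0 < deriv r' t ^ 2 + deriv s' t ^ 2 := by rwa [← e1, ← e2]
  refine iteratedDeriv_eq_of_mul_self ((contDiffAt_speed hr hs hreg).of_le (hle K))
    ((contDiffAt_speed hr' hs' hreg').of_le (hle K)) (by rw [speed, speed, e1, e2])
    (Real.sqrt_pos.mpr hreg).ne' (fun l hl => ?_) hk
  have c := fun {z : ℝ → ℝ} (hz : ContDiffAt ℝ ∞ z t) => (contDiffAt_deriv hz).of_le (hle l)
  rw [eventually_speed_mul_self.iteratedDeriv_eq, eventually_speed_mul_self.iteratedDeriv_eq,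
    iteratedDeriv_add (f := deriv r * deriv r) (g := deriv s * deriv s) ((c hr).mul (c hr))
      ((c hs).mul (c hs)),
    iteratedDeriv_add (f := deriv r' * deriv r') (g := deriv s' * deriv s') ((c hr').mul (c hr'))
      ((c hs').mul (c hs')), iteratedDeriv_deriv_mul_self_congr hr hr' h hl,
    iteratedDeriv_deriv_mul_self_congr hs hs' h' hl]

/-! ### Values of a jet -/

/-- The polynomial of degree at most `n` with the derivatives `c k` at `0`. -/
def taylorPoly (c : ℕ → ℝ) (n : ℕ) (t : ℝ) : ℝ :=
  ∑ k ∈ Finset.range (n + 1), c k / k.factorial * t ^ k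

lemma contDiff_taylorPoly (c : ℕ → ℝ) (n : ℕ) : ContDiff ℝ ∞ (taylorPoly c n) :=
  ContDiff.sum fun _ _ => contDiff_const.mul (contDiff_id.pow _)

lemma iteratedDeriv_taylorPoly (c : ℕ → ℝ) {n k : ℕ} (hk : k ≤ n) :
    iteratedDeriv k (taylorPoly c n) 0 = c k := by
  unfold taylorPoly
  rw [iteratedDeriv_fun_sum fun i _ => contDiffAt_const.mul (contDiffAt_id.pow _),
    Finset.sum_eq_single_of_mem k (Finset.mem_range.mpr (by omega))]
  · rw [iteratedDeriv_const_mul_field, iteratedDeriv_fun_pow_zero]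
    simp [Nat.factorial_ne_zero]
  · intro i _ hik
    rw [iteratedDeriv_const_mul_field, iteratedDeriv_fun_pow_zero]
    simp [hik.symm]

namespace Jet

variable {M : ℕ} (J : Jet M)

/-- The derivatives of the first coordinate of the curve, continued by `0`. -/
def rho (k : ℕ) : ℝ := if h : k < M + 2 then J.r ⟨k, h⟩ else 0

/-- The derivatives of the second coordinate of the curve, continued by `0`. -/
def sig (k : ℕ) : ℝ := if h : k < M + 2 then J.s ⟨k, h⟩ else 0

/-- The derivatives of the speed of the curve. -/
def spd (k : ℕ) : ℝ :=
  iteratedDeriv k (speed (taylorPoly J.rho (M + 1)) (taylorPoly J.sig (M + 1))) 0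

/-- The derivatives of the coefficient in `Ω⁺`, continued by `0`. -/
def apArray : DerivArray := ext (Lam M) J.ap

/-- The derivatives of the coefficient in `Ω⁻`, continued by `0`. -/
def amArray : DerivArray := ext (Lam M) J.am

variable {J}

lemma Admissible.rho_zero (hJ : J.Admissible) : J.rho 0 = 0 := by
  simpa [rho] using hJ.r_zero

lemma Admissible.sig_zero (hJ : J.Admissible) : J.sig 0 = 0 := by
  simpa [sig] using hJ.s_zero

lemma Admissible.reg (hJ : J.Admissible) : 0 < J.rho 1 ^ 2 + J.sig 1 ^ 2 := by
  have h := hJ.regular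
  have e : (1 : Fin (M + 2)) = ⟨1, by omega⟩ := rfl
  rw [e] at h
  simpa [rho, sig] using h

lemma Admissible.apArray_pos (hJ : J.Admissible) : 0 < J.apArray 0 0 := by
  rw [apArray, ext_apply_mem _ (mem_Lam.mpr (Nat.zero_le _))]
  exact hJ.ap_pos _ rfl

lemma Admissible.amArray_pos (hJ : J.Admissible) : 0 < J.amArray 0 0 := by
  rw [amArray, ext_apply_mem _ (mem_Lam.mpr (Nat.zero_le _))]
  exact hJ.am_pos _ rfl

end Jet

/-! ### The equations satisfied by the derivatives of a solution -/

namespace InterfaceProblem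

variable {P : InterfaceProblem} {u : ℝ × ℝ → ℝ} {b : ℝ × ℝ} {r s : ℝ → ℝ} {M : ℕ}

/-- The curve is a parametrization of the interface on the open set `I`. -/
structure IsParamOn (P : InterfaceProblem) (b : ℝ × ℝ) (r s : ℝ → ℝ) (I : Set ℝ) : Prop where
  isOpen : IsOpen I
  zero_mem : (0 : ℝ) ∈ I
  r_zero : r 0 = 0
  s_zero : s 0 = 0
  smooth_r : ContDiffOn ℝ ∞ r I
  smooth_s : ContDiffOn ℝ ∞ s I
  reg : ∀ t ∈ I, 0 < deriv r t ^ 2 + deriv s t ^ 2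
  mem : ∀ t ∈ I, b + (r t, s t) ∈ P.Γ

lemma IsParam.exists_isParamOn (h : P.IsParam b r s) : ∃ I, P.IsParamOn b r s I := by
  obtain ⟨ε, hε, h1, h2, h3⟩ := h.exists_param
  exact ⟨Ioo (-ε) ε, isOpen_Ioo, by simpa using hε, h.r_zero, h.s_zero, h1, h2,
    fun t ht => (h3 t ht).1, fun t ht => (h3 t ht).2⟩

namespace IsParamOn

variable {I : Set ℝ}

lemma pos (h : P.IsParamOn b r s I) (hP : P.Regular) : IsBoundaryCurve P.Ωp P.Γ b r s I :=
  hP.isBoundaryCurve_pos h.isOpen h.smooth_r h.smooth_s h.mem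

lemma neg (h : P.IsParamOn b r s I) (hP : P.Regular) : IsBoundaryCurve P.Ωm P.Γ b r s I :=
  hP.isBoundaryCurve_neg h.isOpen h.smooth_r h.smooth_s h.mem

lemma base (h : P.IsParamOn b r s I) : b + (r 0, s 0) = b := by
  rw [h.r_zero, h.s_zero]; simp

end IsParamOn

variable {I : Set ℝ}

/-- A boundary curve need not be regular, so the constant curve at `p` is admissible, and pushing it
gives points of `Ω⁺` near `p`. -/
lemma Regular.subset_closure_pos (hP : P.Regular) : P.Γ ⊆ closure P.Ωp := by
  intro p hp
  have hz : p + ((0 : ℝ), (0 : ℝ)) = p := add_zero p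
  have h : IsBoundaryCurve P.Ωp P.Γ p (fun _ => 0) (fun _ => 0) univ :=
    hP.isBoundaryCurve_pos isOpen_univ contDiffOn_const contDiffOn_const
      fun t _ => by simpa [hz] using hp
  simpa [mem_closure_iff_nhdsWithin_neBot, hz] using h.neBot (mem_univ 0)

lemma Regular.subset_closure_neg (hP : P.Regular) : P.Γ ⊆ closure P.Ωm := by
  intro p hp
  have hz : p + ((0 : ℝ), (0 : ℝ)) = p := add_zero p
  have h : IsBoundaryCurve P.Ωm P.Γ p (fun _ => 0) (fun _ => 0) univ :=
    hP.isBoundaryCurve_neg isOpen_univ contDiffOn_const contDiffOn_const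
      fun t _ => by simpa [hz] using hp
  simpa [mem_closure_iff_nhdsWithin_neBot, hz] using h.neBot (mem_univ 0)

lemma Regular.isOpen_pos (hP : P.Regular) : IsOpen P.Ωp :=
  hP.smooth_ψ.continuousOn.isOpen_inter_preimage P.isOpen_Ω isOpen_Ioi

lemma Regular.isOpen_neg (hP : P.Regular) : IsOpen P.Ωm :=
  hP.smooth_ψ.continuousOn.isOpen_inter_preimage P.isOpen_Ω isOpen_Iio

lemma Γ_subset (P : InterfaceProblem) : P.Γ ⊆ P.Ω := fun _ h => h.1

lemma Ωp_subset (P : InterfaceProblem) : P.Ωp ⊆ P.Ω := fun _ h => h.1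

lemma IsSolution.smoothUpToOrder_pos {k : ℕ} (hu : P.IsSolution k u) (hP : P.Regular) :
    SmoothUpToOrder k P.Ωp P.Γ u := hu.smooth_pos.smoothUpToOrder hP.subset_closure_pos

lemma IsSolution.smoothUpToOrder_neg {k : ℕ} (hu : P.IsSolution k u) (hP : P.Regular) :
    SmoothUpToOrder k P.Ωm P.Γ u := hu.smooth_neg.smoothUpToOrder hP.subset_closure_neg

lemma IsSolution.ell_pos {K : ℕ} (hu : P.IsSolution (K + 2) u) (hP : P.Regular) (hb : b ∈ P.Γ)
    {m n : ℕ} (hmn : m + n ≤ K) :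
    ell (sideDeriv P.Ωp P.a b) (sideDeriv P.Ωp u b) m n = - sideDeriv P.Ωp P.f b m n := by
  have := mem_closure_iff_nhdsWithin_neBot.mp (hP.subset_closure_pos hb)
  exact ell_sideDeriv hP.isOpen_pos (hP.smooth_a_pos.smoothUpToOrder _)
    (hu.smoothUpToOrder_pos hP) (fun p hp => hu.pde p ⟨hp.1, fun h => hp.2.ne' h.2⟩) hb hmn

lemma IsSolution.ell_neg {K : ℕ} (hu : P.IsSolution (K + 2) u) (hP : P.Regular) (hb : b ∈ P.Γ)
    {m n : ℕ} (hmn : m + n ≤ K) :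
    ell (sideDeriv P.Ωm P.a b) (sideDeriv P.Ωm u b) m n = - sideDeriv P.Ωm P.f b m n := by
  have := mem_closure_iff_nhdsWithin_neBot.mp (hP.subset_closure_neg hb)
  exact ell_sideDeriv hP.isOpen_neg (hP.smooth_a_neg.smoothUpToOrder _)
    (hu.smoothUpToOrder_neg hP) (fun p hp => hu.pde p ⟨hp.1, fun h => hp.2.ne h.2⟩) hb hmn

/-- The trace of a function that is smooth across the interface. -/
lemma IsParamOn.trace_of_contDiffOn (h : P.IsParamOn b r s I) (hP : P.Regular) {g : ℝ × ℝ → ℝ}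
    (hg : ContDiffOn ℝ ∞ g P.Ω) {t : ℝ} (ht : t ∈ I) :
    trace P.Ωp g b r s t = g (b + (r t, s t)) := by
  have := (h.pos hP).neBot ht
  exact SmoothUpToOrder.sideDeriv_of_contDiffOn P.isOpen_Ω hg P.Ωp_subset (h.mem t ht).1 0 0

lemma IsParamOn.iteratedDeriv_comp (h : P.IsParamOn b r s I) (hP : P.Regular) {g : ℝ × ℝ → ℝ}
    (hg : ContDiffOn ℝ ∞ g P.Ω) (k : ℕ) :
    iteratedDeriv k (trace P.Ωp g b r s) 0 =
      tr (fun i => iteratedDeriv i r 0) (fun i => iteratedDeriv i s 0) k (pdArray g b) := by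
  have hne := (h.pos hP).neBot h.zero_mem
  rw [(h.pos hP).iteratedDeriv_trace (SmoothUpToOrder.of_contDiffOn P.isOpen_Ω hg P.Ωp_subset
    P.Γ_subset k) h.zero_mem le_rfl]
  rw [h.base] at hne ⊢
  congr 1
  funext m n
  exact SmoothUpToOrder.sideDeriv_of_contDiffOn P.isOpen_Ω hg P.Ωp_subset
    (by simpa [h.base] using (h.mem 0 h.zero_mem).1) m n

lemma IsSolution.trace_jump {k : ℕ} (hu : P.IsSolution k u) (hP : P.Regular)
    (h : P.IsParamOn b r s I) {t : ℝ} (ht : t ∈ I) :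
    trace P.Ωp u b r s t - trace P.Ωm u b r s t = P.g₁ (b + (r t, s t)) := by
  obtain ⟨lp, lm, h1, h2, h3⟩ := hu.jump _ (h.mem t ht)
  have := (h.pos hP).neBot ht
  have := (h.neg hP).neBot ht
  rw [tendsto_nhds_unique ((h.pos hP).trace_tendsto (hu.smoothUpToOrder_pos hP) ht) h1,
    tendsto_nhds_unique ((h.neg hP).trace_tendsto (hu.smoothUpToOrder_neg hP) ht) h2, h3]

/-- The relation `[u] = g₁` holds along a whole piece of the curve and may therefore be
differentiated in the parameter. -/
lemma IsSolution.tr_jump {K : ℕ} (hu : P.IsSolution K u) (hP : P.Regular)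
    (h : P.IsParamOn b r s I) {k : ℕ} (hk : k ≤ K) :
    tr (fun i => iteratedDeriv i r 0) (fun i => iteratedDeriv i s 0) k (sideDeriv P.Ωm u b) =
      tr (fun i => iteratedDeriv i r 0) (fun i => iteratedDeriv i s 0) k (sideDeriv P.Ωp u b) -
      tr (fun i => iteratedDeriv i r 0) (fun i => iteratedDeriv i s 0) k (pdArray P.g₁ b) := by
  have hI := h.isOpen.mem_nhds h.zero_mem
  have hup := hu.smoothUpToOrder_pos hP
  have hg := SmoothUpToOrder.of_contDiffOn (S := P.Γ) P.isOpen_Ω hP.smooth_g₁ P.Ωp_subset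
    P.Γ_subset k
  have e1 := (h.neg hP).iteratedDeriv_trace (hu.smoothUpToOrder_neg hP) h.zero_mem hk
  have e2 := (h.pos hP).iteratedDeriv_trace hup h.zero_mem hk
  rw [h.base] at e1 e2
  have hev : trace P.Ωm u b r s =ᶠ[𝓝 0] trace P.Ωp u b r s - trace P.Ωp P.g₁ b r s := by
    filter_upwards [hI] with t ht
    rw [Pi.sub_apply, h.trace_of_contDiffOn hP hP.smooth_g₁ ht, ← hu.trace_jump hP h ht]
    ring
  rw [← e1, ← e2, ← h.iteratedDeriv_comp hP hP.smooth_g₁, hev.iteratedDeriv_eq, iteratedDeriv_sub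
    (((h.pos hP).contDiffOn_trace (hup.mono hk)).contDiffAt hI)
    (((h.pos hP).contDiffOn_trace hg).contDiffAt hI)]

/-- The conormal derivative at a point of the interface, in terms of traces. -/
lemma tendsto_flux {R S : Set (ℝ × ℝ)} {K : ℕ} {a : ℝ × ℝ → ℝ}
    (h : IsBoundaryCurve R S b r s I) (ha : SmoothUpToOrder K R S a)
    (hu : SmoothUpToOrder (K + 1) R S u) {t : ℝ} (ht : t ∈ I) (n : ℝ × ℝ) :
    Tendsto (fun q => a q * (dX u q * n.1 + dY u q * n.2)) (𝓝[R] (b + (r t, s t)))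
      (𝓝 (trace R (fun q => a q * dX u q) b r s t * n.1
        + trace R (fun q => a q * dY u q) b r s t * n.2)) := by
  have hR := h.isOpen_region
  refine (((h.trace_tendsto (ha.mul hR (hu.dX hR)) ht).mul_const n.1).add
    ((h.trace_tendsto (ha.mul hR (hu.dY hR)) ht).mul_const n.2)).congr fun q => ?_
  ring

/-- Multiplying the flux condition by the speed clears the square root from the normal and leaves
the bilinear expression `a u_x s' - a u_y r'`. -/
lemma IsSolution.eventually_fluxTrace_jump {K : ℕ} (hu : P.IsSolution (K + 1) u)
    (hP : P.Regular) (h : P.IsParamOn b r s I) :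
    (fluxTrace P.Ωm P.a u b r s =ᶠ[𝓝 0] fun t => fluxTrace P.Ωp P.a u b r s t
      - P.orientation b r s * (P.g₂ (b + (r t, s t)) * speed r s t)) := by
  filter_upwards [hP.eventually_normal_eq (h.pos hP) h.zero_mem h.r_zero h.s_zero h.reg]
    with t ht
  obtain ⟨ht, hn, hσ⟩ := ht
  obtain ⟨lp, lm, h1, h2, h3⟩ := hu.jump_flux _ (h.mem t ht)
  have := (h.pos hP).neBot ht
  have := (h.neg hP).neBot ht
  have e1 := tendsto_nhds_unique (tendsto_flux (h.pos hP) (hP.smooth_a_pos.smoothUpToOrder K)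
    (hu.smoothUpToOrder_pos hP) ht _) h1
  have e2 := tendsto_nhds_unique (tendsto_flux (h.neg hP) (hP.smooth_a_neg.smoothUpToOrder K)
    (hu.smoothUpToOrder_neg hP) ht _) h2
  have hN : 0 < speed r s t := Real.sqrt_pos.mpr (h.reg t ht)
  rw [hn] at e1 e2
  rw [← h3, ← e1, ← e2]
  simp only [fluxTrace, Pi.sub_apply, Pi.mul_apply]
  change _ = _ - _ * (((_ * (_ / speed r s t) + _ * (_ / speed r s t))
    - (_ * (_ / speed r s t) + _ * (_ / speed r s t))) * speed r s t)
  field_simp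
  generalize trace P.Ωp (fun q => P.a q * dX u q) b r s t = X
  generalize trace P.Ωp (fun q => P.a q * dY u q) b r s t = Y
  generalize trace P.Ωm (fun q => P.a q * dX u q) b r s t = X'
  generalize trace P.Ωm (fun q => P.a q * dY u q) b r s t = Y'
  -- The sign `σ` occurs once in the normal and once in front of `g₂`, and `σ² = 1`.
  linear_combination (X * deriv s t - Y * deriv r t - X' * deriv s t + Y' * deriv r t) * hσ

lemma IsParamOn.iteratedDeriv_mul_speed (h : P.IsParamOn b r s I) (hP : P.Regular)
    {g : ℝ × ℝ → ℝ} (hg : ContDiffOn ℝ ∞ g P.Ω) (k : ℕ) :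
    iteratedDeriv k (trace P.Ωp g b r s * speed r s) 0 =
      gr (fun i => iteratedDeriv i r 0) (fun i => iteratedDeriv i s 0)
        (fun i => iteratedDeriv i (speed r s) 0) k (pdArray g b) := by
  have hI := h.isOpen.mem_nhds h.zero_mem
  have hg' := SmoothUpToOrder.of_contDiffOn (S := P.Γ) P.isOpen_Ω hg P.Ωp_subset P.Γ_subset k
  rw [iteratedDeriv_mul (((h.pos hP).contDiffOn_trace hg').contDiffAt hI)
    ((contDiffAt_speed (h.smooth_r.contDiffAt hI) (h.smooth_s.contDiffAt hI)
      (h.reg 0 h.zero_mem)).of_le (by exact_mod_cast le_top)), gr_apply]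
  refine Finset.sum_congr rfl fun j _ => ?_
  rw [h.iteratedDeriv_comp hP hg]
  ring

lemma IsSolution.fl_jump {K : ℕ} (hu : P.IsSolution (K + 1) u) (hP : P.Regular)
    (h : P.IsParamOn b r s I) {k : ℕ} (hk : k ≤ K) :
    fl (fun i => iteratedDeriv i r 0) (fun i => iteratedDeriv i s 0) (sideDeriv P.Ωm P.a b) k
        (sideDeriv P.Ωm u b) =
      fl (fun i => iteratedDeriv i r 0) (fun i => iteratedDeriv i s 0) (sideDeriv P.Ωp P.a b) k
        (sideDeriv P.Ωp u b) -
      P.orientation b r s * gr (fun i => iteratedDeriv i r 0) (fun i => iteratedDeriv i s 0)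
        (fun i => iteratedDeriv i (speed r s) 0) k (pdArray P.g₂ b) := by
  have hI := h.isOpen.mem_nhds h.zero_mem
  have hle : (k : WithTop ℕ∞) ≤ ∞ := by exact_mod_cast le_top
  have hap := hP.smooth_a_pos.smoothUpToOrder K
  have hup := hu.smoothUpToOrder_pos hP
  have hg := SmoothUpToOrder.of_contDiffOn (S := P.Γ) P.isOpen_Ω hP.smooth_g₂ P.Ωp_subset
    P.Γ_subset k
  have e1 := (h.neg hP).iteratedDeriv_fluxTrace (hP.smooth_a_neg.smoothUpToOrder K)
    (hu.smoothUpToOrder_neg hP) h.zero_mem hk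
  have e2 := (h.pos hP).iteratedDeriv_fluxTrace hap hup h.zero_mem hk
  rw [h.base] at e1 e2
  have hev : fluxTrace P.Ωm P.a u b r s =ᶠ[𝓝 0] fluxTrace P.Ωp P.a u b r s
      - fun t => P.orientation b r s * (trace P.Ωp P.g₂ b r s * speed r s) t := by
    filter_upwards [hI, hu.eventually_fluxTrace_jump hP h] with t ht h2
    rw [h2, Pi.sub_apply, Pi.mul_apply, h.trace_of_contDiffOn hP hP.smooth_g₂ ht]
  have hsm : ContDiffAt ℝ k (trace P.Ωp P.g₂ b r s * speed r s) 0 :=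
    (((h.pos hP).contDiffOn_trace hg).contDiffAt hI).mul
      ((contDiffAt_speed (h.smooth_r.contDiffAt hI) (h.smooth_s.contDiffAt hI)
        (h.reg 0 h.zero_mem)).of_le hle)
  rw [← e1, ← e2, ← h.iteratedDeriv_mul_speed hP hP.smooth_g₂, hev.iteratedDeriv_eq,
    iteratedDeriv_sub (((h.pos hP).contDiffOn_fluxTrace (hap.mono hk)
      (hup.mono (Nat.succ_le_succ hk))).contDiffAt hI) (contDiffAt_const.mul hsm),
    iteratedDeriv_const_mul_field]

end InterfaceProblem

/-! ### The data of the transmission identities -/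

/-- Values for the data in the transmission identities: `u_+`, `f_+`, `f_-`, `g₁`, and the product
of the orientation with `g₂`. -/
abbrev TransmissionData (M : ℕ) : Type :=
  (Lam1 (M + 1) → ℝ) × (Lam (M - 1) → ℝ) × (Lam (M - 1) → ℝ) × (Lam (M + 1) → ℝ) × (Lam M → ℝ)

/-- The data of a solution of an interface problem at a point. -/
def InterfaceProblem.data (P : InterfaceProblem) (M : ℕ) (u : ℝ × ℝ → ℝ) (b : ℝ × ℝ)
    (r s : ℝ → ℝ) : TransmissionData M :=
  (res _ (sideDeriv P.Ωp u b), res _ (sideDeriv P.Ωp P.f b), res _ (sideDeriv P.Ωm P.f b),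
    res _ (pdArray P.g₁ b), P.orientation b r s • res _ (pdArray P.g₂ b))

/-- The values of `u_-` given by transmission coefficients. -/
def Transmission.eval {M : ℕ} (T : Transmission M) (d : TransmissionData M) (j : Lam1 (M + 1)) :
    ℝ :=
  ∑ i : Lam1 (M + 1), T.Tu j i * d.1 i
    + ∑ i : Lam (M - 1), (T.Tp j i * d.2.1 i + T.Tm j i * d.2.2.1 i)
    + ∑ i : Lam (M + 1), T.Tg₁ j i * d.2.2.2.1 i
    + ∑ i : Lam M, T.Tg₂ j i * d.2.2.2.2 i

lemma Transmission.holds_iff {M : ℕ} (T : Transmission M) (P : InterfaceProblem)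
    (u : ℝ × ℝ → ℝ) (b : ℝ × ℝ) (r s : ℝ → ℝ) :
    T.Holds P u b r s ↔ res (Lam1 (M + 1)) (sideDeriv P.Ωm u b) = T.eval (P.data M u b r s) := by
  rw [funext_iff]
  refine forall_congr' fun j => ?_
  rw [res_apply, Transmission.eval, Finset.mul_sum]
  simp only [InterfaceProblem.data, res_apply, Pi.smul_apply, smul_eq_mul, pdArray]
  rw [Finset.sum_congr rfl fun i _ => mul_left_comm (P.orientation b r s) (T.Tg₂ j i) _]

/-- Linear maps on the data are given by transmission coefficients. -/
lemma Transmission.exists_eval_eq {M : ℕ} (E : TransmissionData M →ₗ[ℝ] (Lam1 (M + 1) → ℝ)) :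
    ∃ T : Transmission M, ∀ d, T.eval d = E d := by
  refine ⟨⟨LinearMap.toMatrix' (E ∘ₗ LinearMap.inl ℝ _ _),
    LinearMap.toMatrix' (E ∘ₗ LinearMap.inr ℝ _ _ ∘ₗ LinearMap.inl ℝ _ _),
    LinearMap.toMatrix' (E ∘ₗ LinearMap.inr ℝ _ _ ∘ₗ LinearMap.inr ℝ _ _ ∘ₗ
      LinearMap.inl ℝ _ _),
    LinearMap.toMatrix' (E ∘ₗ LinearMap.inr ℝ _ _ ∘ₗ LinearMap.inr ℝ _ _ ∘ₗ
      LinearMap.inr ℝ _ _ ∘ₗ LinearMap.inl ℝ _ _),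
    LinearMap.toMatrix' (E ∘ₗ LinearMap.inr ℝ _ _ ∘ₗ LinearMap.inr ℝ _ _ ∘ₗ
      LinearMap.inr ℝ _ _ ∘ₗ LinearMap.inr ℝ _ _)⟩, fun d => ?_⟩
  obtain ⟨d1, d2, d3, d4, d5⟩ := d
  -- The map is split over the five components; each restriction has its own matrix.
  have hd : ((d1, d2, d3, d4, d5) : TransmissionData M) = (d1, 0) + (0, d2, 0) + (0, 0, d3, 0)
      + (0, 0, 0, d4, 0) + (0, 0, 0, 0, d5) := by simp
  have key : ∀ {ι : Type} [Fintype ι] [DecidableEq ι]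
      (F : (ι → ℝ) →ₗ[ℝ] (Lam1 (M + 1) → ℝ)) (x : ι → ℝ) (j : Lam1 (M + 1)),
      ∑ i, LinearMap.toMatrix' F j i * x i = F x j := fun F x j =>
    congrFun (LinearMap.toMatrix'_mulVec F x) j
  funext j
  rw [hd]
  simp only [map_add, Pi.add_apply, Transmission.eval, Finset.sum_add_distrib]
  simp only [← hd, key]
  simp only [LinearMap.comp_apply, LinearMap.inl_apply, LinearMap.inr_apply]
  ring

/-- Transmission coefficients are determined by the values that they give. -/
lemma Transmission.eval_injective {M : ℕ} {T T' : Transmission M}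
    (h : ∀ d, T.eval d = T'.eval d) : T = T' := by
  ext j i
  · simpa [Transmission.eval, Pi.single_apply] using congrFun (h (Pi.single i 1, 0)) j
  · simpa [Transmission.eval, Pi.single_apply] using congrFun (h (0, Pi.single i 1, 0)) j
  · simpa [Transmission.eval, Pi.single_apply] using congrFun (h (0, 0, Pi.single i 1, 0)) j
  · simpa [Transmission.eval, Pi.single_apply] using congrFun (h (0, 0, 0, Pi.single i 1, 0)) j
  · simpa [Transmission.eval, Pi.single_apply] using congrFun (h (0, 0, 0, 0, Pi.single i 1)) j

/-! ### The arrays of a solution as linear functions of the data -/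

namespace Jet.Admissible

variable {M : ℕ} {J : Jet M}

/-- The derivatives of `u` in `Ω⁺` as a linear function of the data. -/
def plus (hJ : J.Admissible) (hM : 1 ≤ M) : TransmissionData M →ₗ[ℝ] (Lam (M + 1) → ℝ) where
  -- The sign of `f_+` is reversed since `ell` is `∇ · (a ∇ u)`, which equals `-f`.
  toFun d := (leftEquiv hJ.apArray_pos.ne' hM).symm (d.1, -d.2.1)
  map_add' d d' := by
    rw [← map_add]
    congr 1
    simp only [Prod.fst_add, Prod.snd_add, neg_add, Prod.mk_add_mk]
  map_smul' k d := by
    rw [RingHom.id_apply, ← map_smul]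
    congr 1
    simp only [Prod.smul_fst, Prod.smul_snd, Prod.smul_mk, smul_neg]

/-- The derivatives of `u` in `Ω⁻` as a linear function of the data. -/
def minus (hJ : J.Admissible) (hM : 1 ≤ M) : TransmissionData M →ₗ[ℝ] (Lam (M + 1) → ℝ) where
  -- The Cauchy data of `u_-` are those of `u_+` minus the jumps; the orientation is already
  -- contained in the last component of the data.
  toFun d := (cauchyEquiv hJ.reg hJ.amArray_pos.ne' hM).symm (-d.2.2.1,
    fun k => tr J.rho J.sig k (ext _ (hJ.plus hM d)) - tr J.rho J.sig k (ext _ d.2.2.2.1),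
    fun k => fl J.rho J.sig J.apArray k (ext _ (hJ.plus hM d))
      - gr J.rho J.sig J.spd k (ext _ d.2.2.2.2))
  map_add' d d' := by
    rw [← map_add]
    congr 1
    simp only [Prod.snd_add, Prod.fst_add, Prod.mk_add_mk, map_add, Prod.mk.injEq, neg_add]
    refine ⟨trivial, ?_, ?_⟩ <;> funext k <;> simp only [Pi.add_apply] <;> ring
  map_smul' c d := by
    rw [RingHom.id_apply, ← map_smul]
    congr 1
    simp only [Prod.smul_fst, Prod.smul_snd, Prod.smul_mk, map_smul, Prod.mk.injEq, smul_neg]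
    refine ⟨trivial, ?_, ?_⟩ <;> funext k <;> simp only [Pi.smul_apply, smul_eq_mul] <;> ring

variable {P : InterfaceProblem} {u : ℝ × ℝ → ℝ} {b : ℝ × ℝ} {r s : ℝ → ℝ}

lemma rho_jet (P : InterfaceProblem) (M : ℕ) (b : ℝ × ℝ) (r s : ℝ → ℝ) {k : ℕ}
    (hk : k ≤ M + 1) : (P.jet M b r s).rho k = iteratedDeriv k r 0 := dif_pos (by omega)

lemma sig_jet (P : InterfaceProblem) (M : ℕ) (b : ℝ × ℝ) (r s : ℝ → ℝ) {k : ℕ}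
    (hk : k ≤ M + 1) : (P.jet M b r s).sig k = iteratedDeriv k s 0 := dif_pos (by omega)

lemma apArray_jet (P : InterfaceProblem) (M : ℕ) (b : ℝ × ℝ) (r s : ℝ → ℝ) {m n : ℕ}
    (hmn : m + n ≤ M) : (P.jet M b r s).apArray m n = sideDeriv P.Ωp P.a b m n :=
  ext_apply_mem _ (mem_Lam.mpr hmn)

lemma amArray_jet (P : InterfaceProblem) (M : ℕ) (b : ℝ × ℝ) (r s : ℝ → ℝ) {m n : ℕ}
    (hmn : m + n ≤ M) : (P.jet M b r s).amArray m n = sideDeriv P.Ωm P.a b m n :=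
  ext_apply_mem _ (mem_Lam.mpr hmn)

/-- `spd` is computed from one model curve, the Taylor polynomials; any curve with the same jet has
the same speed derivatives up to order `M`. -/
lemma spd_jet {I : Set ℝ} (h : P.IsParamOn b r s I) {k : ℕ} (hk : k ≤ M) :
    (P.jet M b r s).spd k = iteratedDeriv k (speed r s) 0 := by
  have hI := h.isOpen.mem_nhds h.zero_mem
  refine (iteratedDeriv_speed_congr (h.smooth_r.contDiffAt hI) (h.smooth_s.contDiffAt hI)
    (contDiff_taylorPoly _ _).contDiffAt (contDiff_taylorPoly _ _).contDiffAt (h.reg 0 h.zero_mem)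
    (fun i hi => ?_) (fun i hi => ?_) hk).symm
  · rw [iteratedDeriv_taylorPoly _ hi, rho_jet P M b r s hi]
  · rw [iteratedDeriv_taylorPoly _ hi, sig_jet P M b r s hi]

/-- The derivatives of a solution in `Ω⁺` are determined by the data. -/
lemma plus_data (hJ : (P.jet M b r s).Admissible) (hM : 1 ≤ M) (hP : P.Regular)
    (hu : P.IsSolution (M + 1) u) (hb : b ∈ P.Γ) :
    hJ.plus hM (P.data M u b r s) = res (Lam (M + 1)) (sideDeriv P.Ωp u b) := by
  -- It suffices that the true derivatives satisfy the system inverted in `plus`.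
  refine (LinearEquiv.symm_apply_eq _).mpr ?_
  rw [leftEquiv_apply, leftMap_apply]
  -- With `M = K + 1` the truncated `M - 1` becomes `K`, and the equation of order `K` involves `u`
  -- to order `K + 2 = M + 1`.
  obtain ⟨K, rfl⟩ : ∃ K, M = K + 1 := ⟨M - 1, by omega⟩
  refine Prod.ext ?_ ?_
  · funext ⟨i, hi⟩
    exact (ext_res_apply (sideDeriv P.Ωp u b) (mem_Lam.mpr (mem_Lam1.mp hi).1)).symm
  · funext ⟨i, hi⟩
    have hi' : i.1 + i.2 ≤ K := mem_Lam.mp hi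
    refine (hu.ell_pos hP hb hi').symm.trans (ell_congr (fun m n hmn => ?_) fun m n hmn => ?_)
    · exact (apArray_jet P _ b r s (by omega)).symm
    · exact (ext_res_apply _ (mem_Lam.mpr (by dsimp only; omega))).symm

/-- The derivatives of a solution in `Ω⁻` are determined by the data. -/
lemma minus_data (hJ : (P.jet M b r s).Admissible) (hM : 1 ≤ M) (hP : P.Regular)
    (hu : P.IsSolution (M + 1) u) (hb : b ∈ P.Γ) (hpar : P.IsParam b r s) :
    hJ.minus hM (P.data M u b r s) = res (Lam (M + 1)) (sideDeriv P.Ωm u b) := by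
  obtain ⟨I, h⟩ := hpar.exists_isParamOn
  refine (LinearEquiv.symm_apply_eq _).mpr ?_
  rw [cauchyEquiv_apply, cauchyMap_apply, plus_data hJ hM hP hu hb]
  have hext : ∀ (L : ℕ) (c : DerivArray) (i j : ℕ), i + j ≤ L →
      ext (Lam L) (res (Lam L) c) i j = c i j := fun L c i j hij =>
    ext_res_apply c (mem_Lam.mpr hij)
  refine Prod.ext ?_ (Prod.ext ?_ ?_)
  · obtain ⟨K, rfl⟩ : ∃ K, M = K + 1 := ⟨M - 1, by omega⟩
    funext ⟨i, hi⟩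
    have hi' : i.1 + i.2 ≤ K := mem_Lam.mp hi
    refine (hu.ell_neg hP hb hi').symm.trans (ell_congr (fun m n hmn => ?_) fun m n hmn => ?_)
    · exact (amArray_jet P _ b r s (by omega)).symm
    · exact (hext _ _ _ _ (by omega)).symm
  · funext ⟨k, hk⟩
    have hk' : k ≤ M + 1 := by omega
    -- The jet is continued by zero, but a trace derivative of order `k ≤ M + 1` sees no continued
    -- value.
    have key : ∀ c, tr (P.jet M b r s).rho (P.jet M b r s).sig k
        (ext (Lam (M + 1)) (res (Lam (M + 1)) c)) =
        tr (fun i => iteratedDeriv i r 0) (fun i => iteratedDeriv i s 0) k c := fun c =>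
      tr_congr (fun i hi => rho_jet P M b r s (hi.trans hk'))
        (fun i hi => sig_jet P M b r s (hi.trans hk'))
        fun i j hij => hext _ _ _ _ (hij.trans hk')
    dsimp only [InterfaceProblem.data]
    rw [key, key, key, hu.tr_jump hP h hk']
  · funext ⟨k, hk⟩
    have hk' : k ≤ M := by omega
    have hρ : ∀ i ≤ k + 1, (P.jet M b r s).rho i = iteratedDeriv i r 0 := fun i hi =>
      rho_jet P M b r s (by omega)
    have hς : ∀ i ≤ k + 1, (P.jet M b r s).sig i = iteratedDeriv i s 0 := fun i hi =>
      sig_jet P M b r s (by omega)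
    dsimp only [InterfaceProblem.data]
    rw [map_smul, map_smul, smul_eq_mul]
    rw [fl_congr hρ hς (fun i j hij => apArray_jet P M b r s (hij.trans hk'))
      (fun i j hij => hext _ (sideDeriv P.Ωp u b) _ _ (by omega)),
      fl_congr hρ hς (fun i j hij => amArray_jet P M b r s (hij.trans hk'))
      (fun i j hij => hext _ (sideDeriv P.Ωm u b) _ _ (by omega)),
      gr_congr (fun i hi => hρ i (by omega)) (fun i hi => hς i (by omega))
      (fun i hi => spd_jet h (hi.trans hk')) (fun i j hij => hext _ (pdArray P.g₂ b) _ _ (by omega)),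
      hu.fl_jump hP h hk']

/-- There are transmission coefficients. -/
lemma exists_holds (hJ : J.Admissible) (hM : 1 ≤ M) :
    ∃ T : Transmission M,
      ∀ (P : InterfaceProblem) (u : ℝ × ℝ → ℝ) (b : ℝ × ℝ) (r s : ℝ → ℝ),
        P.Regular → P.IsSolution (M + 1) u → b ∈ P.Γ → P.IsParam b r s →
        P.jet M b r s = J → T.Holds P u b r s := by
  obtain ⟨T, hT⟩ := Transmission.exists_eval_eq
    ((res (Lam1 (M + 1))).comp ((ext (Lam (M + 1))).comp (hJ.minus hM)))
  refine ⟨T, fun P u b r s hP hu hb hpar hjet => ?_⟩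
  subst hjet
  rw [Transmission.holds_iff, hT, LinearMap.comp_apply, LinearMap.comp_apply,
    minus_data hJ hM hP hu hb hpar]
  funext ⟨i, hi⟩
  exact (ext_res_apply (sideDeriv P.Ωm u b) (mem_Lam.mpr (mem_Lam1.mp hi).1)).symm

end Jet.Admissible

/-! ### Straightening of a curve -/

/-- The invertible linear map with the columns `(α, β)` and `(ς, -ρ)`. -/
def frameEquiv (α β ρ ς : ℝ) (h : α * ρ + β * ς ≠ 0) : (ℝ × ℝ) ≃L[ℝ] (ℝ × ℝ) :=
  ContinuousLinearEquiv.equivOfInverse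
    ((α • ContinuousLinearMap.fst ℝ ℝ ℝ + ς • ContinuousLinearMap.snd ℝ ℝ ℝ).prod
      (β • ContinuousLinearMap.fst ℝ ℝ ℝ - ρ • ContinuousLinearMap.snd ℝ ℝ ℝ))
    -- The determinant of the map is `-(α ρ + β ς)`, so this is the usual two-by-two inverse.
    ((α * ρ + β * ς)⁻¹ •
      (ρ • ContinuousLinearMap.fst ℝ ℝ ℝ + ς • ContinuousLinearMap.snd ℝ ℝ ℝ).prod
      (β • ContinuousLinearMap.fst ℝ ℝ ℝ - α • ContinuousLinearMap.snd ℝ ℝ ℝ))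
    (fun x => by
      ext
      · simp; field_simp; ring
      · simp; field_simp; ring)
    (fun x => by
      ext
      · simp; field_simp; ring
      · simp; field_simp; ring)

/-- Near `0`, a regular curve is the zero set of a function `ψ` which increases in direction of the
normal `(s', -r')`, and the parameter of the curve extends to a function `τ`. -/
lemma exists_straightening {r s : ℝ → ℝ} (hr : ContDiff ℝ ∞ r) (hs : ContDiff ℝ ∞ s)
    (hr0 : r 0 = 0) (hs0 : s 0 = 0) (hreg : 0 < deriv r 0 ^ 2 + deriv s 0 ^ 2) :
    ∃ (U : Set (ℝ × ℝ)) (τ ψ : ℝ × ℝ → ℝ), IsOpen U ∧ (0 : ℝ × ℝ) ∈ U ∧ ContDiffOn ℝ ∞ τ U ∧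
      ContDiffOn ℝ ∞ ψ U ∧ τ 0 = 0 ∧ (∀ q ∈ U, ψ q = 0 → q = (r (τ q), s (τ q))) ∧
      (∀ q ∈ U, 0 < deriv r (τ q) * deriv r 0 + deriv s (τ q) * deriv s 0) ∧
      (∀ q ∈ U, dX ψ q * deriv s 0 - dY ψ q * deriv r 0 = 1) ∧
      (∀ q ∈ U, dX ψ q * deriv r (τ q) + dY ψ q * deriv s (τ q) = 0) ∧
      ∀ᶠ t in 𝓝 0, ψ (r t, s t) = 0 := by
  set ρ := deriv r 0 with hρ
  set ς := deriv s 0 with hς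
  -- Points of the curve are shifted in the fixed direction `(ς, -ρ)`, the normal at `0`; `τ` and
  -- `ψ` are the two components of the local inverse of `Φ`.
  set Φ : ℝ × ℝ → ℝ × ℝ := fun x => (r x.1 + ς * x.2, s x.1 - ρ * x.2) with hΦ
  have hΦs : ContDiff ℝ ∞ Φ :=
    ((hr.comp contDiff_fst).add (contDiff_const.mul contDiff_snd)).prodMk
      ((hs.comp contDiff_fst).sub (contDiff_const.mul contDiff_snd))
  have hd : ∀ (x : ℝ × ℝ) (h : deriv r x.1 * ρ + deriv s x.1 * ς ≠ 0),
      HasFDerivAt Φ (frameEquiv (deriv r x.1) (deriv s x.1) ρ ς h : (ℝ × ℝ) →L[ℝ] (ℝ × ℝ)) x := by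
    intro x h
    have h1 : HasFDerivAt (fun x : ℝ × ℝ => r x.1)
        (deriv r x.1 • ContinuousLinearMap.fst ℝ ℝ ℝ) x :=
      ((hr.differentiable (by simp)) x.1).hasDerivAt.comp_hasFDerivAt x hasFDerivAt_fst
    have h2 : HasFDerivAt (fun x : ℝ × ℝ => s x.1)
        (deriv s x.1 • ContinuousLinearMap.fst ℝ ℝ ℝ) x :=
      ((hs.differentiable (by simp)) x.1).hasDerivAt.comp_hasFDerivAt x hasFDerivAt_fst
    exact (h1.add (hasFDerivAt_snd.const_mul ς)).prodMk (h2.sub (hasFDerivAt_snd.const_mul ρ))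
  have h0 : deriv r (0 : ℝ × ℝ).1 * ρ + deriv s (0 : ℝ × ℝ).1 * ς ≠ 0 := by
    rw [Prod.fst_zero, ← hρ, ← hς]
    intro h
    rw [← h] at hreg
    exact absurd hreg (by ring_nf; exact lt_irrefl _)
  let e := hΦs.contDiffAt.toOpenPartialHomeomorph Φ (hd 0 h0) (by simp)
  have he : ∀ x, e x = Φ x := fun _ => rfl
  have h0s : (0 : ℝ × ℝ) ∈ e.source :=
    hΦs.contDiffAt.mem_toOpenPartialHomeomorph_source (hd 0 h0) (by simp)
  have hΦ0 : Φ 0 = 0 := by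
    simp only [hΦ, Prod.fst_zero, Prod.snd_zero, hr0, hs0, mul_zero, add_zero, sub_zero]; rfl
  have h0t : (0 : ℝ × ℝ) ∈ e.target := by
    have := e.map_source h0s
    rwa [he, hΦ0] at this
  have hsymm0 : e.symm 0 = 0 := by
    have := e.left_inv h0s
    rwa [he, hΦ0] at this
  have hcr : Continuous (deriv r) := hr.continuous_deriv (by simp)
  have hcs : Continuous (deriv s) := hs.continuous_deriv (by simp)
  -- On `V` the derivative of `Φ` is invertible, which gives smoothness of the inverse on a
  -- neighbourhood and not only at `0`.
  set V : Set (ℝ × ℝ) := {x | 0 < deriv r x.1 * ρ + deriv s x.1 * ς} with hV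
  have hVo : IsOpen V := isOpen_lt continuous_const
    (((hcr.comp continuous_fst).mul continuous_const).add
      ((hcs.comp continuous_fst).mul continuous_const))
  have hUo : IsOpen (e.target ∩ e.symm ⁻¹' V) := e.isOpen_inter_preimage_symm hVo
  have hsm : ∀ q ∈ e.target ∩ e.symm ⁻¹' V, ContDiffAt ℝ ∞ e.symm q := fun q hq =>
    e.contDiffAt_symm hq.1 (hd (e.symm q) (ne_of_gt hq.2)) hΦs.contDiffAt
  have hψ : ContDiffOn ℝ ∞ (fun q => (e.symm q).2) (e.target ∩ e.symm ⁻¹' V) := fun q hq =>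
    (contDiff_snd.contDiffAt.comp q (hsm q hq)).contDiffWithinAt
  -- Differentiation of the identity `ψ ∘ Φ = snd`. The two basis vectors then give the derivatives
  -- of `ψ` along `(ς, -ρ)` and along the velocity.
  have key : ∀ q ∈ e.target ∩ e.symm ⁻¹' V, ∀ y : ℝ × ℝ,
      fderiv ℝ (fun q => (e.symm q).2) q
        (deriv r (e.symm q).1 * y.1 + ς * y.2, deriv s (e.symm q).1 * y.1 - ρ * y.2) = y.2 := by
    intro q hq y
    have hqs : e.symm q ∈ e.source := e.map_target hq.1
    have hqq : Φ (e.symm q) = q := e.right_inv hq.1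
    have h1 : HasFDerivAt (fun q => (e.symm q).2) (fderiv ℝ (fun q => (e.symm q).2) q)
        (Φ (e.symm q)) := by
      rw [hqq]
      exact ((hψ.contDiffAt (hUo.mem_nhds hq)).differentiableAt (by simp)).hasFDerivAt
    have h2 := h1.comp (e.symm q) (hd (e.symm q) (ne_of_gt hq.2))
    have h3 : HasFDerivAt ((fun q => (e.symm q).2) ∘ Φ) (ContinuousLinearMap.snd ℝ ℝ ℝ)
        (e.symm q) := by
      refine hasFDerivAt_snd.congr_of_eventuallyEq ?_
      filter_upwards [e.open_source.mem_nhds hqs] with x hx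
      change (e.symm (e x)).2 = x.2
      rw [e.left_inv hx]
    have h4 := DFunLike.congr_fun (h2.unique h3) y
    exact h4
  refine ⟨e.target ∩ e.symm ⁻¹' V, fun q => (e.symm q).1, fun q => (e.symm q).2, hUo,
    ⟨h0t, ?_⟩, fun q hq => (contDiff_fst.contDiffAt.comp q (hsm q hq)).contDiffWithinAt, hψ,
    ?_, ?_, fun q hq => hq.2, ?_, ?_, ?_⟩
  · rw [mem_preimage, hsymm0]
    refine lt_of_le_of_ne ?_ h0.symm
    rw [Prod.fst_zero, ← hρ, ← hς, ← sq, ← sq]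
    exact hreg.le
  · exact congrArg Prod.fst hsymm0
  · intro q hq hq0
    have hqq : Φ (e.symm q) = q := e.right_inv hq.1
    dsimp only at hq0
    conv_lhs => rw [← hqq]
    simp only [hΦ, hq0, mul_zero, add_zero, sub_zero]
  · intro q hq
    have h1 := key q hq (0, 1)
    rw [fderiv_eq_dX_dY] at h1
    linarith
  · intro q hq
    have h1 := key q hq (1, 0)
    rw [fderiv_eq_dX_dY] at h1
    simpa using h1
  · have hc : ContinuousAt (fun t : ℝ => (t, (0 : ℝ))) 0 := by fun_prop
    filter_upwards [hc.preimage_mem_nhds (e.open_source.mem_nhds h0s)] with t ht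
    have h1 := e.left_inv ht
    have h2 : e (t, 0) = (r t, s t) := by simp [he, hΦ]
    rw [h2] at h1
    rw [h1]

/-! ### Functions with given derivatives -/

lemma pd_fst_mul_snd {f g : ℝ → ℝ} (hf : ContDiff ℝ ∞ f) (hg : ContDiff ℝ ∞ g) (m n : ℕ) :
    (pd m n fun p => f p.1 * g p.2) = fun p => iteratedDeriv m f p.1 * iteratedDeriv n g p.2 := by
  have hdf : ∀ m, Differentiable ℝ (iteratedDeriv m f) := fun m =>
    hf.differentiable_iteratedDeriv m (by exact_mod_cast WithTop.coe_lt_top _)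
  have hdg : ∀ n, Differentiable ℝ (iteratedDeriv n g) := fun n =>
    hg.differentiable_iteratedDeriv n (by exact_mod_cast WithTop.coe_lt_top _)
  have key : ∀ m n (p : ℝ × ℝ),
      HasFDerivAt (fun p : ℝ × ℝ => iteratedDeriv m f p.1 * iteratedDeriv n g p.2)
        (iteratedDeriv m f p.1 •
            (deriv (iteratedDeriv n g) p.2 • ContinuousLinearMap.snd ℝ ℝ ℝ)
          + iteratedDeriv n g p.2 •
            (deriv (iteratedDeriv m f) p.1 • ContinuousLinearMap.fst ℝ ℝ ℝ)) p :=
    fun m n p => ((hdf m p.1).hasDerivAt.comp_hasFDerivAt p hasFDerivAt_fst).mul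
      ((hdg n p.2).hasDerivAt.comp_hasFDerivAt p hasFDerivAt_snd)
  induction m with
  | zero =>
    induction n with
    | zero => simp
    | succ n ih =>
      funext p
      rw [pd_zero_succ, ih, dY, (key 0 n p).fderiv, iteratedDeriv_succ]
      simp
  | succ m ih =>
    funext p
    rw [pd_succ_left, ih, dX, (key m n p).fderiv, iteratedDeriv_succ]
    simp; ring

lemma pd_sum {ι : Type*} (S : Finset ι) {v : ι → ℝ × ℝ → ℝ} (hv : ∀ i, ContDiff ℝ ∞ (v i))
    (m n : ℕ) (p : ℝ × ℝ) : pd m n (fun q => ∑ i ∈ S, v i q) p = ∑ i ∈ S, pd m n (v i) p := by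
  classical
  induction S using Finset.induction_on with
  | empty =>
    simp only [Finset.sum_empty]
    -- The empty sum is the product of two zero functions.
    have := congrFun (pd_fst_mul_snd (f := 0) (g := 0) contDiff_const contDiff_const m n) p
    simpa using this
  | insert i S hi ih =>
    simp only [Finset.sum_insert hi]
    have hle : ((m + n : ℕ) : WithTop ℕ∞) ≤ ∞ := by exact_mod_cast le_top
    rw [pd_add isOpen_univ ((hv i).of_le hle).contDiffOn
      ((ContDiff.sum fun i _ => hv i).of_le hle).contDiffOn le_rfl (mem_univ p), ← ih]

/-- The polynomial with the derivatives `c m n`, `m, n ≤ K`, at `0`. -/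
def taylorPoly₂ (c : DerivArray) (K : ℕ) (p : ℝ × ℝ) : ℝ :=
  ∑ i ∈ Finset.range (K + 1), p.1 ^ i / i.factorial * taylorPoly (c i) K p.2

lemma contDiff_taylorPoly₂ (c : DerivArray) (K : ℕ) : ContDiff ℝ ∞ (taylorPoly₂ c K) :=
  ContDiff.sum fun _ _ => ((contDiff_fst.pow _).div_const _).mul
    ((contDiff_taylorPoly _ _).comp contDiff_snd)

lemma pd_taylorPoly₂ (c : DerivArray) {K m n : ℕ} (h : m + n ≤ K) :
    pd m n (taylorPoly₂ c K) 0 = c m n := by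
  have hs : ∀ i : ℕ, ContDiff ℝ ∞ fun x : ℝ => x ^ i / i.factorial := fun i =>
    (contDiff_id.pow i).div_const _
  unfold taylorPoly₂
  rw [pd_sum (v := fun i p => p.1 ^ i / i.factorial * taylorPoly (c i) K p.2) _
    fun i => ((hs i).comp contDiff_fst).mul
    ((contDiff_taylorPoly (c i) K).comp contDiff_snd)]
  have e : ∀ i : ℕ, pd m n (fun p : ℝ × ℝ => p.1 ^ i / i.factorial * taylorPoly (c i) K p.2) 0 =
      (if m = i then 1 else 0) * c i n := by
    intro i
    rw [pd_fst_mul_snd (hs i) (contDiff_taylorPoly (c i) K)]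
    dsimp only
    rw [Prod.fst_zero, Prod.snd_zero, iteratedDeriv_taylorPoly _ (by omega),
      iteratedDeriv_div_const, iteratedDeriv_fun_pow_zero]
    split_ifs with hmi
    · simp [Nat.factorial_ne_zero]
    · simp
  change ∑ i ∈ Finset.range (K + 1), pd m n (fun p : ℝ × ℝ =>
    p.1 ^ i / i.factorial * taylorPoly (c i) K p.2) 0 = c m n
  rw [Finset.sum_congr rfl fun i _ => e i]
  simp only [ite_mul, one_mul, zero_mul, Finset.sum_ite_eq, Finset.mem_range]
  rw [if_pos (by omega)]

/-- The composition with a function whose derivatives vanish has vanishing derivatives. -/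
lemma pd_comp_mul_eq_zero {U : Set (ℝ × ℝ)} (hU : IsOpen U) {I : Set ℝ} (hI : IsOpen I)
    {τ w : ℝ × ℝ → ℝ} (hτ : ContDiffOn ℝ ∞ τ U) (hw : ContDiffOn ℝ ∞ w U) (hτI : MapsTo τ U I)
    {δ : ℝ → ℝ} (hδ : ContDiffOn ℝ ∞ δ I) {p : ℝ × ℝ} (hp : p ∈ U) {K : ℕ}
    (h0 : ∀ k ≤ K, iteratedDeriv k δ (τ p) = 0) {m n : ℕ} (hmn : m + n ≤ K) :
    pd m n (fun q => δ (τ q) * w q) p = 0 := by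
  -- The factor `w` closes the induction: a derivative of `δ(τ) w` is `δ'(τ) (τ_x w) + δ(τ) w_x`, or
  -- the same in `y`, and both `δ'` and `δ` vanish to one order less.
  induction K generalizing m n δ w with
  | zero =>
    obtain ⟨rfl, rfl⟩ : m = 0 ∧ n = 0 := by omega
    have := h0 0 le_rfl
    rw [iteratedDeriv_zero] at this
    simp [this]
  | succ K ih =>
    have hle : ∀ k : ℕ, (k : WithTop ℕ∞) ≤ ∞ := fun k => by exact_mod_cast le_top
    have hδ' := contDiffOn_deriv hI hδ
    have h0' : ∀ k ≤ K, iteratedDeriv k (deriv δ) (τ p) = 0 := fun k hk => by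
      rw [← iteratedDeriv_succ']
      exact h0 (k + 1) (by omega)
    have hτX : ContDiffOn ℝ ∞ (dX τ) U := contDiffOn_dX hU (by simp) hτ
    have hτY : ContDiffOn ℝ ∞ (dY τ) U := contDiffOn_dY hU (by simp) hτ
    have hwX : ContDiffOn ℝ ∞ (dX w) U := contDiffOn_dX hU (by simp) hw
    have hwY : ContDiffOn ℝ ∞ (dY w) U := contDiffOn_dY hU (by simp) hw
    have hc : ContDiffOn ℝ ∞ (fun q => δ (τ q)) U := hδ.comp hτ hτI
    have hc' : ContDiffOn ℝ ∞ (fun q => deriv δ (τ q)) U := hδ'.comp hτ hτI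
    have hdiff : ∀ {v : ℝ × ℝ → ℝ}, ContDiffOn ℝ ∞ v U → ∀ q ∈ U, DifferentiableAt ℝ v q :=
      fun hv q hq => (hv.contDiffAt (hU.mem_nhds hq)).differentiableAt (by simp)
    have hcomp : ∀ q ∈ U, HasFDerivAt (fun q => δ (τ q)) (deriv δ (τ q) • fderiv ℝ τ q) q :=
      fun q hq => (hasDerivAt_of_isOpen_of_contDiffOn hI hδ (hτI hq)).comp_hasFDerivAt q
        (hdiff hτ q hq).hasFDerivAt
    have eX : EqOn (dX fun q => δ (τ q) * w q)
        (fun q => deriv δ (τ q) * (dX τ q * w q) + δ (τ q) * dX w q) U := fun q hq => by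
      rw [dX_mul (hdiff hc q hq) (hdiff hw q hq)]
      rw [show dX (fun q => δ (τ q)) q = deriv δ (τ q) * dX τ q by
        rw [dX, (hcomp q hq).fderiv]; rfl]
      ring
    have eY : EqOn (dY fun q => δ (τ q) * w q)
        (fun q => deriv δ (τ q) * (dY τ q * w q) + δ (τ q) * dY w q) U := fun q hq => by
      rw [dY_mul (hdiff hc q hq) (hdiff hw q hq)]
      rw [show dY (fun q => δ (τ q)) q = deriv δ (τ q) * dY τ q by
        rw [dY, (hcomp q hq).fderiv]; rfl]
      ring
    have hK : ∀ k ≤ K, iteratedDeriv k δ (τ p) = 0 := fun k hk => h0 k (by omega)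
    rcases m with _ | m
    · rcases n with _ | n
      · exact ih hw hδ hK (Nat.zero_le _)
      · rw [← pd_dY, eqOn_pd hU eY 0 n hp,
          pd_add (K := 0 + n) hU ((hc'.mul (hτY.mul hw)).of_le (hle _))
            ((hc.mul hwY).of_le (hle _)) le_rfl hp]
        dsimp only
        rw [ih (hτY.mul hw) hδ' h0' (by omega), ih hwY hδ hK (by omega), add_zero]
    · rw [← pd_dX hU ((hc.mul hw).of_le (hle (m + n + 1))) le_rfl hp, eqOn_pd hU eX m n hp,
          pd_add (K := m + n) hU ((hc'.mul (hτX.mul hw)).of_le (hle _))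
            ((hc.mul hwX).of_le (hle _)) le_rfl hp]
      dsimp only
      rw [ih (hτX.mul hw) hδ' h0' (by omega), ih hwX hδ hK (by omega), add_zero]

lemma pd_comp_eq_zero {U : Set (ℝ × ℝ)} (hU : IsOpen U) {I : Set ℝ} (hI : IsOpen I)
    {τ : ℝ × ℝ → ℝ} (hτ : ContDiffOn ℝ ∞ τ U) (hτI : MapsTo τ U I) {δ : ℝ → ℝ}
    (hδ : ContDiffOn ℝ ∞ δ I) {p : ℝ × ℝ} (hp : p ∈ U) {K : ℕ}
    (h0 : ∀ k ≤ K, iteratedDeriv k δ (τ p) = 0) {m n : ℕ} (hmn : m + n ≤ K) :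
    pd m n (fun q => δ (τ q)) p = 0 := by
  simpa using pd_comp_mul_eq_zero hU hI hτ (w := fun _ => 1) contDiffOn_const hτI hδ hp h0 hmn

/-! ### Interface problems with prescribed solutions -/

/-- The source term of the equation with coefficient `a` and solution `u`. -/
def source (a u : ℝ × ℝ → ℝ) (p : ℝ × ℝ) : ℝ :=
  -(dX (fun q => a q * dX u q) p + dY (fun q => a q * dY u q) p)

lemma contDiff_dX {v : ℝ × ℝ → ℝ} (hv : ContDiff ℝ ∞ v) : ContDiff ℝ ∞ (dX v) :=
  contDiffOn_univ.mp (contDiffOn_dX isOpen_univ (by simp) hv.contDiffOn)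

lemma contDiff_dY {v : ℝ × ℝ → ℝ} (hv : ContDiff ℝ ∞ v) : ContDiff ℝ ∞ (dY v) :=
  contDiffOn_univ.mp (contDiffOn_dY isOpen_univ (by simp) hv.contDiffOn)

lemma contDiff_pd {v : ℝ × ℝ → ℝ} (hv : ContDiff ℝ ∞ v) (m n : ℕ) : ContDiff ℝ ∞ (pd m n v) := by
  induction m with
  | zero =>
    induction n with
    | zero => exact hv
    | succ n ih => rw [pd_zero_succ]; exact contDiff_dY ih
  | succ m ih => rw [pd_succ_left]; exact contDiff_dX ih

lemma hasCompactSupport_pd {v : ℝ × ℝ → ℝ} (hv : HasCompactSupport v) (m n : ℕ) :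
    HasCompactSupport (pd m n v) := by
  induction m with
  | zero =>
    induction n with
    | zero => exact hv
    | succ n ih => rw [pd_zero_succ]; exact ih.fderiv_apply ℝ _
  | succ m ih => rw [pd_succ_left]; exact ih.fderiv_apply ℝ _

lemma contDiff_source {a u : ℝ × ℝ → ℝ} (ha : ContDiff ℝ ∞ a) (hu : ContDiff ℝ ∞ u) :
    ContDiff ℝ ∞ (source a u) :=
  ((contDiff_dX (ha.mul (contDiff_dX hu))).add (contDiff_dY (ha.mul (contDiff_dY hu)))).neg

lemma source_congr {R : Set (ℝ × ℝ)} (hR : IsOpen R) {a a' u u' : ℝ × ℝ → ℝ} (ha : EqOn a a' R)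
    (hu : EqOn u u' R) : EqOn (source a u) (source a' u') R := fun p hp => by
  have h1 : EqOn (fun q => a q * dX u q) (fun q => a' q * dX u' q) R := fun q hq => by
    dsimp only
    rw [ha hq, eqOn_dX hR hu hq]
  have h2 : EqOn (fun q => a q * dY u q) (fun q => a' q * dY u' q) R := fun q hq => by
    dsimp only
    rw [ha hq, eqOn_dY hR hu hq]
  rw [source, source, eqOn_dX hR h1 hp, eqOn_dY hR h2 hp]

lemma smoothUpTo_of_eqOn {R S : Set (ℝ × ℝ)} (hR : IsOpen R) {v w : ℝ × ℝ → ℝ}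
    (hw : ContDiff ℝ ∞ w) (h : EqOn v w R) : SmoothUpTo R S v :=
  ⟨hw.contDiffOn.congr h, fun m n p hp =>
    ((SmoothUpToOrder.of_contDiffOn isOpen_univ hw.contDiffOn (subset_univ R) (subset_univ S)
      (m + n)).congr hR h.symm).2 m n le_rfl p hp⟩

/-- Compact support makes every derivative uniformly continuous on the plane; this is one reason to
cut off the polynomials. -/
lemma uniformlySmooth_of_eqOn {R : Set (ℝ × ℝ)} (hR : IsOpen R) {v w : ℝ × ℝ → ℝ}
    (hw : ContDiff ℝ ∞ w) (hc : HasCompactSupport w) (h : EqOn v w R) (k : ℕ) :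
    UniformlySmooth k R v :=
  ⟨(hw.contDiffOn.of_le (by exact_mod_cast le_top)).congr h, fun m n _ =>
    ((hasCompactSupport_pd hc m n).uniformContinuous_of_continuous
      (contDiff_pd hw m n).continuous).uniformContinuousOn.congr (eqOn_pd hR h m n).symm⟩

lemma tendsto_of_eqOn {R : Set (ℝ × ℝ)} {v w : ℝ × ℝ → ℝ} (hw : Continuous w) (h : EqOn v w R)
    (p : ℝ × ℝ) : Tendsto v (𝓝[R] p) (𝓝 (w p)) :=
  (hw.continuousAt.tendsto.mono_left nhdsWithin_le_nhds).congr'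
    (h.symm.eventuallyEq_of_mem self_mem_nhdsWithin)

lemma sideDeriv_of_eqOn {R : Set (ℝ × ℝ)} (hR : IsOpen R) {v w : ℝ × ℝ → ℝ}
    (hw : ContDiff ℝ ∞ w) (h : EqOn v w R) {p : ℝ × ℝ} (hp : p ∈ closure R) (m n : ℕ) :
    sideDeriv R v p m n = pd m n w p := by
  have := mem_closure_iff_nhdsWithin_neBot.mp hp
  exact (tendsto_of_eqOn (contDiff_pd hw m n).continuous (eqOn_pd hR h m n) p).limUnder_eq

/-- The function that is `v` where `ψ` is positive and `w` elsewhere. -/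
def glue (ψ v w : ℝ × ℝ → ℝ) (q : ℝ × ℝ) : ℝ := if 0 < ψ q then v q else w q

lemma eqOn_glue_pos {ψ : ℝ × ℝ → ℝ} (v w : ℝ × ℝ → ℝ) {R : Set (ℝ × ℝ)}
    (hR : ∀ q ∈ R, 0 < ψ q) : EqOn (glue ψ v w) v R := fun q hq => if_pos (hR q hq)

lemma eqOn_glue_neg {ψ : ℝ × ℝ → ℝ} (v w : ℝ × ℝ → ℝ) {R : Set (ℝ × ℝ)}
    (hR : ∀ q ∈ R, ψ q < 0) : EqOn (glue ψ v w) w R := fun q hq => if_neg (hR q hq).not_gt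

/-- The interface problem in the square of centre `0` and radius `η` with the coefficients `ap`,
`am`, the solutions `up`, `um` in the two regions and vanishing boundary data. -/
def gluedProblem (η : ℝ) (ψ ap am up um g₁ g₂ : ℝ × ℝ → ℝ) : InterfaceProblem where
  l₁ := -η
  l₂ := η
  l₃ := -η
  l₄ := η
  ψ := ψ
  a := glue ψ ap am
  f := glue ψ (source ap up) (source am um)
  g₁ := g₁
  g₂ := g₂
  g := 0

section Glued

variable {η : ℝ} {ψ ap am up um g₁ g₂ : ℝ × ℝ → ℝ}

lemma gluedProblem_Ω : (gluedProblem η ψ ap am up um g₁ g₂).Ω = Metric.ball 0 η := by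
  change Ioo (-η) η ×ˢ Ioo (-η) η = _
  rw [show (0 : ℝ × ℝ) = (0, 0) from rfl, ← ball_prod_same, Real.ball_eq_Ioo, zero_sub, zero_add]

lemma gluedProblem_regular (hψ : ContDiffOn ℝ ∞ ψ (Metric.ball 0 η))
    (hgrad : ∀ q ∈ Metric.ball 0 η, (dX ψ q, dY ψ q) ≠ (0, 0)) (hap : ContDiff ℝ ∞ ap)
    (ham : ContDiff ℝ ∞ am) (hap0 : ∀ q ∈ Metric.ball 0 η, 0 < ap q)
    (ham0 : ∀ q ∈ Metric.ball 0 η, 0 < am q) (hup : ContDiff ℝ ∞ up) (hum : ContDiff ℝ ∞ um)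
    (hg₁ : ContDiffOn ℝ ∞ g₁ (Metric.ball 0 η)) (hg₂ : ContDiffOn ℝ ∞ g₂ (Metric.ball 0 η)) :
    (gluedProblem η ψ ap am up um g₁ g₂).Regular := by
  have hΩ := gluedProblem_Ω (η := η) (ψ := ψ) (ap := ap) (am := am) (up := up) (um := um)
    (g₁ := g₁) (g₂ := g₂)
  set P := gluedProblem η ψ ap am up um g₁ g₂ with hP
  have hψ' : ContDiffOn ℝ ∞ P.ψ P.Ω := by rw [hΩ]; exact hψ
  have hop : IsOpen P.Ωp := hψ'.continuousOn.isOpen_inter_preimage P.isOpen_Ω isOpen_Ioi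
  have hom : IsOpen P.Ωm := hψ'.continuousOn.isOpen_inter_preimage P.isOpen_Ω isOpen_Iio
  exact
    { smooth_ψ := hψ'
      grad_ψ := fun p hp => hgrad p (hΩ ▸ hp.1)
      smooth_a_pos := smoothUpTo_of_eqOn hop hap (eqOn_glue_pos _ _ fun q hq => hq.2)
      smooth_a_neg := smoothUpTo_of_eqOn hom ham (eqOn_glue_neg _ _ fun q hq => hq.2)
      pos_a := by
        rintro p (hp | hp)
        · rw [show P.a p = ap p from if_pos hp.2]
          exact hap0 p (hΩ ▸ hp.1)
        · rw [show P.a p = am p from if_neg (not_lt.mpr hp.2.le)]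
          exact ham0 p (hΩ ▸ hp.1)
      smooth_f_pos := smoothUpTo_of_eqOn hop (contDiff_source hap hup)
        (eqOn_glue_pos _ _ fun q hq => hq.2)
      smooth_f_neg := smoothUpTo_of_eqOn hom (contDiff_source ham hum)
        (eqOn_glue_neg _ _ fun q hq => hq.2)
      smooth_g₁ := by rw [hΩ]; exact hg₁
      smooth_g₂ := by rw [hΩ]; exact hg₂
      smooth_g := contDiff_const }

/-- The equation holds by choice of the source, so only the jumps remain as hypotheses. The normal
enters through a variable `n`, so that a computed expression can be substituted for it. -/
lemma gluedProblem_isSolution (hR : (gluedProblem η ψ ap am up um g₁ g₂).Regular)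
    (hap : ContDiff ℝ ∞ ap) (ham : ContDiff ℝ ∞ am) (hup : ContDiff ℝ ∞ up)
    (hum : ContDiff ℝ ∞ um) (hupc : HasCompactSupport up) (humc : HasCompactSupport um)
    (hups : tsupport up ⊆ Metric.ball 0 η) (hums : tsupport um ⊆ Metric.ball 0 η)
    (hj : ∀ p ∈ (gluedProblem η ψ ap am up um g₁ g₂).Γ, up p - um p = g₁ p)
    (hjf : ∀ p ∈ (gluedProblem η ψ ap am up um g₁ g₂).Γ, ∀ n,
      (gluedProblem η ψ ap am up um g₁ g₂).normal p = n →
        ap p * (dX up p * n.1 + dY up p * n.2) - am p * (dX um p * n.1 + dY um p * n.2) = g₂ p)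
    (k : ℕ) : (gluedProblem η ψ ap am up um g₁ g₂).IsSolution k (glue ψ up um) := by
  have hΩ := gluedProblem_Ω (η := η) (ψ := ψ) (ap := ap) (am := am) (up := up) (um := um)
    (g₁ := g₁) (g₂ := g₂)
  set P := gluedProblem η ψ ap am up um g₁ g₂ with hP
  have hop := hR.isOpen_pos
  have hom := hR.isOpen_neg
  have ep : ∀ v w : ℝ × ℝ → ℝ, EqOn (glue ψ v w) v P.Ωp := fun v w =>
    eqOn_glue_pos _ _ fun q hq => hq.2
  have em : ∀ v w : ℝ × ℝ → ℝ, EqOn (glue ψ v w) w P.Ωm := fun v w =>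
    eqOn_glue_neg _ _ fun q hq => hq.2
  refine
    { smooth_pos := uniformlySmooth_of_eqOn hop hup hupc (ep _ _) k
      smooth_neg := uniformlySmooth_of_eqOn hom hum humc (em _ _) k
      pde := ?_
      jump := fun p hp => ⟨_, _, tendsto_of_eqOn hup.continuous (ep _ _) p,
        tendsto_of_eqOn hum.continuous (em _ _) p, hj p hp⟩
      jump_flux := ?_
      boundary := ?_ }
  · rintro p ⟨hp, hpΓ⟩
    change source (glue ψ ap am) (glue ψ up um) p = glue ψ (source ap up) (source am um) p
    rcases lt_trichotomy (ψ p) 0 with h | h | h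
    · rw [source_congr hom (em _ _) (em _ _) ⟨hp, h⟩, em _ _ ⟨hp, h⟩]
    · exact absurd ⟨hp, h⟩ hpΓ
    · rw [source_congr hop (ep _ _) (ep _ _) ⟨hp, h⟩, ep _ _ ⟨hp, h⟩]
  · intro p hp
    have hc : ∀ {a u : ℝ × ℝ → ℝ}, ContDiff ℝ ∞ a → ContDiff ℝ ∞ u → ∀ n : ℝ × ℝ,
        Continuous fun q => a q * (dX u q * n.1 + dY u q * n.2) := fun ha hu n =>
      ha.continuous.mul (((contDiff_dX hu).continuous.mul continuous_const).add
        ((contDiff_dY hu).continuous.mul continuous_const))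
    refine ⟨_, _, tendsto_of_eqOn (hc hap hup (P.normal p)) (fun q hq => ?_) p,
      tendsto_of_eqOn (hc ham hum (P.normal p)) (fun q hq => ?_) p, hjf p hp _ rfl⟩
    · dsimp only
      rw [eqOn_dX hop (ep up um) hq, eqOn_dY hop (ep up um) hq, show P.a q = ap q from ep _ _ hq]
    · dsimp only
      rw [eqOn_dX hom (em up um) hq, eqOn_dY hom (em up um) hq, show P.a q = am q from em _ _ hq]
  · rintro p ⟨hp, -⟩
    have hpΩ : p ∉ P.Ω := by
      rw [P.isOpen_Ω.frontier_eq] at hp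
      exact hp.2
    rw [hΩ] at hpΩ
    -- Both supports lie in the open square, so the glued function is zero near each boundary point.
    have h1 := notMem_tsupport_iff_eventuallyEq.mp fun h => hpΩ (hups h)
    have h2 := notMem_tsupport_iff_eventuallyEq.mp fun h => hpΩ (hums h)
    refine tendsto_const_nhds.congr' (Filter.EventuallyEq.filter_mono ?_ nhdsWithin_le_nhds)
    filter_upwards [h1, h2] with q hq1 hq2
    simp [glue, hq1, hq2, hP, gluedProblem]

end Glued

/-! ### Curves in the plane -/

/-- With the whole plane as region, the one-sided chain rules apply to functions that are smooth
everywhere. -/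
lemma isBoundaryCurve_univ {r s : ℝ → ℝ} (hr : ContDiff ℝ ∞ r) (hs : ContDiff ℝ ∞ s) :
    IsBoundaryCurve univ univ 0 r s univ where
  isOpen_region := isOpen_univ
  isOpen_interval := isOpen_univ
  smooth_r := hr.contDiffOn
  smooth_s := hs.contDiffOn
  mem _ _ := mem_univ _
  push _ _ := ⟨0, Eventually.of_forall fun _ => mem_univ _⟩

lemma sideDeriv_univ {v : ℝ × ℝ → ℝ} (hv : ContDiff ℝ ∞ v) (p : ℝ × ℝ) :
    sideDeriv univ v p = pdArray v p := by
  funext m n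
  exact sideDeriv_of_eqOn isOpen_univ hv (fun _ _ => rfl) (by simp) m n

lemma trace_univ {v : ℝ × ℝ → ℝ} (hv : ContDiff ℝ ∞ v) (r s : ℝ → ℝ) (t : ℝ) :
    trace univ v 0 r s t = v (r t, s t) := by
  rw [trace, sideDeriv_univ hv, zero_add]
  rfl

lemma smoothUpToOrder_univ {v : ℝ × ℝ → ℝ} (hv : ContDiff ℝ ∞ v) (K : ℕ) :
    SmoothUpToOrder K univ univ v :=
  (smoothUpTo_of_eqOn isOpen_univ hv fun _ _ => rfl).smoothUpToOrder K

lemma contDiff_trace_univ {v : ℝ × ℝ → ℝ} (hv : ContDiff ℝ ∞ v) {r s : ℝ → ℝ}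
    (hr : ContDiff ℝ ∞ r) (hs : ContDiff ℝ ∞ s) : ContDiff ℝ ∞ (trace univ v 0 r s) := by
  rw [funext (trace_univ hv r s)]
  exact hv.comp (hr.prodMk hs)

lemma contDiff_deriv {r : ℝ → ℝ} (hr : ContDiff ℝ ∞ r) : ContDiff ℝ ∞ (deriv r) :=
  contDiffOn_univ.mp (contDiffOn_deriv isOpen_univ hr.contDiffOn)

lemma contDiff_fluxTrace_univ {a u : ℝ × ℝ → ℝ} (ha : ContDiff ℝ ∞ a) (hu : ContDiff ℝ ∞ u)
    {r s : ℝ → ℝ} (hr : ContDiff ℝ ∞ r) (hs : ContDiff ℝ ∞ s) :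
    ContDiff ℝ ∞ (fluxTrace univ a u 0 r s) :=
  ((contDiff_trace_univ (ha.mul (contDiff_dX hu)) hr hs).mul (contDiff_deriv hs)).sub
    ((contDiff_trace_univ (ha.mul (contDiff_dY hu)) hr hs).mul (contDiff_deriv hr))

lemma iteratedDeriv_trace_univ {v : ℝ × ℝ → ℝ} (hv : ContDiff ℝ ∞ v) {r s : ℝ → ℝ}
    (hr : ContDiff ℝ ∞ r) (hs : ContDiff ℝ ∞ s) (hr0 : r 0 = 0) (hs0 : s 0 = 0) (k : ℕ) :
    iteratedDeriv k (trace univ v 0 r s) 0 =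
      tr (fun i => iteratedDeriv i r 0) (fun i => iteratedDeriv i s 0) k (pdArray v 0) := by
  rw [(isBoundaryCurve_univ hr hs).iteratedDeriv_trace (smoothUpToOrder_univ hv k) (mem_univ 0)
    le_rfl, hr0, hs0, zero_add, sideDeriv_univ hv]
  rfl

lemma iteratedDeriv_fluxTrace_univ {a u : ℝ × ℝ → ℝ} (ha : ContDiff ℝ ∞ a)
    (hu : ContDiff ℝ ∞ u) {r s : ℝ → ℝ} (hr : ContDiff ℝ ∞ r) (hs : ContDiff ℝ ∞ s)
    (hr0 : r 0 = 0) (hs0 : s 0 = 0) (k : ℕ) :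
    iteratedDeriv k (fluxTrace univ a u 0 r s) 0 =
      fl (fun i => iteratedDeriv i r 0) (fun i => iteratedDeriv i s 0) (pdArray a 0) k
        (pdArray u 0) := by
  rw [(isBoundaryCurve_univ hr hs).iteratedDeriv_fluxTrace (smoothUpToOrder_univ ha k)
    (smoothUpToOrder_univ hu (k + 1)) (mem_univ 0) le_rfl, hr0, hs0, zero_add, sideDeriv_univ ha,
    sideDeriv_univ hu]
  rfl

lemma iteratedDeriv_mul_eq_zero {f g : ℝ → ℝ} {t : ℝ} {K : ℕ} (hf : ContDiffAt ℝ ∞ f t)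
    (hg : ContDiffAt ℝ ∞ g t) (h : ∀ k ≤ K, iteratedDeriv k f t = 0) {k : ℕ} (hk : k ≤ K) :
    iteratedDeriv k (f * g) t = 0 := by
  have hle : (k : WithTop ℕ∞) ≤ ∞ := by exact_mod_cast le_top
  rw [iteratedDeriv_mul (hf.of_le hle) (hg.of_le hle)]
  refine Finset.sum_eq_zero fun i hi => ?_
  rw [Finset.mem_range] at hi
  rw [h i (by omega), mul_zero, zero_mul]

/-! ### Realization of the data -/

/-- Multiplication by a cutoff function gives a function with compact support and the same
derivatives at `0`. -/
lemma exists_cutoff {η : ℝ} (hη : 0 < η) {v : ℝ × ℝ → ℝ} (hv : ContDiff ℝ ∞ v) :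
    ∃ w : ℝ × ℝ → ℝ, ContDiff ℝ ∞ w ∧ HasCompactSupport w ∧ tsupport w ⊆ Metric.ball 0 η ∧
      ∀ m n, pd m n w 0 = pd m n v 0 := by
  -- The outer radius `η / 2` keeps the closed support inside the open ball of radius `η`.
  let χ : ContDiffBump (0 : ℝ × ℝ) := ⟨η / 3, η / 2, by positivity, by linarith⟩
  refine ⟨fun q => χ q * v q, χ.contDiff.mul hv, χ.hasCompactSupport.mul_right, ?_, fun m n => ?_⟩
  · refine (tsupport_mul_subset_left (f := χ) (g := v)).trans ?_
    rw [χ.tsupport_eq]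
    exact Metric.closedBall_subset_ball (by change η / 2 < η; linarith)
  · refine pd_congr_of_eventuallyEq ?_ m n
    filter_upwards [χ.eventuallyEq_one] with q hq
    rw [hq, Pi.one_apply, one_mul]

/-! ### Construction of a problem with prescribed data -/

namespace Jet.Admissible

variable {M : ℕ} {J : Jet M}

lemma plus_data_of_jet_eq (hJ : J.Admissible) (hM : 1 ≤ M) {P : InterfaceProblem}
    {u : ℝ × ℝ → ℝ} {b : ℝ × ℝ} {r s : ℝ → ℝ} (hjet : P.jet M b r s = J) (hP : P.Regular)
    (hu : P.IsSolution (M + 1) u) (hb : b ∈ P.Γ) :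
    hJ.plus hM (P.data M u b r s) = res (Lam (M + 1)) (sideDeriv P.Ωp u b) := by
  subst hjet
  exact plus_data hJ hM hP hu hb

lemma minus_data_of_jet_eq (hJ : J.Admissible) (hM : 1 ≤ M) {P : InterfaceProblem}
    {u : ℝ × ℝ → ℝ} {b : ℝ × ℝ} {r s : ℝ → ℝ} (hjet : P.jet M b r s = J) (hP : P.Regular)
    (hu : P.IsSolution (M + 1) u) (hb : b ∈ P.Γ) (hpar : P.IsParam b r s) :
    hJ.minus hM (P.data M u b r s) = res (Lam (M + 1)) (sideDeriv P.Ωm u b) := by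
  subst hjet
  exact minus_data hJ hM hP hu hb hpar

lemma tr_minus (hJ : J.Admissible) (hM : 1 ≤ M) (d : TransmissionData M) {k : ℕ}
    (hk : k ≤ M + 1) :
    tr J.rho J.sig k (ext _ (hJ.minus hM d)) =
      tr J.rho J.sig k (ext _ (hJ.plus hM d)) - tr J.rho J.sig k (ext _ d.2.2.2.1) :=
  congrFun (congrArg (fun x => x.2.1)
    ((cauchyEquiv hJ.reg hJ.amArray_pos.ne' hM).apply_symm_apply _)) ⟨k, by omega⟩

lemma fl_minus (hJ : J.Admissible) (hM : 1 ≤ M) (d : TransmissionData M) {k : ℕ} (hk : k ≤ M) :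
    fl J.rho J.sig J.amArray k (ext _ (hJ.minus hM d)) =
      fl J.rho J.sig J.apArray k (ext _ (hJ.plus hM d))
        - gr J.rho J.sig J.spd k (ext _ d.2.2.2.2) :=
  congrFun (congrArg (fun x => x.2.2)
    ((cauchyEquiv hJ.reg hJ.amArray_pos.ne' hM).apply_symm_apply _)) ⟨k, by omega⟩

/-- Data with the same derivatives of the solution and the same jumps are equal. -/
lemma data_ext (hJ : J.Admissible) (hM : 1 ≤ M) {d d' : TransmissionData M}
    (hp : hJ.plus hM d = hJ.plus hM d') (hm : hJ.minus hM d = hJ.minus hM d')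
    (h₁ : d.2.2.2.1 = d'.2.2.2.1) (h₂ : d.2.2.2.2 = d'.2.2.2.2) : d = d' := by
  -- `plus` and `minus` are inverse equivalences applied to tuples containing `-f_+` and `-f_-`;
  -- injectivity recovers these sources and the entries of `u_+`.
  have e1 := (leftEquiv hJ.apArray_pos.ne' hM).symm.injective hp
  have e2 := (cauchyEquiv hJ.reg hJ.amArray_pos.ne' hM).symm.injective hm
  rw [Prod.mk.injEq] at e1 e2
  exact Prod.ext e1.1 (Prod.ext (neg_injective e1.2) (Prod.ext (neg_injective e2.1)
    (Prod.ext h₁ h₂)))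

/-- All data are realized by solutions of interface problems with the given jet. -/
lemma exists_data_eq (hJ : J.Admissible) (hM : 1 ≤ M) (d : TransmissionData M) :
    ∃ (P : InterfaceProblem) (u : ℝ × ℝ → ℝ) (b : ℝ × ℝ) (r s : ℝ → ℝ),
      P.Regular ∧ P.IsSolution (M + 1) u ∧ b ∈ P.Γ ∧ P.IsParam b r s ∧
        P.jet M b r s = J ∧ P.data M u b r s = d := by
  set r := taylorPoly J.rho (M + 1) with hr_def
  set s := taylorPoly J.sig (M + 1) with hs_def
  have hr : ContDiff ℝ ∞ r := contDiff_taylorPoly _ _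
  have hs : ContDiff ℝ ∞ s := contDiff_taylorPoly _ _
  have hrk : ∀ k ≤ M + 1, iteratedDeriv k r 0 = J.rho k := fun k hk =>
    iteratedDeriv_taylorPoly _ hk
  have hsk : ∀ k ≤ M + 1, iteratedDeriv k s 0 = J.sig k := fun k hk =>
    iteratedDeriv_taylorPoly _ hk
  have hr0 : r 0 = 0 := by simpa [hJ.rho_zero] using hrk 0 (by omega)
  have hs0 : s 0 = 0 := by simpa [hJ.sig_zero] using hsk 0 (by omega)
  have hr1 : deriv r 0 = J.rho 1 := by simpa [iteratedDeriv_one] using hrk 1 (by omega)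
  have hs1 : deriv s 0 = J.sig 1 := by simpa [iteratedDeriv_one] using hsk 1 (by omega)
  have hreg0 : 0 < deriv r 0 ^ 2 + deriv s 0 ^ 2 := by rw [hr1, hs1]; exact hJ.reg
  obtain ⟨U, τ, ψ, hU, h0U, hτ, hψ, hτ0, hΓ, hpos, hnor, htan, hcur⟩ :=
    exists_straightening hr hs hr0 hs0 hreg0
  set ap := taylorPoly₂ J.apArray M with hap_def
  set am := taylorPoly₂ J.amArray M with ham_def
  have hap : ContDiff ℝ ∞ ap := contDiff_taylorPoly₂ _ _
  have ham : ContDiff ℝ ∞ am := contDiff_taylorPoly₂ _ _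
  have hapk : ∀ m n, m + n ≤ M → pd m n ap 0 = J.apArray m n := fun m n h => pd_taylorPoly₂ _ h
  have hamk : ∀ m n, m + n ≤ M → pd m n am 0 = J.amArray m n := fun m n h => pd_taylorPoly₂ _ h
  have hap0 : 0 < ap 0 := by
    rw [← pd_zero_zero ap, hapk 0 0 (Nat.zero_le _)]; exact hJ.apArray_pos
  have ham0 : 0 < am 0 := by
    rw [← pd_zero_zero am, hamk 0 0 (Nat.zero_le _)]; exact hJ.amArray_pos
  -- The square must lie in the straightened neighbourhood, and both polynomial coefficients must be
  -- positive on it.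
  obtain ⟨η, hη, hball⟩ := Metric.nhds_basis_ball.mem_iff.mp
    (inter_mem (hU.mem_nhds h0U) (inter_mem
      (hap.continuous.continuousAt.eventually (lt_mem_nhds hap0))
      (ham.continuous.continuousAt.eventually (lt_mem_nhds ham0))))
  have hBU : Metric.ball 0 η ⊆ U := fun q hq => (hball hq).1
  have h0B : (0 : ℝ × ℝ) ∈ Metric.ball 0 η := Metric.mem_ball_self hη
  obtain ⟨up, hup, hupc, hups, hupk⟩ := exists_cutoff hη
    (contDiff_taylorPoly₂ (ext _ (hJ.plus hM d)) (M + 1))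
  obtain ⟨um, hum, humc, hums, humk⟩ := exists_cutoff hη
    (contDiff_taylorPoly₂ (ext _ (hJ.minus hM d)) (M + 1))
  set q₁ := taylorPoly₂ (ext _ d.2.2.2.1) (M + 1) with hq₁_def
  set q₂ := taylorPoly₂ (ext _ d.2.2.2.2) M with hq₂_def
  have hq₁ : ContDiff ℝ ∞ q₁ := contDiff_taylorPoly₂ _ _
  have hq₂ : ContDiff ℝ ∞ q₂ := contDiff_taylorPoly₂ _ _
  have hupk' : ∀ m n, m + n ≤ M + 1 → pd m n up 0 = ext _ (hJ.plus hM d) m n := fun m n h => by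
    rw [hupk, pd_taylorPoly₂ _ h]
  have humk' : ∀ m n, m + n ≤ M + 1 → pd m n um 0 = ext _ (hJ.minus hM d) m n := fun m n h => by
    rw [humk, pd_taylorPoly₂ _ h]
  have hq₁k : ∀ m n, m + n ≤ M + 1 → pd m n q₁ 0 = ext _ d.2.2.2.1 m n := fun m n h =>
    pd_taylorPoly₂ _ h
  have hq₂k : ∀ m n, m + n ≤ M → pd m n q₂ 0 = ext _ d.2.2.2.2 m n := fun m n h =>
    pd_taylorPoly₂ _ h
  -- the defect of the first jump condition
  set δ₁ : ℝ → ℝ := trace univ up 0 r s - trace univ um 0 r s - trace univ q₁ 0 r s with hδ₁_def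
  have hTp := contDiff_trace_univ hup hr hs
  have hTm := contDiff_trace_univ hum hr hs
  have hT₁ := contDiff_trace_univ hq₁ hr hs
  have hT₂ := contDiff_trace_univ hq₂ hr hs
  have hδ₁ : ContDiff ℝ ∞ δ₁ := (hTp.sub hTm).sub hT₁
  have hle : ∀ k : ℕ, (k : WithTop ℕ∞) ≤ ∞ := fun k => by exact_mod_cast le_top
  have hδ₁k : ∀ k ≤ M + 1, iteratedDeriv k δ₁ 0 = 0 := by
    intro k hk
    have key : ∀ {v : ℝ × ℝ → ℝ} {c : DerivArray}, ContDiff ℝ ∞ v →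
        (∀ m n, m + n ≤ M + 1 → pd m n v 0 = c m n) →
        iteratedDeriv k (trace univ v 0 r s) 0 = tr J.rho J.sig k c := fun hv hc => by
      rw [iteratedDeriv_trace_univ hv hr hs hr0 hs0]
      exact tr_congr (fun i hi => hrk i (hi.trans hk)) (fun i hi => hsk i (hi.trans hk))
        fun i j hij => hc i j (hij.trans hk)
    rw [hδ₁_def, iteratedDeriv_sub (f := trace univ up 0 r s - trace univ um 0 r s)
      (g := trace univ q₁ 0 r s) ((hTp.sub hTm).contDiffAt.of_le (hle k))
      (hT₁.contDiffAt.of_le (hle k)), iteratedDeriv_sub (hTp.contDiffAt.of_le (hle k))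
      -- The array of `um` solves the Cauchy system, so the trace relation `tr_minus` cancels the
      -- defect at each order up to `M + 1`.
      (hTm.contDiffAt.of_le (hle k)), key hup hupk', key hum humk', key hq₁ hq₁k,
      hJ.tr_minus hM d hk]
    ring
  -- the defect of the second jump condition
  set F : ℝ → ℝ := fluxTrace univ ap up 0 r s - fluxTrace univ am um 0 r s
    - trace univ q₂ 0 r s * speed r s with hF_def
  set I : Set ℝ := {t | 0 < deriv r t ^ 2 + deriv s t ^ 2} with hI_def
  have hIo : IsOpen I := isOpen_lt continuous_const
    (((contDiff_deriv hr).continuous.pow 2).add ((contDiff_deriv hs).continuous.pow 2))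
  have hspd : ∀ t ∈ I, ContDiffAt ℝ ∞ (speed r s) t := fun t ht =>
    contDiffAt_speed hr.contDiffAt hs.contDiffAt ht
  have hspd0 : ∀ t ∈ I, 0 < speed r s t := fun t ht => Real.sqrt_pos.mpr ht
  have hFp := contDiff_fluxTrace_univ hap hup hr hs
  have hFm := contDiff_fluxTrace_univ ham hum hr hs
  have hF : ∀ t ∈ I, ContDiffAt ℝ ∞ F t := fun t ht =>
    (hFp.contDiffAt.sub hFm.contDiffAt).sub (hT₂.contDiffAt.mul (hspd t ht))
  have h0I : (0 : ℝ) ∈ I := hreg0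
  have hFk : ∀ k ≤ M, iteratedDeriv k F 0 = 0 := by
    intro k hk
    have hρ : ∀ i ≤ k + 1, iteratedDeriv i r 0 = J.rho i := fun i hi => hrk i (by omega)
    have hς : ∀ i ≤ k + 1, iteratedDeriv i s 0 = J.sig i := fun i hi => hsk i (by omega)
    rw [hF_def, iteratedDeriv_sub (f := fluxTrace univ ap up 0 r s - fluxTrace univ am um 0 r s)
      (g := trace univ q₂ 0 r s * speed r s) ((hFp.sub hFm).contDiffAt.of_le (hle k))
      ((hT₂.contDiffAt.mul (hspd 0 h0I)).of_le (hle k)),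
      iteratedDeriv_sub (hFp.contDiffAt.of_le (hle k)) (hFm.contDiffAt.of_le (hle k)),
      iteratedDeriv_fluxTrace_univ hap hup hr hs hr0 hs0,
      iteratedDeriv_fluxTrace_univ ham hum hr hs hr0 hs0,
      fl_congr (a := pdArray ap 0) (c := pdArray up 0) hρ hς (fun i j hij => hapk i j (hij.trans hk))
        (fun i j hij => hupk' i j (by omega)),
      fl_congr (a := pdArray am 0) (c := pdArray um 0) hρ hς (fun i j hij => hamk i j (hij.trans hk))
        (fun i j hij => humk' i j (by omega)), hJ.fl_minus hM d hk,
      iteratedDeriv_mul (hT₂.contDiffAt.of_le (hle k)) ((hspd 0 h0I).of_le (hle k)), gr_apply]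
    rw [sub_sub_cancel, sub_eq_zero]
    refine Finset.sum_congr rfl fun j hj => ?_
    rw [Finset.mem_range] at hj
    rw [iteratedDeriv_trace_univ hq₂ hr hs hr0 hs0,
      tr_congr (c := pdArray q₂ 0) (fun i hi => hρ i (by omega)) (fun i hi => hς i (by omega))
        fun i l hil => hq₂k i l (by omega)]
    rw [show J.spd (k - j) = iteratedDeriv (k - j) (speed r s) 0 from rfl]
    ring
  -- `F` is the defect of the flux condition multiplied by the speed; dividing by the speed gives
  -- the correction to `g₂` and preserves the vanishing at `0`.
  set δ₂ : ℝ → ℝ := F * fun t => (speed r s t)⁻¹ with hδ₂_def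
  have hδ₂ : ContDiffOn ℝ ∞ δ₂ I := fun t ht =>
    ((hF t ht).mul ((hspd t ht).inv (hspd0 t ht).ne')).contDiffWithinAt
  have hδ₂k : ∀ k ≤ M, iteratedDeriv k δ₂ 0 = 0 := fun k hk =>
    iteratedDeriv_mul_eq_zero (hF 0 h0I) ((hspd 0 h0I).inv (hspd0 0 h0I).ne') hFk hk
  have hτB : ContDiffOn ℝ ∞ τ (Metric.ball 0 η) := hτ.mono hBU
  -- The velocity at `τ q` has positive scalar product with the velocity at `0`, so it is not zero.
  have hτI : MapsTo τ (Metric.ball 0 η) I := fun q hq => by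
    have h1 := hpos q (hBU hq)
    by_contra h2
    have h3 : deriv r (τ q) ^ 2 + deriv s (τ q) ^ 2 ≤ 0 := not_lt.mp h2
    have h4 : deriv r (τ q) = 0 := by
      nlinarith [sq_nonneg (deriv r (τ q)), sq_nonneg (deriv s (τ q))]
    have h5 : deriv s (τ q) = 0 := by
      nlinarith [sq_nonneg (deriv r (τ q)), sq_nonneg (deriv s (τ q))]
    rw [h4, h5] at h1
    simp at h1
  -- On `Γ` the added term is exactly the defect, as `q` is the curve point with parameter `τ q`; at
  -- the base point its derivatives vanish to the order that matters.
  set g₁ : ℝ × ℝ → ℝ := fun q => q₁ q + δ₁ (τ q) with hg₁_def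
  set g₂ : ℝ × ℝ → ℝ := fun q => q₂ q + δ₂ (τ q) with hg₂_def
  have hE₁ : ContDiffOn ℝ ∞ (fun q => δ₁ (τ q)) (Metric.ball 0 η) := hδ₁.comp_contDiffOn hτB
  have hE₂ : ContDiffOn ℝ ∞ (fun q => δ₂ (τ q)) (Metric.ball 0 η) := hδ₂.comp hτB hτI
  have hgrad : ∀ q ∈ Metric.ball 0 η, (dX ψ q, dY ψ q) ≠ (0, 0) := fun q hq h0 => by
    have h1 := hnor q (hBU hq)
    rw [Prod.mk.injEq] at h0
    rw [h0.1, h0.2] at h1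
    norm_num at h1
  have hReg : (gluedProblem η ψ ap am up um g₁ g₂).Regular :=
    gluedProblem_regular (hψ.mono hBU) hgrad hap ham (fun q hq => (hball hq).2.1)
      (fun q hq => (hball hq).2.2) hup hum (hq₁.contDiffOn.add hE₁) (hq₂.contDiffOn.add hE₂)
  have hΩ := gluedProblem_Ω (η := η) (ψ := ψ) (ap := ap) (am := am) (up := up) (um := um)
    (g₁ := g₁) (g₂ := g₂)
  have hD : ∀ q ∈ U, 0 < dX ψ q * deriv s (τ q) - dY ψ q * deriv r (τ q) := fun q hq => by
    have h1 := hnor q hq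
    have h2 := htan q hq
    have h3 := hpos q hq
    -- As `∇ψ` is orthogonal to the velocity at `τ q`, its cross product there is a positive
    -- multiple of its cross product with the velocity at `0`, which is `1` by `hnor`.
    have h4 : (dX ψ q * deriv s (τ q) - dY ψ q * deriv r (τ q)) *
        (deriv r (τ q) * deriv r 0 + deriv s (τ q) * deriv s 0) =
        deriv r (τ q) ^ 2 + deriv s (τ q) ^ 2 := by
      linear_combination (deriv r (τ q) ^ 2 + deriv s (τ q) ^ 2) * h1
        + (deriv s (τ q) * deriv r 0 - deriv r (τ q) * deriv s 0) * h2
    have h5 : 0 < deriv r (τ q) ^ 2 + deriv s (τ q) ^ 2 := by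
      rcases not_and_or.mp (fun hh : deriv r (τ q) = 0 ∧ deriv s (τ q) = 0 => by
        rw [hh.1, hh.2] at h3; simp at h3) with h | h
      · exact add_pos_of_pos_of_nonneg (sq_pos_of_ne_zero h) (sq_nonneg _)
      · exact add_pos_of_nonneg_of_pos (sq_nonneg _) (sq_pos_of_ne_zero h)
    exact (mul_pos_iff_of_pos_right h3).mp (h4 ▸ h5)
  set P := gluedProblem η ψ ap am up um g₁ g₂ with hP
  have hΓ' : ∀ p ∈ P.Γ, p ∈ Metric.ball (0 : ℝ × ℝ) η ∧ p = (r (τ p), s (τ p)) := fun p hp => by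
    have hpB : p ∈ Metric.ball (0 : ℝ × ℝ) η := hΩ ▸ hp.1
    exact ⟨hpB, hΓ p (hBU hpB) hp.2⟩
  have hSol : P.IsSolution (M + 1) (glue ψ up um) := by
    refine gluedProblem_isSolution hReg hap ham hup hum hupc humc hups hums (fun p hp => ?_)
      (fun p hp n hn => ?_) _
    · obtain ⟨-, hpτ⟩ := hΓ' p hp
      simp only [hg₁_def, hδ₁_def, Pi.sub_apply, trace_univ hup, trace_univ hum, trace_univ hq₁,
        ← hpτ]
      ring
    · obtain ⟨hpB, hpτ⟩ := hΓ' p hp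
      have hN := hspd0 _ (hτI hpB)
      have h1 := (InterfaceProblem.normal_eq (P := P) (hgrad p hpB) (hτI hpB) (htan p (hBU hpB))
        (Real.sign_of_pos (hD p (hBU hpB)))).1
      rw [hn] at h1
      have hTX : ∀ {a u : ℝ × ℝ → ℝ}, ContDiff ℝ ∞ a → ContDiff ℝ ∞ u →
          fluxTrace univ a u 0 r s (τ p) =
            a p * dX u p * deriv s (τ p) - a p * dY u p * deriv r (τ p) := fun ha hu => by
        simp only [fluxTrace, Pi.sub_apply, Pi.mul_apply, trace_univ (ha.mul (contDiff_dX hu)),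
          trace_univ (ha.mul (contDiff_dY hu)), ← hpτ]
      simp only [hg₂_def, hδ₂_def, hF_def, Pi.sub_apply, Pi.mul_apply, hTX hap hup, hTX ham hum,
        trace_univ hq₂, ← hpτ]
      rw [h1]
      change ap p * (_ * (_ / speed r s (τ p)) + _ * (_ / speed r s (τ p)))
        - am p * (_ * (_ / speed r s (τ p)) + _ * (_ / speed r s (τ p))) = _
      field_simp
      ring
  have hb : (0 : ℝ × ℝ) ∈ P.Γ := by
    refine ⟨by rw [hΩ]; exact h0B, ?_⟩
    have := hcur.self_of_nhds
    rwa [hr0, hs0] at this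
  have hPar : P.IsParam 0 r s := by
    refine ⟨hr0, hs0, ?_⟩
    have hc : ContinuousAt (fun t => (r t, s t)) 0 := by
      exact (hr.continuous.prodMk hs.continuous).continuousAt
    have h0c : (r 0, s 0) ∈ Metric.ball (0 : ℝ × ℝ) η := by rw [hr0, hs0]; exact h0B
    obtain ⟨ε, hε, h⟩ := Metric.eventually_nhds_iff_ball.mp
      ((hIo.eventually_mem h0I).and
        ((hc.eventually (Metric.isOpen_ball.eventually_mem h0c)).and hcur))
    rw [Real.ball_eq_Ioo, zero_sub, zero_add] at h
    refine ⟨ε, hε, hr.contDiffOn, hs.contDiffOn, fun t ht => ?_⟩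
    obtain ⟨h1, h2, h3⟩ := h t ht
    refine ⟨h1, ?_⟩
    rw [zero_add]
    exact ⟨by rw [hΩ]; exact h2, h3⟩
  have hsideP : ∀ {v w : ℝ × ℝ → ℝ}, ContDiff ℝ ∞ v → ∀ m n,
      sideDeriv P.Ωp (glue ψ v w) 0 m n = pd m n v 0 := fun hv m n =>
    sideDeriv_of_eqOn hReg.isOpen_pos hv (eqOn_glue_pos _ _ fun q hq => hq.2)
      (hReg.subset_closure_pos hb) m n
  have hsideM : ∀ {v w : ℝ × ℝ → ℝ}, ContDiff ℝ ∞ w → ∀ m n,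
      sideDeriv P.Ωm (glue ψ v w) 0 m n = pd m n w 0 := fun hw m n =>
    sideDeriv_of_eqOn hReg.isOpen_neg hw (eqOn_glue_neg _ _ fun q hq => hq.2)
      (hReg.subset_closure_neg hb) m n
  have hjet : P.jet M 0 r s = J := by
    refine Jet.ext ?_ ?_ ?_ ?_
    · funext k
      exact (hrk k (by omega)).trans (dif_pos k.2)
    · funext k
      exact (hsk k (by omega)).trans (dif_pos k.2)
    · funext i
      exact (hsideP hap _ _).trans ((hapk _ _ (mem_Lam.mp i.2)).trans (ext_apply_mem _ i.2))
    · funext i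
      exact (hsideM ham _ _).trans ((hamk _ _ (mem_Lam.mp i.2)).trans (ext_apply_mem _ i.2))
  have hor : P.orientation 0 r s = 1 := by
    have h1 : Real.sign (dX ψ 0 * deriv s 0 - dY ψ 0 * deriv r 0) = 1 := by
      rw [hnor 0 h0U, Real.sign_one]
    exact h1
  have hg : ∀ {q e : ℝ × ℝ → ℝ} {K m n : ℕ}, ContDiff ℝ ∞ q →
      ContDiffOn ℝ ∞ e (Metric.ball 0 η) → m + n ≤ K → pd m n e 0 = 0 →
      pd m n (fun x => q x + e x) 0 = pd m n q 0 := fun {q e K m n} hq he hmn h0 => by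
    rw [pd_add (K := K) Metric.isOpen_ball (hq.contDiffOn.of_le (hle K)) (he.of_le (hle K)) hmn h0B]
    simp [h0]
  -- By `data_ext` only the arrays of `u_±` and the derivatives of `g₁`, `g₂` are compared; the
  -- sources then agree automatically.
  refine ⟨P, glue ψ up um, 0, r, s, hReg, hSol, hb, hPar, hjet, hJ.data_ext hM ?_ ?_ ?_ ?_⟩
  · rw [hJ.plus_data_of_jet_eq hM hjet hReg hSol hb]
    funext i
    exact (hsideP hup _ _).trans ((hupk' _ _ (mem_Lam.mp i.2)).trans (ext_apply_mem _ i.2))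
  · rw [hJ.minus_data_of_jet_eq hM hjet hReg hSol hb hPar]
    funext i
    exact (hsideM hum _ _).trans ((humk' _ _ (mem_Lam.mp i.2)).trans (ext_apply_mem _ i.2))
  · funext i
    have hi := mem_Lam.mp i.2
    refine (hg hq₁ hE₁ hi ?_).trans ((hq₁k _ _ hi).trans (ext_apply_mem _ i.2))
    exact pd_comp_eq_zero Metric.isOpen_ball isOpen_univ hτB (mapsTo_univ _ _) hδ₁.contDiffOn h0B
      (K := M + 1) (by rw [hτ0]; exact hδ₁k) hi
  · funext i
    have hi := mem_Lam.mp i.2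
    change P.orientation 0 r s * pd i.1.1 i.1.2 g₂ 0 = _
    rw [hor, one_mul]
    refine (hg hq₂ hE₂ hi ?_).trans ((hq₂k _ _ hi).trans (ext_apply_mem _ i.2))
    exact pd_comp_eq_zero Metric.isOpen_ball hIo hτB hτI hδ₂ h0B
      (K := M) (by rw [hτ0]; exact hδ₂k) hi

end Jet.Admissible

end

end EllipticInterface

theorem mainTheorem2 (M : ℕ) (hM : 1 ≤ M) (J : Jet M) (hJ : J.Admissible) :
    ∃! T : Transmission M,
      ∀ (P : InterfaceProblem) (u : ℝ × ℝ → ℝ) (b : ℝ × ℝ) (r s : ℝ → ℝ),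
        P.Regular → P.IsSolution (M + 1) u → b ∈ P.Γ → P.IsParam b r s →
        P.jet M b r s = J → T.Holds P u b r s := by
  obtain ⟨T, hT⟩ := hJ.exists_holds hM
  -- For realized data both families evaluate to the derivatives of the same `u_-`. Since all data
  -- are realized, the two linear maps coincide, and so do their coefficients.
  refine ⟨T, hT, fun T' hT' => Transmission.eval_injective fun d => ?_⟩
  obtain ⟨P, u, b, r, s, hP, hu, hb, hpar, hjet, rfl⟩ := hJ.exists_data_eq hM d
  exact ((T'.holds_iff P u b r s).mp (hT' P u b r s hP hu hb hpar hjet)).symm.trans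
    ((T.holds_iff P u b r s).mp (hT P u b r s hP hu hb hpar hjet))
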